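/- For even $k\ge 4$ let $E_k(z)=\frac12\sum_{(c,d)=1}(cz+d)^{-k}$ be the normalised Eisenstein series of weight $k$ for $SL_2(\mathbb Z)$, and let $\Delta_{k,\ell}=E_kE_\ell-E_{k+\ell}$. Let $A_{k,\ell}$ be the number of distinct zeros of $\Delta_{k,\ell}$ on the arc $\{e^{i\theta}:\pi/3<\theta<\pi/2\}$ and $B_{k,\ell}$ the number of distinct zeros on the half-line $x=1/2$, $y>\sqrt3/2$. For $0\le j<12$ put $$sp_j(\ell)=\begin{cases}\frac{\ell-1+\sqrt{3\ell^2-1}}{2}, & \ell\equiv 0,\ j\equiv 2 \pmod 6,\\ 2\ell, & \ell\equiv 4,\ j\equiv 2\pmod 6,\\ \frac{4\ell-1+\sqrt{12\ell^2-12\ell+1}}{2}, & \ell\equiv 4,\ j\equiv 0 \pmod 6,\\ \ell, & \text{otherwise.}\end{cases}$$ There is a constant $L$ such that for all even integers $k\ge\ell\ge \max(L,4)$ with $k-\ell=12n+j$, $n\ge 1$, $0\le j<12$, and $k\ge sp_j(\ell)$, the following hold. (1) $A_{k,\ell}+B_{k,\ell}\ \ge\ n+\lfloor \ell/6\rfloor-c_{j,\ell}$,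 where $c_{j,\ell}$ is given by the table $$\begin{array}{c|ccc} j\,\backslash\,\ell \bmod 6 & 0&2&4\\ \hline 0&1&1&1\\ 2&2&1&1\\ 4&1&1&0\\ 6&1&1&1\\ 8&1&0&0\\ 10&1&1&0\end{array}$$ (2) The value $n+\lfloor \ell/6\rfloor-c_{j,\ell}$ is the number of nontrivial zeros of a cusp form of weight $w=k+\ell$: for every nonzero cusp form $f$ of weight $w$ for $SL_2(\mathbb Z)$, $$ (v_\infty(f)-1)+\tfrac12\big(v_i(f)-\epsilon_w\big)+\tfrac13\big(v_\rho(f)-\delta_w\big)+\sum_{z\in SL_2(\mathbb Z)\backslash\mathbb H,\ z\ne i,\rho}v_z(f)\ =\ n+\lfloor \ell/6\rfloor-c_{j,\ell},$$ where $v_z$ and $v_\infty$ denote orders of vanishing (at $\infty$ with respect to $q=e^{2\pi i z}$), $\rho=e^{\pi i/3}$, and $\epsilon_w\in\{0,1\}$, $\delta_w\in\{0,1,2\}$, determined by $w\equiv 6\epsilon_w+4\delta_w \pmod{12}$, are the orders at $i$ and $\rho$ of the trivial zeros, i.e. those that the valence formula forces on forms of weight $w$. -/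

import Mathlib

open scoped UpperHalfPlane MatrixGroups

namespace EisensteinZeros

noncomputable section

/-- `Δ_{k,ℓ} = E_k E_ℓ - E_{k+ℓ}`, where `E_k = (1/2) ∑_{(c,d)=1} (c z + d)^{-k}` is the
normalised Eisenstein series of weight `k` for `SL(2, ℤ)`. -/
def Delta {k l : ℕ} (hk : 4 ≤ k) (hl : 4 ≤ l) (z : ℍ) : ℂ :=
  ModularForm.E (show 3 ≤ k by omega) z * ModularForm.E (show 3 ≤ l by omega) z
    - ModularForm.E (show 3 ≤ k + l by omega) z

/-- Zeros of `f` on the open arc `{ e^{iθ} : π/3 < θ < π/2 }`. -/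
def arcZeros (f : ℍ → ℂ) : Set ℍ :=
  {z | (∃ θ : ℝ, Real.pi / 3 < θ ∧ θ < Real.pi / 2 ∧
    (z : ℂ) = Complex.exp ((θ : ℂ) * Complex.I)) ∧ f z = 0}

/-- Zeros of `f` on the open half-line `x = 1/2`, `y > √3/2`. -/
def sideZeros (f : ℍ → ℂ) : Set ℍ :=
  {z | z.re = 1 / 2 ∧ Real.sqrt 3 / 2 < z.im ∧ f z = 0}

/-- `A_{k,ℓ}`: the number of (distinct) zeros of `Δ_{k,ℓ}` on the arc. -/
def A {k l : ℕ} (hk : 4 ≤ k) (hl : 4 ≤ l) : ℕ := (arcZeros (Delta hk hl)).ncard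

/-- `B_{k,ℓ}`: the number of (distinct) zeros of `Δ_{k,ℓ}` on the side. -/
def B {k l : ℕ} (hk : 4 ≤ k) (hl : 4 ≤ l) : ℕ := (sideZeros (Delta hk hl)).ncard

/-- The stabilisation point `sp_j(ℓ)`. -/
def sp (j l : ℕ) : ℝ :=
  if l % 6 = 0 ∧ j % 6 = 2 then ((l : ℝ) - 1 + Real.sqrt (3 * (l : ℝ) ^ 2 - 1)) / 2
  else if l % 6 = 4 ∧ j % 6 = 2 then 2 * (l : ℝ)
  else if l % 6 = 4 ∧ j % 6 = 0 then
    (4 * (l : ℝ) - 1 + Real.sqrt (12 * (l : ℝ) ^ 2 - 12 * (l : ℝ) + 1)) / 2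
  else (l : ℝ)

/-- The integer `c` in the table entry `n + ⌊ℓ/6⌋ - c`; the first argument is `j`, the second is
`ℓ mod 6`. Only the eighteen listed entries are ever used. -/
def tableOffset : ℕ → ℕ → ℤ
  | 0, 0 => 1
  | 0, 2 => 1
  | 0, 4 => 1
  | 2, 0 => 2
  | 2, 2 => 1
  | 2, 4 => 1
  | 4, 0 => 1
  | 4, 2 => 1
  | 4, 4 => 0
  | 6, 0 => 1
  | 6, 2 => 1
  | 6, 4 => 1
  | 8, 0 => 1
  | 8, 2 => 0
  | 8, 4 => 0
  | 10, 0 => 1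
  | 10, 2 => 1
  | 10, 4 => 0
  | _, _ => 0

/-- The table value `n + ⌊ℓ/6⌋ - c`, an integer. -/
def tableValue (n j l : ℕ) : ℤ := (n : ℤ) + ((l / 6 : ℕ) : ℤ) - tableOffset j (l % 6)

/-- The point `e^{πi/3} = 1/2 + i √3/2`. -/
def rho : ℍ := ⟨⟨1 / 2, Real.sqrt 3 / 2⟩, by positivity⟩

/-- The order of vanishing of `f` at `z`. -/
def ord (f : ℍ → ℂ) (z : ℍ) : ℕ := analyticOrderNatAt (f ∘ UpperHalfPlane.ofComplex) (z : ℂ)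

/-- The order of vanishing of `f` at the cusp `∞`, read off the expansion in `q = e^{2πiz}`. -/
def ordInfty (f : ℍ → ℂ) : ℕ := (UpperHalfPlane.qExpansion 1 f).order.toNat

/-- A strict fundamental domain for `SL(2, ℤ)` acting on `ℍ`: the closed domain `|z| ≥ 1`,
`|x| ≤ 1/2` with the left half of its boundary (`x = -1/2`, or `|z| = 1` and `x < 0`) removed. -/
def strictFundamentalDomain : Set ℍ :=
  {z | 1 ≤ ‖(z : ℂ)‖ ∧ -(1 / 2) < z.re ∧ z.re ≤ 1 / 2 ∧ (‖(z : ℂ)‖ = 1 → 0 ≤ z.re)}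

/-- The order of vanishing at `i` which the valence formula
`w/12 = v_∞ + v_i/2 + v_ρ/3 + ∑ v_z` forces on every form of even weight `w`. -/
def forcedOrdI (w : ℕ) : ℕ := if w % 4 = 2 then 1 else 0

/-- The order of vanishing at `ρ = e^{πi/3}` which the valence formula forces on every form of
even weight `w`: the unique `r ∈ {0, 1, 2}` with `w ≡ 6 * forcedOrdI w + 4 * r (mod 12)`. -/
def forcedOrdRho (w : ℕ) : ℕ := w % 3

/-- The number of nontrivial zeros of a weight `w` cusp form `f`, that is, of the zeros modulo
`SL(2, ℤ)` (including `∞`) other than the trivial ones: the simple zero at `∞` forced by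
cuspidality and the zeros at `i` and `ρ` forced by the valence formula. Zeros are counted
with multiplicity, and with the weights `1/2` at `i` and `1/3` at `ρ`, as in the valence formula. -/
def nontrivialZeroCount (w : ℕ) (f : ℍ → ℂ) : ℚ :=
  ((ordInfty f : ℚ) - 1)
    + ((ord f UpperHalfPlane.I : ℚ) - forcedOrdI w) / 2
    + ((ord f rho : ℚ) - forcedOrdRho w) / 3
    + ((∑ᶠ z ∈ strictFundamentalDomain \ {UpperHalfPlane.I, rho}, ord f z : ℕ) : ℚ)

end

end EisensteinZeros

/-! ### Even negative moments determine an even integer weight on the plane -/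

namespace EisensteinZeros

open Filter Topology

/-! The bound (1) comes from counting sign changes, and (2) is the valence formula, proved here
without contour integration.

Sign changes. Put w = k + ℓ. By modularity and complex conjugation, e^{iwθ/2} Δ(e^{iθ}) is real on
the arc and Δ is real on x = 1/2, so the intermediate value theorem finds zeros. Keeping the lattice
vectors ±1, ±z, ±(z - 1) makes e^{ikθ/2} E_k(e^{iθ}) equal to 2cos(kθ/2) plus a damped term, and
2cos(a)·2cos(b) - 2cos(a + b) = 2cos(a - b). Hence Δ has sign (-1)^m at θ = 2πm/(k - ℓ)
(`exists_arcVal_pos`). On the half-line write z = e^{iφ}/(2cos φ). Up to height of order √ℓ the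
terms z^{-ℓ} and (z - 1)^{-ℓ} dictate the sign, which is (-1)^m at φ = πm/ℓ. Higher up, the
Lipschitz formula turns the row c = ±1 of E_ℓ into an alternating series ∑ (-1)^n n^{ℓ-1} e^{-2πny},
and at y = (ℓ - 1)/(2πm) its m-th term dominates. Together these give the samples of
`exists_sideVal_sideSample_pos`.

The gaps at ρ. Between ρ and the first sample on either line a further zero may lie. In the disc
coordinate u = (z - ρ)/(z - ρ̄) the Taylor coefficients of E_k at ρ are lattice sums close to 3 or
equal to 0, according to the sixfold symmetry. The coefficient `deltaCoef` of u^{w mod 3} therefore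
fixes the signs of Δ near ρ on both lines, once it is known not to vanish
(`exists_deltaCoef_re_ne_zero`). Except when k ≡ 0 and ℓ ≡ 0 or 2 mod 6, a parity check shows that
exactly one of the two gaps has a sign change, whichever sign the coefficient has, so A + B does not
depend on it. When k ≡ ℓ ≡ 0 mod 6 the coefficient is positive and both gaps have one
(`exists_deltaCoef_re_pos`). When k ≡ 0 and ℓ ≡ 2 mod 6 the table needs neither.

Valence formula. For f of weight w, f^12 = Δ^w P(j) with deg P ≤ w and j = E₄³/Δ, by repeatedly
removing the constant term and dividing by Δ. Splitting P reduces the formula to the forms E₄³ - cΔ.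
These vanish on exactly one orbit, because j is a bijection from the fundamental domain to ℂ.
Surjectivity: a missed value c would make Δ/(E₄³ - cΔ) a weight-0 form vanishing at ∞. Injectivity:
E₄ and E₆ determine all E_k up to scaling, these are the even moments of the primitive lattice
vectors, and the moments determine the lattice. Multiplicities follow because 2E₄E₆' - 3E₆E₄' is a
nonzero multiple of Δ, which never vanishes on ℍ. -/

/-- Cesàro means of the powers of a point of the closed unit disc other than `1` tend to `0`. -/
lemma tendsto_average_pow {u : ℂ} (hu : ‖u‖ ≤ 1) (h1 : u ≠ 1) :
    Tendsto (fun N : ℕ => (∑ m ∈ Finset.range N, u ^ m) / (N : ℂ)) atTop (𝓝 0) := by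
  have hb : ∀ N : ℕ, ‖(∑ m ∈ Finset.range N, u ^ m) / (N : ℂ)‖ ≤ 2 / ‖u - 1‖ / N := by
    intro N
    rw [geom_sum_eq h1, norm_div, norm_div, Complex.norm_natCast]
    gcongr
    calc ‖u ^ N - 1‖ ≤ ‖u ^ N‖ + ‖(1 : ℂ)‖ := norm_sub_le _ _
      _ ≤ 1 + 1 := by
        rw [norm_pow, norm_one]
        gcongr
        exact pow_le_one₀ (norm_nonneg _) hu
      _ = 2 := by norm_num
  exact squeeze_zero_norm hb (tendsto_const_div_atTop_nhds_zero_nat _)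

lemma norm_average_pow_le {u : ℂ} (hu : ‖u‖ ≤ 1) (N : ℕ) :
    ‖(∑ m ∈ Finset.range N, u ^ m) / (N : ℂ)‖ ≤ 1 := by
  rw [norm_div, Complex.norm_natCast]
  rcases Nat.eq_zero_or_pos N with rfl | hN
  · simp
  rw [div_le_one (by positivity)]
  refine (norm_sum_le _ _).trans ?_
  calc ∑ m ∈ Finset.range N, ‖u ^ m‖ ≤ ∑ _m ∈ Finset.range N, (1 : ℝ) := by
        gcongr with m _
        rw [norm_pow]
        exact pow_le_one₀ (norm_nonneg _) hu
    _ = N := by simp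

/-- An even integer weight on `ℂ` all of whose even negative moments of order at least `4` vanish
is zero. -/
lemma eq_zero_of_even_moments (g : ℂ → ℤ) (h0 : g 0 = 0) (heven : ∀ x, g (-x) = g x)
    (hs : Summable fun x => ‖(g x : ℂ) * (x⁻¹) ^ 4‖)
    (hm : ∀ m : ℕ, ∑' x, (g x : ℂ) * (x⁻¹) ^ (4 + 2 * m) = 0) : g = 0 := by
  by_contra hne
  obtain ⟨x0, hx0⟩ : ∃ x, g x ≠ 0 := by
    by_contra! h
    exact hne (funext h)
  have hnz : ∀ x, g x ≠ 0 → x ≠ 0 := fun x hx h => hx (h ▸ h0)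
  -- Summability forces the terms to 0, while a nonzero integer weight has modulus at least 1. So
  -- only finitely many support points have norm at most that of `x0`, and a shortest support point
  -- exists.
  have hfin : {x | g x ≠ 0 ∧ ‖x‖ ≤ ‖x0‖}.Finite := by
    have h4 : 0 < (‖x0‖⁻¹) ^ 4 := by
      have := norm_pos_iff.mpr (hnz x0 hx0)
      positivity
    have := hs.tendsto_cofinite_zero.eventually (gt_mem_nhds h4)
    refine (Filter.eventually_cofinite.mp this).subset ?_
    rintro x ⟨hx, hxn⟩
    simp only [Set.mem_ofPred_eq, not_lt, norm_mul, norm_pow, norm_inv]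
    have h1 : (1 : ℝ) ≤ ‖(g x : ℂ)‖ := by
      rw [Complex.norm_intCast]
      exact_mod_cast Int.one_le_abs hx
    have hxp := norm_pos_iff.mpr (hnz x hx)
    calc (‖x0‖⁻¹) ^ 4 = 1 * (‖x0‖⁻¹) ^ 4 := (one_mul _).symm
      _ ≤ ‖(g x : ℂ)‖ * (‖x‖⁻¹) ^ 4 := by gcongr
  obtain ⟨v, ⟨hv, hvx⟩, hvmin⟩ := Set.exists_min_image _ (fun x => ‖x‖) hfin ⟨x0, hx0, le_rfl⟩
  have hmin : ∀ x, g x ≠ 0 → ‖v‖ ≤ ‖x‖ := by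
    intro x hx
    by_cases h : ‖x‖ ≤ ‖x0‖
    · exact hvmin x ⟨hx, h⟩
    · exact hvx.trans (le_of_not_ge h)
  have hv0 := hnz v hv
  -- On the support |u| ≤ 1, with u = 1 only at ±v. Averaging the first N rescaled moments inserts
  -- the Cesàro mean of the powers of u, so N → ∞ isolates the two points ±v and leaves 2 g(v) = 0.
  set u : ℂ → ℂ := fun x => (v * x⁻¹) ^ 2 with hu
  have hule : ∀ x, g x ≠ 0 → ‖u x‖ ≤ 1 := by
    intro x hx
    have hxp := norm_pos_iff.mpr (hnz x hx)
    simp only [hu, norm_pow, norm_mul, norm_inv]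
    refine pow_le_one₀ (by positivity) ?_
    rw [← div_eq_mul_inv, div_le_one hxp]
    exact hmin x hx
  set F : ℕ → ℂ → ℂ := fun N x => (g x : ℂ) * (v * x⁻¹) ^ 4 *
    ((∑ m ∈ Finset.range N, u x ^ m) / (N : ℂ)) with hF
  classical
  set G : ℂ → ℂ := fun x => if u x = 1 then (g x : ℂ) * (v * x⁻¹) ^ 4 else 0 with hG
  have hFsum : ∀ N, ∑' x, F N x = 0 := by
    intro N
    have hsm : ∀ m : ℕ, Summable fun x => (g x : ℂ) * (v * x⁻¹) ^ (4 + 2 * m) := by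
      intro m
      refine Summable.of_norm_bounded (hs.mul_left (‖v‖ ^ 4)) ?_
      intro x
      by_cases hx : g x = 0
      · simp [hx]
      have h1 : ‖(u x) ^ m‖ ≤ 1 := by
        rw [norm_pow]; exact pow_le_one₀ (norm_nonneg _) (hule x hx)
      calc ‖(g x : ℂ) * (v * x⁻¹) ^ (4 + 2 * m)‖
          = ‖v‖ ^ 4 * ‖(g x : ℂ) * x⁻¹ ^ 4‖ * ‖(u x) ^ m‖ := by
            simp only [hu, pow_add, norm_mul, norm_pow, mul_pow, pow_mul]; ring
        _ ≤ ‖v‖ ^ 4 * ‖(g x : ℂ) * x⁻¹ ^ 4‖ * 1 := by gcongr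
        _ = _ := mul_one _
    have hz : ∀ m : ℕ, ∑' x, (g x : ℂ) * (v * x⁻¹) ^ (4 + 2 * m) = 0 := by
      intro m
      have : ∀ x, (g x : ℂ) * (v * x⁻¹) ^ (4 + 2 * m)
          = v ^ (4 + 2 * m) * ((g x : ℂ) * (x⁻¹) ^ (4 + 2 * m)) := by
        intro x; rw [mul_pow]; ring
      simp_rw [this, tsum_mul_left, hm m, mul_zero]
    have : ∀ x, F N x = ∑ m ∈ Finset.range N,
        (N : ℂ)⁻¹ * ((g x : ℂ) * (v * x⁻¹) ^ (4 + 2 * m)) := by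
      intro x
      simp only [hF, hu, div_eq_mul_inv, Finset.sum_mul, Finset.mul_sum]
      refine Finset.sum_congr rfl fun m _ => ?_
      rw [pow_add, pow_mul]; ring
    simp_rw [this]
    rw [Summable.tsum_finsetSum fun m _ => (hsm m).mul_left _]
    simp [tsum_mul_left, hz]
  have hlim : Tendsto (fun N => ∑' x, F N x) atTop (𝓝 (∑' x, G x)) := by
    refine tendsto_tsum_of_dominated_convergence (hs.mul_left (‖v‖ ^ 4)) ?_ ?_
    · intro x
      simp only [hF, hG]
      by_cases hx : g x = 0
      · simp [hx]
      split_ifs with h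
      · simp only [h, one_pow, Finset.sum_const, Finset.card_range, nsmul_eq_mul, mul_one]
        refine tendsto_const_nhds.congr' ?_
        filter_upwards [eventually_gt_atTop 0] with N hN
        rw [div_self (by exact_mod_cast hN.ne'), mul_one]
      · simpa using (tendsto_average_pow (hule x hx) h).const_mul ((g x : ℂ) * (v * x⁻¹) ^ 4)
    · refine Eventually.of_forall fun N x => ?_
      by_cases hx : g x = 0
      · simp [hF, hx]
      calc ‖F N x‖ = ‖v‖ ^ 4 * ‖(g x : ℂ) * x⁻¹ ^ 4‖ *
            ‖(∑ m ∈ Finset.range N, u x ^ m) / (N : ℂ)‖ := by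
            simp only [hF, norm_mul, norm_pow, mul_pow]; ring
        _ ≤ ‖v‖ ^ 4 * ‖(g x : ℂ) * x⁻¹ ^ 4‖ * 1 := by
            gcongr; exact norm_average_pow_le (hule x hx) N
        _ = _ := mul_one _
  have hG0 : ∑' x, G x = 0 := by
    refine tendsto_nhds_unique hlim ?_
    simp [hFsum]
  have hGsum : ∑' x, G x = ∑ x ∈ ({v, -v} : Finset ℂ), G x := by
    refine tsum_eq_sum fun x hx => ?_
    simp only [hG]
    split_ifs with h
    · exfalso
      apply hx
      have hx0 : x ≠ 0 := by
        rintro rfl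
        simp [hu] at h
      rcases sq_eq_sq_iff_eq_or_eq_neg.mp (h.trans (one_pow 2).symm) with h | h
      all_goals simp
      · left; field_simp at h; exact h.symm
      · right; field_simp at h; rw [h, neg_neg]
    · rfl
  have hvne : v ≠ -v := by
    intro h
    exact hv0 (self_eq_neg.mp h)
  rw [hG0, Finset.sum_pair hvne] at hGsum
  have h1 : G v = g v := by simp [hG, hu, hv0]
  have h2 : G (-v) = g v := by simp [hG, hu, hv0, heven, Even.neg_pow (show Even 4 by decide)]
  rw [h1, h2, ← two_mul] at hGsum
  apply hv
  have : (g v : ℂ) = 0 := by simpa using hGsum.symm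
  exact_mod_cast this

end EisensteinZeros

/-! ### Eisenstein series as moments of primitive lattice vectors -/

namespace EisensteinZeros

open Filter Topology EisensteinSeries ModularForm UpperHalfPlane

/-- The lattice vector `c z + d` attached to the integer pair `v = (c, d)`. -/
noncomputable def latVec (z : ℍ) (v : Fin 2 → ℤ) : ℂ := v 0 * (z : ℂ) + v 1

lemma latVec_injective (z : ℍ) : Function.Injective (latVec z) := by
  intro v w h
  have him := congrArg Complex.im h
  have hre := congrArg Complex.re h
  simp only [latVec, Complex.add_im, Complex.mul_im, Complex.intCast_re, Complex.intCast_im,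
    zero_mul, add_zero, Complex.add_re, Complex.mul_re, sub_zero] at him hre
  have h0 : ((v 0 : ℤ) : ℝ) = w 0 := mul_right_cancel₀ z.im_ne_zero him
  rw [h0] at hre
  have h1 : ((v 1 : ℤ) : ℝ) = w 1 := by linarith
  ext i
  fin_cases i
  · exact_mod_cast h0
  · exact_mod_cast h1

lemma latVec_neg (z : ℍ) (v : Fin 2 → ℤ) : latVec z (-v) = -latVec z v := by
  simp [latVec]; ring

lemma latVec_zero (z : ℍ) : latVec z 0 = 0 := by simp [latVec]

lemma ne_zero_of_mem_gammaSet {v : Fin 2 → ℤ} (hv : v ∈ gammaSet 1 1 0) : v ≠ 0 := by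
  rintro rfl
  rw [mem_gammaSet_one] at hv
  exact not_isCoprime_zero_zero hv

lemma latVec_ne_zero (z : ℍ) {v : Fin 2 → ℤ} (hv : v ≠ 0) : latVec z v ≠ 0 := fun h =>
  hv (latVec_injective z (h.trans (latVec_zero z).symm))

lemma neg_mem_gammaSet {v : Fin 2 → ℤ} (hv : v ∈ gammaSet 1 1 0) : -v ∈ gammaSet 1 1 0 := by
  rw [mem_gammaSet_one] at hv ⊢
  simpa using hv.neg_neg

lemma E_apply_eq_tsum {k : ℕ} (hk : 3 ≤ k) (z : ℍ) :
    E hk z = 1 / 2 * ∑' v : gammaSet 1 1 0, ((latVec z v)⁻¹) ^ k := by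
  have : E hk z = 1 / 2 * ∑' v : gammaSet 1 1 0, eisSummand k v z := rfl
  rw [this]
  simp [eisSummand, latVec, zpow_neg, inv_pow]

lemma summable_norm_latVec {k : ℕ} (hk : 3 ≤ k) (z : ℍ) :
    Summable fun v : Fin 2 → ℤ => ‖((latVec z v)⁻¹) ^ k‖ := by
  have := summable_norm_eisSummand (k := k) (by exact_mod_cast hk) z
  simpa [eisSummand, latVec, zpow_neg, inv_pow] using this

/-- Scaled primitive vectors of the lattice `ℤ z + ℤ`. -/
def primSet (c : ℂ) (z : ℍ) : Set ℂ := Set.range fun v : gammaSet 1 1 0 => c * latVec z v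

lemma neg_mem_primSet {c : ℂ} {z : ℍ} {x : ℂ} (hx : x ∈ primSet c z) : -x ∈ primSet c z := by
  obtain ⟨v, rfl⟩ := hx
  exact ⟨⟨-v, neg_mem_gammaSet v.2⟩, by simp [latVec_neg]⟩

lemma zero_notMem_primSet {c : ℂ} (hc : c ≠ 0) (z : ℍ) : (0 : ℂ) ∉ primSet c z := by
  rintro ⟨v, hv⟩
  exact mul_ne_zero hc (latVec_ne_zero z (ne_zero_of_mem_gammaSet v.2)) hv

lemma mul_latVec_injective {c : ℂ} (hc : c ≠ 0) (z : ℍ) :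
    Function.Injective fun v : gammaSet 1 1 0 => c * latVec z v := fun _ _ h =>
  Subtype.ext (latVec_injective z (mul_left_cancel₀ hc h))

open Classical in
lemma summable_primSet {c : ℂ} (hc : c ≠ 0) (z : ℍ) {k : ℕ} (hk : 3 ≤ k) :
    Summable fun x : ℂ => (primSet c z).indicator (fun x => (x⁻¹) ^ k) x := by
  rw [← summable_subtype_iff_indicator]
  rw [primSet, ← (Equiv.ofInjective _ (mul_latVec_injective hc z)).summable_iff]
  have h1 : Summable fun v : gammaSet 1 1 0 => ((latVec z v)⁻¹) ^ k :=
    (summable_norm_iff.mp (summable_norm_latVec hk z)).subtype _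
  refine (h1.mul_left ((c⁻¹) ^ k)).congr fun v => ?_
  simp [mul_pow, mul_comm]

open Classical in
lemma tsum_primSet {c : ℂ} (hc : c ≠ 0) (z : ℍ) {k : ℕ} (hk : 3 ≤ k) :
    ∑' x : ℂ, (primSet c z).indicator (fun x => (x⁻¹) ^ k) x = 2 * (c⁻¹) ^ k * E hk z := by
  rw [← tsum_subtype, primSet, tsum_range (fun x : ℂ => (x⁻¹) ^ k) (mul_latVec_injective hc z),
    E_apply_eq_tsum]
  simp only [mul_inv, mul_pow, tsum_mul_left]
  ring

/-- If all even Eisenstein series at `z₀`, `z₁` agree up to the scaling `c`, then the scaled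
lattices have the same primitive vectors. -/
lemma primSet_eq_of_E_eq {z₀ z₁ : ℍ} {c : ℂ} (hc : c ≠ 0)
    (h : ∀ (k : ℕ) (hk : 3 ≤ k), Even k → E hk z₁ = c ^ k * E hk z₀) :
    primSet 1 z₁ = primSet c⁻¹ z₀ := by
  classical
  have hc' := inv_ne_zero hc
  -- The difference of the two indicator functions is an even integer weight. Its moment of order k
  -- is 2 E_k(z₁) - 2 c^k E_k(z₀), which vanishes for even k by hypothesis.
  set g : ℂ → ℤ := fun x => (primSet 1 z₁).indicator 1 x - (primSet c⁻¹ z₀).indicator 1 x with hg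
  have hgk : ∀ (k : ℕ) (x : ℂ), (g x : ℂ) * (x⁻¹) ^ k =
      (primSet 1 z₁).indicator (fun x => (x⁻¹) ^ k) x
        - (primSet c⁻¹ z₀).indicator (fun x => (x⁻¹) ^ k) x := by
    intro k x
    simp only [hg, Set.indicator_apply]
    split_ifs <;> simp
  have hmem : ∀ (c : ℂ) (z : ℍ) (x : ℂ), -x ∈ primSet c z ↔ x ∈ primSet c z := fun c z x =>
    ⟨fun hx => by simpa using neg_mem_primSet hx, neg_mem_primSet⟩
  have hg0 : g = 0 := by
    refine eq_zero_of_even_moments g ?_ ?_ ?_ ?_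
    · simp [hg, Set.indicator_apply, zero_notMem_primSet one_ne_zero z₁,
        zero_notMem_primSet hc' z₀]
    · intro x
      simp only [hg, Set.indicator_apply, hmem, Pi.one_apply]
    · simp_rw [hgk]
      exact ((summable_primSet one_ne_zero z₁ (by norm_num)).sub
        (summable_primSet hc' z₀ (by norm_num))).norm
    · intro m
      simp_rw [hgk]
      have h3 : 3 ≤ 4 + 2 * m := by omega
      rw [(summable_primSet one_ne_zero z₁ h3).tsum_sub (summable_primSet hc' z₀ h3),
        tsum_primSet one_ne_zero z₁ h3, tsum_primSet hc' z₀ h3,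
        h _ h3 ⟨2 + m, by ring⟩]
      simp
      ring
  ext x
  have hx := congrFun hg0 x
  simp only [hg, Set.indicator_apply, Pi.one_apply, Pi.zero_apply] at hx
  by_cases h1 : x ∈ primSet 1 z₁ <;> by_cases h2 : x ∈ primSet c⁻¹ z₀ <;> simp_all

/-- Points whose scaled lattices have the same primitive vectors are `SL(2, ℤ)`-equivalent. -/
lemma exists_smul_eq_of_primSet_eq {z₀ z₁ : ℍ} {c : ℂ} (hc : c ≠ 0)
    (h : primSet 1 z₁ = primSet c⁻¹ z₀) : ∃ γ : SL(2, ℤ), γ • z₀ = z₁ := by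
  have hcop1 : (![0, 1] : Fin 2 → ℤ) ∈ gammaSet 1 1 0 := by
    rw [mem_gammaSet_one]; exact isCoprime_one_right
  have hcop2 : (![1, 0] : Fin 2 → ℤ) ∈ gammaSet 1 1 0 := by
    rw [mem_gammaSet_one]; exact isCoprime_one_left
  have key : ∀ v : Fin 2 → ℤ, v ∈ gammaSet 1 1 0 → ∃ w : Fin 2 → ℤ, c * latVec z₁ v = latVec z₀ w := by
    intro v hv
    have : latVec z₁ v ∈ primSet c⁻¹ z₀ := by
      rw [← h]; exact ⟨⟨v, hv⟩, by simp⟩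
    obtain ⟨w, hw⟩ := this
    refine ⟨w, ?_⟩
    simp only at hw
    rw [← hw]; field_simp
  have key' : ∀ v : Fin 2 → ℤ, v ∈ gammaSet 1 1 0 → ∃ w : Fin 2 → ℤ, latVec z₀ v = c * latVec z₁ w := by
    intro v hv
    have : c⁻¹ * latVec z₀ v ∈ primSet 1 z₁ := by
      rw [h]; exact ⟨⟨v, hv⟩, rfl⟩
    obtain ⟨w, hw⟩ := this
    refine ⟨w, ?_⟩
    simp only [one_mul] at hw
    rw [hw]; field_simp
  obtain ⟨p, hp⟩ := key _ hcop2
  obtain ⟨q, hq⟩ := key _ hcop1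
  obtain ⟨r, hr⟩ := key' _ hcop2
  obtain ⟨s, hs⟩ := key' _ hcop1
  -- Each of the two lattice bases is an integer combination of the other, so the two coefficient
  -- matrices are inverse to each other and their determinants are units.
  have e1 : c * z₁ = p 0 * z₀ + p 1 := by simpa [latVec] using hp
  have e2 : c = q 0 * z₀ + q 1 := by simpa [latVec] using hq
  have e3 : (z₀ : ℂ) = c * (r 0 * z₁ + r 1) := by simpa [latVec] using hr
  have e4 : (1 : ℂ) = c * (s 0 * z₁ + s 1) := by simpa [latVec] using hs
  have f1 : latVec z₀ ![r 0 * p 0 + r 1 * q 0, r 0 * p 1 + r 1 * q 1] = latVec z₀ ![1, 0] := by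
    simp only [latVec, Matrix.cons_val_zero, Matrix.cons_val_one]
    push_cast
    linear_combination (-(r 0 : ℂ)) * e1 - (r 1 : ℂ) * e2 - e3
  have f2 : latVec z₀ ![s 0 * p 0 + s 1 * q 0, s 0 * p 1 + s 1 * q 1] = latVec z₀ ![0, 1] := by
    simp only [latVec, Matrix.cons_val_zero, Matrix.cons_val_one]
    push_cast
    linear_combination (-(s 0 : ℂ)) * e1 - (s 1 : ℂ) * e2 - e4
  have g1 := latVec_injective z₀ f1
  have g2 := latVec_injective z₀ f2
  have a1 : r 0 * p 0 + r 1 * q 0 = 1 := by simpa using congrFun g1 0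
  have a2 : r 0 * p 1 + r 1 * q 1 = 0 := by simpa using congrFun g1 1
  have a3 : s 0 * p 0 + s 1 * q 0 = 0 := by simpa using congrFun g2 0
  have a4 : s 0 * p 1 + s 1 * q 1 = 1 := by simpa using congrFun g2 1
  have hdet : (r 0 * s 1 - r 1 * s 0) * (p 0 * q 1 - p 1 * q 0) = 1 := by
    have : (r 0 * s 1 - r 1 * s 0) * (p 0 * q 1 - p 1 * q 0)
      = (r 0 * p 0 + r 1 * q 0) * (s 0 * p 1 + s 1 * q 1)
        - (r 0 * p 1 + r 1 * q 1) * (s 0 * p 0 + s 1 * q 0) := by ring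
    rw [this, a1, a2, a3, a4]; norm_num
  have hne : (q 0 : ℂ) * z₀ + q 1 ≠ 0 := e2 ▸ hc
  have hz : (z₁ : ℂ) = (p 0 * z₀ + p 1) / (q 0 * z₀ + q 1) := by
    rw [eq_div_iff hne, ← e2, mul_comm, e1]
  -- The imaginary part of a Möbius image carries the determinant as a factor. Positivity of both
  -- imaginary parts rules out determinant -1.
  have him : z₁.im * Complex.normSq (q 0 * z₀ + q 1) = ((p 0 * q 1 - p 1 * q 0 : ℤ) : ℝ) * z₀.im := by
    have h1 : (z₁ : ℂ) * Complex.normSq (q 0 * z₀ + q 1)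
        = (p 0 * z₀ + p 1) * (starRingEnd ℂ) (q 0 * z₀ + q 1) := by
      rw [← Complex.mul_conj, hz, ← mul_assoc, div_mul_cancel₀ _ hne]
    have h2 := congrArg Complex.im h1
    simp only [Complex.im_mul_ofReal] at h2
    rw [← UpperHalfPlane.coe_im, h2]
    simp
    ring
  have hdpos : (0 : ℝ) < ((p 0 * q 1 - p 1 * q 0 : ℤ) : ℝ) := by
    have h1 : 0 < z₁.im * Complex.normSq (q 0 * z₀ + q 1) :=
      mul_pos z₁.im_pos (Complex.normSq_pos.mpr hne)
    rw [him] at h1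
    exact (pos_iff_pos_of_mul_pos h1).mpr z₀.im_pos
  have hd1 : p 0 * q 1 - p 1 * q 0 = 1 := by
    have h0 : 0 < p 0 * q 1 - p 1 * q 0 := by exact_mod_cast hdpos
    rcases Int.eq_one_or_neg_one_of_mul_eq_one' hdet with h1 | h1
    · exact h1.2
    · omega
  set γ : SL(2, ℤ) := ⟨!![p 0, p 1; q 0, q 1], by rw [Matrix.det_fin_two_of]; exact hd1⟩ with hγ
  refine ⟨γ, ?_⟩
  ext1
  rw [UpperHalfPlane.coe_specialLinearGroup_apply, hz]
  simp [hγ]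

end EisensteinZeros

/-! ### The invariant j: separation of orbits, and polynomials in j -/

namespace EisensteinZeros

open Filter Topology EisensteinSeries ModularForm UpperHalfPlane

/-- A level one form is a multiple of a given form with constant term `1` plus `Δ` times a form of
weight lower by `12`. -/
lemma exists_eq_mul_add_discriminant_mul {k : ℤ} (f g : ModularForm 𝒮ℒ k)
    (hg : (qExpansion 1 g).coeff 0 = 1) :
    ∃ (c : ℂ) (h : ModularForm 𝒮ℒ (k - 12)), ∀ z, f z = c * g z + discriminant z * h z := by
  obtain ⟨φ, hφ⟩ := sub_smul_isCuspForm f g hg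
  refine ⟨(qExpansion 1 f).coeff 0, CuspForm.discriminantEquiv φ, fun z => ?_⟩
  rw [discriminant_mul_discriminantEquiv_apply]
  have : φ z = f z - (qExpansion 1 f).coeff 0 * g z := congrArg (fun F : ModularForm 𝒮ℒ k => F z) hφ
  rw [this]; ring

lemma coeff_zero_E₄_pow_mul_E₆_pow (a b : ℕ) :
    (qExpansion 1 ((E₄.pow a).mul (E₆.pow b))).coeff 0 = 1 := by
  rw [ModularForm.qExpansion_mul one_pos one_mem_strictPeriods_SL,
    ModularForm.qExpansion_pow one_pos one_mem_strictPeriods_SL,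
    ModularForm.qExpansion_pow one_pos one_mem_strictPeriods_SL]
  have h4 := E_qExpansion_coeff_zero (k := 4) (by norm_num) (by decide)
  have h6 := E_qExpansion_coeff_zero (k := 6) (by norm_num) (by decide)
  rw [PowerSeries.coeff_zero_eq_constantCoeff] at h4 h6 ⊢
  simp [h4, h6]

lemma exists_four_mul_add_six_mul {k : ℕ} (hk : Even k) (h4 : 4 ≤ k) : ∃ a b, 4 * a + 6 * b = k := by
  obtain ⟨r, rfl⟩ := hk
  rcases Nat.even_or_odd' r with ⟨s, rfl | rfl⟩
  · exact ⟨s, 0, by ring⟩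
  · exact ⟨s - 1, 1, by omega⟩

/-- If `E₄` and `E₆` scale by `c ^ 4`, `c ^ 6` from `z₀` to `z₁`, every level one form of weight `k`
scales by `c ^ k`. -/
lemma scaling_of_E₄_E₆ {z₀ z₁ : ℍ} {c : ℂ} (h4 : E₄ z₁ = c ^ 4 * E₄ z₀) (h6 : E₆ z₁ = c ^ 6 * E₆ z₀)
    (k : ℕ) (f : ModularForm 𝒮ℒ (k : ℤ)) : f z₁ = c ^ k * f z₀ := by
  have hΔ : discriminant z₁ = c ^ 12 * discriminant z₀ := by
    rw [discriminant_eq_E₄_cube_sub_E₆_sq, discriminant_eq_E₄_cube_sub_E₆_sq, h4, h6]; ring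
  -- Removing a multiple of E₄^a E₆^b leaves Δ times a form of weight k - 12, which is zero for k <
  -- 12 and otherwise falls to the induction hypothesis. Odd weights and the weights 0 and 2 are
  -- settled directly.
  induction k using Nat.strong_induction_on with
  | _ k ih =>
    rcases Nat.even_or_odd k with hk | hk
    swap
    · rw [ModularForm.levelOne_odd_weight_eq_zero (by exact_mod_cast hk) f]; simp
    by_cases hk4 : 4 ≤ k
    · obtain ⟨a, b, hab⟩ := exists_four_mul_add_six_mul hk hk4
      obtain ⟨t, h, hf⟩ := exists_eq_mul_add_discriminant_mul f
        (ModularForm.mcast (by rw [← hab]; push_cast; ring) ((E₄.pow a).mul (E₆.pow b)))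
        (coeff_zero_E₄_pow_mul_E₆_pow a b)
      rw [hf, hf]
      simp only [coe_mcast, coe_mul, coe_pow, Pi.mul_apply, Pi.pow_apply, h4, h6, hΔ]
      rcases lt_or_ge k 12 with hlt | hge
      · have h0 : (h : ℍ → ℂ) = 0 := ModularFormClass.levelOne_neg_weight_eq_zero (by omega) h
        simp only [h0, Pi.zero_apply, ← hab]
        ring
      · have := ih (k - 12) (by omega) (h.mcast (by omega))
        simp only [coe_mcast] at this
        rw [this]
        have hk' : c ^ k = c ^ 12 * c ^ (k - 12) := by rw [← pow_add]; congr 1; omega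
        have hk'' : c ^ k = (c ^ 4) ^ a * (c ^ 6) ^ b := by
          rw [← pow_mul, ← pow_mul, ← pow_add, hab]
        rw [mul_pow, mul_pow]
        linear_combination (-(t * (E₄ z₀ ^ a * E₆ z₀ ^ b))) * hk'' -
          (discriminant z₀ * h z₀) * hk'
    · have : k = 0 ∨ k = 2 := by
        obtain ⟨r, rfl⟩ := hk; omega
      rcases this with rfl | rfl
      · obtain ⟨a, ha⟩ := ModularFormClass.levelOne_weight_zero_const f
        simp [ha]
      · rw [rank_zero_iff_forall_zero.mp levelOne_weight_two_rank_zero f]; simp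

lemma E₄_ne_zero_or_E₆_ne_zero (z : ℍ) : E₄ z ≠ 0 ∨ E₆ z ≠ 0 := by
  by_contra! h
  apply discriminant_ne_zero z
  rw [discriminant_eq_E₄_cube_sub_E₆_sq, h.1, h.2]; norm_num

/-- The modular invariant `E₄³ / Δ`. -/
noncomputable def jInv (z : ℍ) : ℂ := E₄ z ^ 3 / discriminant z

/-- The modular invariant separates `SL(2, ℤ)`-orbits. -/
theorem exists_smul_eq_of_jInv_eq {z₀ z₁ : ℍ} (h : jInv z₁ = jInv z₀) :
    ∃ γ : SL(2, ℤ), γ • z₀ = z₁ := by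
  have d0 := discriminant_ne_zero z₀
  have d1 := discriminant_ne_zero z₁
  have hcross : E₄ z₁ ^ 3 * discriminant z₀ = E₄ z₀ ^ 3 * discriminant z₁ := by
    simpa [jInv, div_eq_div_iff d1 d0] using h
  have hcross6 : E₄ z₁ ^ 3 * E₆ z₀ ^ 2 = E₄ z₀ ^ 3 * E₆ z₁ ^ 2 := by
    rw [discriminant_eq_E₄_cube_sub_E₆_sq, discriminant_eq_E₄_cube_sub_E₆_sq] at hcross
    linear_combination (-1728) * hcross
  have hex : ∃ c : ℂ, c ≠ 0 ∧ E₄ z₁ = c ^ 4 * E₄ z₀ ∧ E₆ z₁ = c ^ 6 * E₆ z₀ := by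
    by_cases h0 : E₄ z₀ = 0
    · have h1 : E₄ z₁ = 0 := by
        rw [h0, zero_pow (by norm_num), zero_mul] at hcross
        exact pow_eq_zero_iff (by norm_num) |>.mp ((mul_eq_zero.mp hcross).resolve_right d0)
      have h60 := (E₄_ne_zero_or_E₆_ne_zero z₀).resolve_left (not_not.mpr h0)
      have h61 := (E₄_ne_zero_or_E₆_ne_zero z₁).resolve_left (not_not.mpr h1)
      obtain ⟨c, hc⟩ := IsAlgClosed.exists_pow_nat_eq (E₆ z₁ / E₆ z₀) (n := 6) (by norm_num)
      refine ⟨c, ?_, by rw [h0, h1, mul_zero], by rw [hc]; field_simp⟩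
      rintro rfl
      rw [zero_pow (by norm_num)] at hc
      exact div_ne_zero h61 h60 hc.symm
    · have h1 : E₄ z₁ ≠ 0 := by
        intro h1
        rw [h1, zero_pow (by norm_num), zero_mul] at hcross
        exact mul_ne_zero (pow_ne_zero 3 h0) d1 hcross.symm
      obtain ⟨c, hc⟩ := IsAlgClosed.exists_pow_nat_eq (E₄ z₁ / E₄ z₀) (n := 4) (by norm_num)
      have hc0 : c ≠ 0 := by
        rintro rfl
        rw [zero_pow (by norm_num)] at hc
        exact div_ne_zero h1 h0 hc.symm
      have e4 : E₄ z₁ = c ^ 4 * E₄ z₀ := by rw [hc]; field_simp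
      have h6 : E₆ z₁ ^ 2 = (c ^ 6 * E₆ z₀) ^ 2 := by
        apply mul_left_cancel₀ (pow_ne_zero 3 h0)
        rw [← hcross6, e4]; ring
      -- The fourth root c is free up to powers of i, and E₆ is so far matched only up to sign.
      -- Since i^4 = 1 and i^6 = -1, replacing c by ci repairs the sign without disturbing E₄.
      rcases sq_eq_sq_iff_eq_or_eq_neg.mp h6 with h6 | h6
      · exact ⟨c, hc0, e4, h6⟩
      · refine ⟨c * Complex.I, mul_ne_zero hc0 Complex.I_ne_zero, ?_, ?_⟩
        · rw [e4, mul_pow, Complex.I_pow_four]; ring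
        · rw [h6, mul_pow, show (6 : ℕ) = 4 + 2 from rfl, pow_add Complex.I, Complex.I_pow_four,
            Complex.I_sq]; ring
  obtain ⟨c, hc, h4, h6⟩ := hex
  exact exists_smul_eq_of_primSet_eq hc (primSet_eq_of_E_eq hc fun k hk _ =>
    scaling_of_E₄_E₆ h4 h6 k (E hk))

/-- A form of weight `12 m` is `Δ ^ m` times a polynomial of degree at most `m` in `jInv`. -/
theorem exists_polynomial_jInv (m : ℕ) (f : ModularForm 𝒮ℒ ((12 * m : ℕ) : ℤ)) :
    ∃ P : Polynomial ℂ, P.natDegree ≤ m ∧ ∀ z, f z = discriminant z ^ m * P.eval (jInv z) := by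
  induction m with
  | zero =>
    obtain ⟨a, ha⟩ := ModularFormClass.levelOne_weight_zero_const (F := ModularForm 𝒮ℒ 0)
      (f.mcast (by simp))
    refine ⟨Polynomial.C a, by simp, fun z => ?_⟩
    have := congrFun ha z
    simpa using this
  | succ m ih =>
    -- E₄^{3(m+1)} equals Δ^{m+1} j^{m+1}, so the constant term of f supplies the monomial of degree
    -- m + 1 and the remainder is Δ times a form of weight 12m.
    obtain ⟨t, h, hf⟩ := exists_eq_mul_add_discriminant_mul f
      (ModularForm.mcast (by push_cast; ring) ((E₄.pow (3 * (m + 1))).mul (E₆.pow 0)))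
      (coeff_zero_E₄_pow_mul_E₆_pow _ _)
    obtain ⟨P, hP, hPf⟩ := ih (h.mcast (by push_cast; ring))
    refine ⟨Polynomial.C t * Polynomial.X ^ (m + 1) + P, ?_, fun z => ?_⟩
    · refine Polynomial.natDegree_add_le_of_degree_le ?_ (by omega)
      exact Polynomial.natDegree_C_mul_X_pow_le _ _
    · have := hPf z
      simp only [coe_mcast] at this
      rw [hf, this]
      have d := discriminant_ne_zero z
      simp only [coe_mcast, coe_mul, coe_pow, Pi.mul_apply, Pi.pow_apply, pow_zero, Pi.one_apply,
        Polynomial.eval_add, Polynomial.eval_mul, Polynomial.eval_C, Polynomial.eval_pow,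
        Polynomial.eval_X]
      have : E₄ z ^ (3 * (m + 1)) = discriminant z ^ (m + 1) * jInv z ^ (m + 1) := by
        rw [← mul_pow, jInv, mul_div_cancel₀ _ d, pow_mul]
      rw [this]; ring

end EisensteinZeros

/-! ### The bracket 2E₄E₆' - 3E₆E₄' as a cusp form -/

namespace EisensteinZeros

open Filter Topology EisensteinSeries ModularForm UpperHalfPlane Derivative
open scoped Manifold

/-- If a holomorphic function on `ℍ` converges at `i∞`, its derivative tends to `0` there. -/
lemma isZeroAtImInfty_normalizedDeriv {f : ℍ → ℂ} (hf : MDiff f) {a : ℂ}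
    (ha : Tendsto f atImInfty (𝓝 a)) : IsZeroAtImInfty (normalizedDerivOfComplex f) := by
  rw [UpperHalfPlane.mdifferentiable_iff] at hf
  rw [IsZeroAtImInfty, ZeroAtFilter, Metric.tendsto_nhds]
  intro ε hε
  rw [Metric.tendsto_nhds] at ha
  have h1 := ha ε hε
  rw [atImInfty, eventually_comap, eventually_atTop] at h1
  obtain ⟨A, hA⟩ := h1
  rw [atImInfty, eventually_comap, eventually_atTop]
  -- The margin 2 keeps the closed unit disc around z inside ℍ and above height A, where f is within
  -- ε of its limit. Cauchy's estimate on that disc then bounds the derivative.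
  refine ⟨max A 0 + 2, ?_⟩
  rintro y hy z rfl
  have hsub : Metric.closedBall (z : ℂ) 1 ⊆ {w : ℂ | 0 < w.im} := by
    intro w hw
    have : |(w - z).im| ≤ 1 := (Complex.abs_im_le_norm _).trans (by simpa [dist_eq_norm] using hw)
    rw [Complex.sub_im, abs_le] at this
    have h2 : z.im = (z : ℂ).im := rfl
    have := le_max_right A 0
    show 0 < w.im
    linarith
  have hd : DiffContOnCl ℂ (fun w => (f ∘ ofComplex) w - a) (Metric.ball (z : ℂ) 1) := by
    refine DifferentiableOn.diffContOnCl_ball (U := {w : ℂ | 0 < w.im}) ?_ hsub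
    exact hf.sub_const a
  have hbd : ∀ w ∈ Metric.sphere (z : ℂ) 1, ‖(f ∘ ofComplex) w - a‖ ≤ ε := by
    intro w hw
    have hw' : 0 < w.im := hsub (Metric.sphere_subset_closedBall hw)
    have : |(w - z).im| ≤ 1 := (Complex.abs_im_le_norm _).trans
      (by rw [← dist_eq_norm]; exact (Metric.mem_sphere.mp hw).le)
    rw [Complex.sub_im, abs_le] at this
    have h2 : z.im = (z : ℂ).im := rfl
    have h3 := le_max_left A 0
    have h4 := hA (⟨w, hw'⟩ : ℍ).im (by show A ≤ w.im; linarith) ⟨w, hw'⟩ rfl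
    rw [dist_eq_norm] at h4
    simpa [ofComplex_apply_of_im_pos hw'] using h4.le
  have hder := Complex.norm_deriv_le_of_forall_mem_sphere_norm_le one_pos hd hbd
  rw [deriv_sub_const] at hder
  rw [dist_zero_right, normalizedDerivOfComplex, norm_mul]
  have hpi : ‖(2 * Real.pi * Complex.I : ℂ)⁻¹‖ < 1 := by
    rw [norm_inv]
    apply inv_lt_one_of_one_lt₀
    simp only [norm_mul, Complex.norm_ofNat, Complex.norm_real, Real.norm_eq_abs, Complex.norm_I,
      mul_one, abs_of_pos Real.pi_pos]
    linarith [Real.pi_gt_three]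
  calc _ ≤ ‖(2 * Real.pi * Complex.I : ℂ)⁻¹‖ * ε := by
        gcongr
        simpa using hder
    _ < 1 * ε := by gcongr
    _ = ε := one_mul ε

lemma tendsto_atImInfty {k : ℤ} (f : ModularForm 𝒮ℒ k) :
    ∃ a, Tendsto f atImInfty (𝓝 a) := by
  refine ⟨cuspFunction 1 f 0, ?_⟩
  have h1 : Tendsto (fun z : ℍ => cuspFunction 1 f (Function.Periodic.qParam 1 z)) atImInfty
      (𝓝 (cuspFunction 1 f 0)) :=
    (ModularFormClass.analyticAt_cuspFunction_zero f one_pos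
      one_mem_strictPeriods_SL).continuousAt.tendsto.comp
      (qParam_tendsto_atImInfty one_pos)
  refine h1.congr fun z => ?_
  exact SlashInvariantFormClass.eq_cuspFunction f z one_mem_strictPeriods_SL one_ne_zero

/-- The Rankin--Cohen type bracket `2 E₄ E₆' - 3 E₆ E₄'`. -/
noncomputable def bracketE₄E₆ (z : ℍ) : ℂ :=
  2 * E₄ z * normalizedDerivOfComplex E₆ z - 3 * E₆ z * normalizedDerivOfComplex E₄ z

/-- The E₂ corrections in the two Serre derivatives cancel because 2·6 = 3·4. In this form every
factor transforms as a modular form. -/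
lemma bracketE₄E₆_eq : bracketE₄E₆ =
    (2 : ℂ) • (⇑E₄ * serreDerivative 6 E₆) - (3 : ℂ) • (⇑E₆ * serreDerivative 4 E₄) := by
  ext z
  simp only [bracketE₄E₆, Pi.sub_apply, Pi.smul_apply, Pi.mul_apply, smul_eq_mul,
    serreDerivative_apply]
  ring

lemma bracketE₄E₆_slash (γ : SL(2, ℤ)) : bracketE₄E₆ ∣[(12 : ℤ)] γ = bracketE₄E₆ := by
  have hγ : (γ : GL (Fin 2) ℝ) ∈ 𝒮ℒ := ⟨γ, rfl⟩
  have h4 : ⇑E₄ ∣[(4 : ℤ)] γ = E₄ := E₄.slash_action_eq' γ hγ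
  have h6 : ⇑E₆ ∣[(6 : ℤ)] γ = E₆ := E₆.slash_action_eq' γ hγ
  have s4 := serreDerivative_slash_invariant (k := 4) E₄.holo' h4
  have s6 := serreDerivative_slash_invariant (k := 6) E₆.holo' h6
  push_cast at s4 s6
  have m1 := ModularForm.mul_slash_SL2 4 8 γ E₄ (serreDerivative 6 E₆)
  have m2 := ModularForm.mul_slash_SL2 6 6 γ E₆ (serreDerivative 4 E₄)
  rw [show (4 : ℤ) + 8 = 12 by norm_num] at m1
  rw [show (6 : ℤ) + 6 = 12 by norm_num] at m2
  rw [bracketE₄E₆_eq, sub_eq_add_neg, SlashAction.add_slash, SlashAction.neg_slash,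
    ModularForm.SL_smul_slash, ModularForm.SL_smul_slash, m1, m2, h4, h6]
  erw [s4, s6]
  rfl

lemma bracketE₄E₆_mdifferentiable : MDiff bracketE₄E₆ := by
  rw [bracketE₄E₆_eq]
  exact ((E₄.holo'.mul (serreDerivative_mdifferentiable 6 E₆.holo')).const_smul 2).sub
    ((E₆.holo'.mul (serreDerivative_mdifferentiable 4 E₄.holo')).const_smul 3)

/-- The bracket `2 E₄ E₆' - 3 E₆ E₄'` as a cusp form of weight `12`. -/
noncomputable def bracketCuspForm : CuspForm 𝒮ℒ 12 where
  toFun := bracketE₄E₆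
  slash_action_eq' A hA := by
    obtain ⟨A, rfl⟩ := hA
    exact bracketE₄E₆_slash A
  holo' := bracketE₄E₆_mdifferentiable
  zero_at_cusps' hc := by
    rw [Subgroup.IsArithmetic.isCusp_iff_isCusp_SL2Z] at hc
    rw [OnePoint.isZeroAt_iff_forall_SL2Z hc]
    intro γ _
    rw [bracketE₄E₆_slash]
    obtain ⟨a, ha⟩ := tendsto_atImInfty E₄
    obtain ⟨b, hb⟩ := tendsto_atImInfty E₆
    have h4 := isZeroAtImInfty_normalizedDeriv E₄.holo' ha
    have h6 := isZeroAtImInfty_normalizedDeriv E₆.holo' hb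
    have := ((ha.const_mul 2).mul h6).sub ((hb.const_mul 3).mul h4)
    rw [mul_zero, mul_zero, sub_zero] at this
    exact this

lemma analyticAt_comp_ofComplex {f : ℍ → ℂ} (hf : MDiff f) (z : ℍ) :
    AnalyticAt ℂ (f ∘ ofComplex) (z : ℂ) :=
  (UpperHalfPlane.mdifferentiable_iff.mp hf).analyticAt
    (isOpen_upperHalfPlaneSet.mem_nhds z.im_pos)

/-- A nonzero holomorphic function on `ℍ` has finite order everywhere. -/
lemma analyticOrderAt_ne_top {f : ℍ → ℂ} (hf : MDiff f) (h0 : f ≠ 0) (z : ℍ) :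
    analyticOrderAt (f ∘ ofComplex) (z : ℂ) ≠ ⊤ := by
  intro htop
  apply h0
  have hpre : IsPreconnected upperHalfPlaneSet :=
    (convex_halfSpace_im_gt 0).isPreconnected
  have han : AnalyticOnNhd ℂ (f ∘ ofComplex) upperHalfPlaneSet :=
    (UpperHalfPlane.mdifferentiable_iff.mp hf).analyticOnNhd isOpen_upperHalfPlaneSet
  have := han.eqOn_zero_of_preconnected_of_eventuallyEq_zero hpre z.im_pos
    (analyticOrderAt_eq_top.mp htop)
  ext w
  simpa using this w.im_pos

end EisensteinZeros

/-! ### The strict fundamental domain and the elliptic points -/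

namespace EisensteinZeros

open EisensteinSeries ModularForm UpperHalfPlane ModularGroup
open scoped Modular

lemma re_S_smul (z : ℍ) : (S • z).re = -z.re / Complex.normSq z := by
  rw [modular_S_smul, ← coe_re]
  simp [Complex.inv_re, neg_div]

lemma im_S_smul (z : ℍ) : (S • z).im = z.im / Complex.normSq z := by
  rw [modular_S_smul, ← coe_im]
  simp [Complex.inv_im, neg_div]

lemma one_vadd_ρ : (1 : ℝ) +ᵥ ρ = rho := by
  apply ext_re_im
  · rw [vadd_re]
    show 1 + (-1 / 2 : ℝ) = 1 / 2
    norm_num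
  · rw [vadd_im]
    rfl

lemma T_smul_ρ : T • ρ = rho := by rw [modular_T_smul, one_vadd_ρ]

lemma normSq_rho : Complex.normSq (rho : ℂ) = 1 := by
  rw [Complex.normSq_apply]
  show (1 / 2 : ℝ) * (1 / 2) + Real.sqrt 3 / 2 * (Real.sqrt 3 / 2) = 1
  have := Real.mul_self_sqrt (show (0 : ℝ) ≤ 3 by norm_num)
  linarith

lemma S_smul_rho : S • rho = ρ := by
  apply ext_re_im
  · rw [re_S_smul, normSq_rho]
    show -(1 / 2 : ℝ) / 1 = -1 / 2
    norm_num
  · rw [im_S_smul, normSq_rho, div_one]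
    rfl

lemma S_smul_ρ : S • ρ = rho := by
  have h : Complex.normSq (ρ : ℂ) = 1 := by
    rw [Complex.normSq_eq_norm_sq, norm_ρ, one_pow]
  apply ext_re_im
  · rw [re_S_smul, h]
    show -(-1 / 2 : ℝ) / 1 = 1 / 2
    norm_num
  · rw [im_S_smul, h, div_one]
    rfl

lemma eq_I_of_normSq_eq_one {z : ℍ} (h : Complex.normSq z = 1) (hre : z.re = 0) : z = I := by
  have him : z.im ^ 2 = 1 := by
    rw [Complex.normSq_apply] at h
    have h1 : (z : ℂ).re = 0 := hre
    rw [h1] at h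
    have : z.im = (z : ℂ).im := rfl
    rw [this]; linarith
  have : z.im = 1 := by
    have := z.im_pos
    nlinarith
  apply ext_re_im
  · rw [hre]; simp
  · rw [this]; simp

lemma S_smul_I : S • I = I := by
  apply ext_re_im
  · rw [re_S_smul]; simp
  · rw [im_S_smul]; simp

lemma norm_eq_one_iff_normSq (z : ℂ) : ‖z‖ = 1 ↔ Complex.normSq z = 1 := by
  rw [Complex.normSq_eq_norm_sq, pow_eq_one_iff_of_nonneg (norm_nonneg z) two_ne_zero]

lemma one_le_norm_iff_normSq (z : ℂ) : 1 ≤ ‖z‖ ↔ 1 ≤ Complex.normSq z := by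
  rw [Complex.normSq_eq_norm_sq, one_le_sq_iff₀ (norm_nonneg z)]

lemma mem_strictFundamentalDomain_iff {z : ℍ} : z ∈ strictFundamentalDomain ↔
    1 ≤ Complex.normSq z ∧ -(1 / 2) < z.re ∧ z.re ≤ 1 / 2 ∧ (Complex.normSq z = 1 → 0 ≤ z.re) := by
  rw [strictFundamentalDomain, Set.mem_ofPred_eq, one_le_norm_iff_normSq, norm_eq_one_iff_normSq]

lemma strictFundamentalDomain_subset_fd : strictFundamentalDomain ⊆ 𝒟 := by
  intro z hz
  rw [mem_strictFundamentalDomain_iff] at hz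
  exact ⟨hz.1, abs_le.mpr ⟨hz.2.1.le, hz.2.2.1⟩⟩

lemma I_mem_strictFundamentalDomain : I ∈ strictFundamentalDomain := by
  rw [mem_strictFundamentalDomain_iff]; simp

lemma rho_mem_strictFundamentalDomain : rho ∈ strictFundamentalDomain := by
  have : rho.re = 1 / 2 := rfl
  rw [mem_strictFundamentalDomain_iff, normSq_rho, this]; norm_num

lemma I_ne_rho : I ≠ rho := by
  intro h
  have := congrArg UpperHalfPlane.re h
  have h2 : rho.re = 1 / 2 := rfl
  rw [h2] at this
  norm_num at this

/-- Every orbit meets the strict fundamental domain. -/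
lemma exists_smul_mem_strictFundamentalDomain (z : ℍ) :
    ∃ g : SL(2, ℤ), g • z ∈ strictFundamentalDomain := by
  obtain ⟨g, hg1, hg2⟩ := exists_smul_mem_fd z
  have hg2' := abs_le.mp hg2
  suffices h : ∃ g' : SL(2, ℤ), g' • (g • z) ∈ strictFundamentalDomain by
    obtain ⟨g', h⟩ := h
    exact ⟨g' * g, by rwa [mul_smul]⟩
  generalize g • z = w at *
  -- Only the removed half of the boundary needs repair: T moves the left vertical edge to the right
  -- one, and S reflects the left part of the arc to the right part.
  by_cases hre : w.re = -(1 / 2)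
  · refine ⟨T, ?_⟩
    rw [mem_strictFundamentalDomain_iff, re_T_smul, hre]
    have : Complex.normSq (T • w : ℍ) = Complex.normSq w := by
      rw [Complex.normSq_apply, Complex.normSq_apply, coe_re, coe_im, coe_re, coe_im,
        re_T_smul, im_T_smul, hre]
      ring
    rw [this]
    norm_num
    exact hg1
  by_cases h1 : Complex.normSq w = 1 ∧ w.re < 0
  · refine ⟨S, ?_⟩
    have : Complex.normSq (S • w : ℍ) = 1 := by
      rw [Complex.normSq_apply, coe_re, coe_im, re_S_smul, im_S_smul, h1.1]
      have := h1.1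
      rw [Complex.normSq_apply, coe_re, coe_im] at this
      linarith
    rw [mem_strictFundamentalDomain_iff, this, re_S_smul, h1.1]
    refine ⟨le_rfl, ?_, ?_, fun _ => ?_⟩ <;> linarith [h1.2, hg2'.1, hg2'.2]
  · refine ⟨1, ?_⟩
    rw [one_smul, mem_strictFundamentalDomain_iff]
    refine ⟨hg1, lt_of_le_of_ne hg2'.1 (Ne.symm hre), hg2'.2, fun h => ?_⟩
    by_contra! h2
    exact h1 ⟨h, h2⟩

/-- Each orbit meets the strict fundamental domain at most once. -/
lemma smul_eq_self_of_mem_strictFundamentalDomain {z : ℍ} {g : SL(2, ℤ)}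
    (hz : z ∈ strictFundamentalDomain) (hg : g • z ∈ strictFundamentalDomain) : g • z = z := by
  have hz' := mem_strictFundamentalDomain_iff.mp hz
  have hcases := cases_of_mem_fd_smul_mem_fd (strictFundamentalDomain_subset_fd hz)
    (strictFundamentalDomain_subset_fd hg)
  have hneg : ∀ h : SL(2, ℤ), g = h ∨ g = -h → g • z = h • z := by
    rintro h (rfl | rfl)
    · rfl
    · rw [SL_neg_smul]
  have hρ : ρ ∉ strictFundamentalDomain := by
    rw [mem_strictFundamentalDomain_iff]
    have : ρ.re = -1 / 2 := rfl
    rw [this]; norm_num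
  have hTρ : T⁻¹ • rho = ρ := by rw [inv_smul_eq_iff, T_smul_ρ]
  rw [one_vadd_ρ] at hcases
  rcases hcases with h | ⟨h, hre⟩ | ⟨h, hre⟩ | ⟨h, h1⟩ | ⟨h, rfl⟩ | ⟨h, rfl⟩ | ⟨h, rfl⟩ | ⟨_, rfl⟩ |
    ⟨_, rfl⟩ | ⟨_, rfl⟩
  · rw [hneg 1 h, one_smul]
  · linarith [hz'.2.1]
  · exfalso
    rw [hneg _ h, mem_strictFundamentalDomain_iff, re_T_inv_smul, hre] at hg
    norm_num at hg
  · have hN := (norm_eq_one_iff_normSq _).mp h1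
    rw [hneg _ h] at hg ⊢
    have hg' := mem_strictFundamentalDomain_iff.mp hg
    have hz0 := hz'.2.2.2 hN
    have hS1 : Complex.normSq (S • z : ℍ) = 1 := by
      rw [Complex.normSq_apply, coe_re, coe_im, re_S_smul, im_S_smul, hN]
      rw [Complex.normSq_apply, coe_re, coe_im] at hN
      linarith
    have := hg'.2.2.2 hS1
    rw [re_S_smul, hN, div_one] at this
    rw [eq_I_of_normSq_eq_one hN (by linarith), S_smul_I]
  · rw [hneg _ h, mul_smul, S_smul_rho, T_smul_ρ]
  · exfalso
    rw [hneg _ h, mul_smul, mul_smul, hTρ] at hg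
    rw [S_smul_ρ, hTρ] at hg
    exact hρ hg
  · rw [hneg _ h, mul_smul, hTρ, S_smul_ρ]
  all_goals exact absurd hz hρ

lemma apply_smul {k : ℤ} (f : ModularForm 𝒮ℒ k) (γ : SL(2, ℤ)) (z : ℍ) :
    f (γ • z) = (denom γ z) ^ k * f z :=
  SlashInvariantForm.slash_action_eqn'' f (γ := (γ : GL (Fin 2) ℝ)) (MonoidHom.mem_range.mpr ⟨γ, rfl⟩) z

lemma apply_smul_eq_zero_iff {k : ℤ} (f : ModularForm 𝒮ℒ k) (γ : SL(2, ℤ)) (z : ℍ) :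
    f (γ • z) = 0 ↔ f z = 0 := by
  rw [apply_smul, mul_eq_zero, or_iff_right (zpow_ne_zero _ (denom_ne_zero _ _))]

lemma coe_rho_eq : (rho : ℂ) = ⟨1 / 2, Real.sqrt 3 / 2⟩ := rfl

lemma rho_sq : (rho : ℂ) ^ 2 = rho - 1 := by
  have := Real.mul_self_sqrt (show (0 : ℝ) ≤ 3 by norm_num)
  rw [coe_rho_eq, sq]
  apply Complex.ext
  · simp; linarith
  · simp; ring

lemma rho_pow_three : (rho : ℂ) ^ 3 = -1 := by
  linear_combination (rho + 1 : ℂ) * rho_sq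

/-- TS fixes ρ with automorphy factor ρ, and ρ^4 = -ρ ≠ 1, so a form of weight 4 must vanish there.
-/
lemma E₄_rho : E₄ rho = 0 := by
  have h := apply_smul E₄ (T * S) rho
  rw [mul_smul, S_smul_rho, T_smul_ρ] at h
  have hd : denom (T * S : SL(2, ℤ)) rho = rho := by
    rw [ModularGroup.denom_apply]; simp [coe_S]
  rw [hd] at h
  have h4 : (rho : ℂ) ^ (4 : ℤ) = -rho := by
    norm_cast
    linear_combination (rho : ℂ) * rho_pow_three
  rw [h4] at h
  have h1 : (1 + rho : ℂ) * E₄ rho = 0 := by linear_combination h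
  refine (mul_eq_zero.mp h1).resolve_left fun h2 => ?_
  have := congrArg Complex.re h2
  rw [coe_rho_eq] at this
  norm_num at this

/-- S fixes i with automorphy factor i, and i^6 = -1. -/
lemma E₆_I : E₆ I = 0 := by
  have h := apply_smul E₆ S I
  rw [S_smul_I] at h
  rw [ModularGroup.denom_S, coe_I] at h
  have h6 : Complex.I ^ (6 : ℤ) = -1 := by
    norm_cast
    rw [show (6 : ℕ) = 4 + 2 from rfl, pow_add, Complex.I_pow_four, Complex.I_sq]; norm_num
  rw [h6] at h
  linear_combination (1 / 2 : ℂ) * h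

end EisensteinZeros

/-! ### Additivity of the weighted zero count, and simple zeros of E₄ and E₆ -/

namespace EisensteinZeros

open Filter Topology EisensteinSeries ModularForm UpperHalfPlane Derivative
open scoped Manifold

/-- Holomorphic functions on `ℍ` with a nonzero holomorphic expansion at `i∞`. -/
structure HasExpansion (f : ℍ → ℂ) : Prop where
  mdiff : MDiff f
  analyticAt : AnalyticAt ℂ (cuspFunction 1 f) 0
  qExpansion_ne_zero : qExpansion 1 f ≠ 0

lemma HasExpansion.ne_zero {f : ℍ → ℂ} (hf : HasExpansion f) : f ≠ 0 := by
  rintro rfl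
  exact hf.qExpansion_ne_zero (qExpansion_zero 1)

lemma HasExpansion.mul {f g : ℍ → ℂ} (hf : HasExpansion f) (hg : HasExpansion g) :
    HasExpansion (f * g) where
  mdiff := hf.mdiff.mul hg.mdiff
  analyticAt := by
    rw [cuspFunction_mul hf.analyticAt.continuousAt hg.analyticAt.continuousAt]
    exact hf.analyticAt.mul hg.analyticAt
  qExpansion_ne_zero := by
    rw [qExpansion_mul hf.analyticAt hg.analyticAt]
    exact mul_ne_zero hf.qExpansion_ne_zero hg.qExpansion_ne_zero

lemma hasExpansion_of_modularForm {k : ℤ} (f : ModularForm 𝒮ℒ k) (hf : f ≠ 0) :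
    HasExpansion f where
  mdiff := f.holo'
  analyticAt := ModularFormClass.analyticAt_cuspFunction_zero f one_pos one_mem_strictPeriods_SL
  qExpansion_ne_zero := by
    rwa [Ne, ModularForm.qExpansion_eq_zero_iff one_pos one_mem_strictPeriods_SL]

lemma hasExpansion_const {c : ℂ} (hc : c ≠ 0) : HasExpansion (fun _ => c) := by
  have := hasExpansion_of_modularForm (ModularForm.const (Γ := 𝒮ℒ) c) (fun h => hc (by
    have := congrArg (fun F : ModularForm 𝒮ℒ 0 => F I) h
    simpa using this))
  exact this

lemma ordInfty_mul {f g : ℍ → ℂ} (hf : HasExpansion f) (hg : HasExpansion g) :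
    ordInfty (f * g) = ordInfty f + ordInfty g := by
  rw [ordInfty, qExpansion_mul hf.analyticAt hg.analyticAt, PowerSeries.order_mul,
    ENat.toNat_add (by simpa using hf.qExpansion_ne_zero) (by simpa using hg.qExpansion_ne_zero)]
  rfl

lemma ord_mul {f g : ℍ → ℂ} (hf : HasExpansion f) (hg : HasExpansion g) (z : ℍ) :
    ord (f * g) z = ord f z + ord g z :=
  analyticOrderNatAt_mul (analyticAt_comp_ofComplex hf.mdiff z)
    (analyticAt_comp_ofComplex hg.mdiff z) (analyticOrderAt_ne_top hf.mdiff hf.ne_zero z)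
    (analyticOrderAt_ne_top hg.mdiff hg.ne_zero z)

lemma ord_eq_zero_iff {f : ℍ → ℂ} (hf : HasExpansion f) (z : ℍ) : ord f z = 0 ↔ f z ≠ 0 := by
  have h := Nat.cast_analyticOrderNatAt (analyticOrderAt_ne_top hf.mdiff hf.ne_zero z)
  have h2 := (analyticAt_comp_ofComplex hf.mdiff z).analyticOrderAt_eq_zero
  rw [← h] at h2
  simpa [ord] using h2

/-- The interior of the strict fundamental domain relative to the elliptic points. -/
def generalDomain : Set ℍ := strictFundamentalDomain \ {UpperHalfPlane.I, rho}

/-- `f` has finitely many zeros in the strict fundamental domain, and its weighted number of zeros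
is `d / 6`. -/
def HasValence (f : ℍ → ℂ) (d : ℕ) : Prop :=
  {z ∈ strictFundamentalDomain | f z = 0}.Finite ∧
    6 * ordInfty f + 3 * ord f I + 2 * ord f rho + 6 * ∑ᶠ z ∈ generalDomain, ord f z = d

lemma finite_inter_support_ord {f : ℍ → ℂ} (hf : HasExpansion f)
    (h : {z ∈ strictFundamentalDomain | f z = 0}.Finite) :
    (generalDomain ∩ Function.support (ord f)).Finite := by
  refine h.subset ?_
  rintro z ⟨hz, hz'⟩
  refine ⟨hz.1, ?_⟩
  by_contra h0
  exact hz' ((ord_eq_zero_iff hf z).mpr h0)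

/-- Finiteness of the zero set belongs to `HasValence` because `finsum` takes the default value 0 on
infinite support. Additivity of the sum over the domain depends on it. -/
lemma HasValence.mul {f g : ℍ → ℂ} (hf : HasExpansion f) (hg : HasExpansion g) {a b : ℕ}
    (ha : HasValence f a) (hb : HasValence g b) : HasValence (f * g) (a + b) := by
  refine ⟨(ha.1.union hb.1).subset ?_, ?_⟩
  · rintro z ⟨hz, hz'⟩
    rcases mul_eq_zero.mp hz' with h | h
    · exact Or.inl ⟨hz, h⟩
    · exact Or.inr ⟨hz, h⟩
  · simp only [ord_mul hf hg, ordInfty_mul hf hg]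
    rw [finsum_mem_add_distrib' (finite_inter_support_ord hf ha.1)
      (finite_inter_support_ord hg hb.1), ← ha.2, ← hb.2]
    ring

lemma hasValence_const {c : ℂ} (hc : c ≠ 0) : HasValence (fun _ => c) 0 := by
  have hE := hasExpansion_const hc
  have h0 : ∀ z, ord (fun _ => c) z = 0 := fun z => (ord_eq_zero_iff hE z).mpr hc
  refine ⟨by simp [hc], ?_⟩
  have hinf : ordInfty (fun _ => c) = 0 := by
    rw [ordInfty, ENat.toNat_eq_zero]
    left
    have h1 : (fun _ : ℍ => c) = c • (1 : ModularForm 𝒮ℒ 0) := by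
      ext z; simp
    rw [h1]
    rw [ModularForm.qExpansion_smul one_pos one_mem_strictPeriods_SL c (1 : ModularForm 𝒮ℒ 0),
      ModularForm.qExpansion_one]
    rw [← not_ne_iff, PowerSeries.order_ne_zero_iff_constCoeff_eq_zero]
    simpa using hc
  simp [h0, hinf]

lemma HasExpansion.pow {f : ℍ → ℂ} (hf : HasExpansion f) (n : ℕ) : HasExpansion (f ^ n) := by
  induction n with
  | zero => exact hasExpansion_const one_ne_zero
  | succ n ih => rw [pow_succ]; exact ih.mul hf

lemma HasValence.pow {f : ℍ → ℂ} (hf : HasExpansion f) {a : ℕ} (ha : HasValence f a) (n : ℕ) :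
    HasValence (f ^ n) (n * a) := by
  induction n with
  | zero => rw [zero_mul]; exact hasValence_const one_ne_zero
  | succ n ih => rw [pow_succ, Nat.succ_mul]; exact ih.mul (hf.pow n) hf ha

lemma hasExpansion_discriminant : HasExpansion discriminant := by
  have h := CuspForm.discriminant.holo'
  refine ⟨h, ModularFormClass.analyticAt_cuspFunction_zero CuspForm.discriminant one_pos
    one_mem_strictPeriods_SL, ?_⟩
  intro h
  have := discriminant_qExpansion_order
  rw [h, PowerSeries.order_zero] at this
  exact absurd this (by decide)

lemma hasValence_discriminant : HasValence discriminant 6 := by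
  have h0 : ∀ z, ord discriminant z = 0 := fun z =>
    (ord_eq_zero_iff hasExpansion_discriminant z).mpr (discriminant_ne_zero z)
  refine ⟨by simp [discriminant_ne_zero], ?_⟩
  have hinf : ordInfty discriminant = 1 := by
    rw [ordInfty, discriminant_qExpansion_order]; rfl
  simp [h0, hinf]

/-- Cusp forms of weight 12 form a line spanned by Δ. -/
lemma exists_bracketE₄E₆_eq : ∃ c : ℂ, ∀ z, bracketE₄E₆ z = c * discriminant z := by
  obtain ⟨c, hc⟩ := CuspForm.exists_smul_discriminant_of_weight_eq_twelve bracketCuspForm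
  exact ⟨c, fun z => (congrArg (fun F : CuspForm 𝒮ℒ 12 => F z) hc).symm⟩

lemma E₆_rho_ne_zero : E₆ rho ≠ 0 :=
  (E₄_ne_zero_or_E₆_ne_zero rho).resolve_left (not_not.mpr E₄_rho)

lemma deriv_comp_ofComplex (f : ℍ → ℂ) (z : ℍ) :
    deriv (f ∘ ofComplex) z = 2 * Real.pi * Complex.I * normalizedDerivOfComplex f z := by
  have : (2 * Real.pi * Complex.I : ℂ) ≠ 0 := Complex.two_pi_I_ne_zero
  rw [normalizedDerivOfComplex, mul_inv_cancel_left₀ this]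

/-- The bracket `2 E₄ E₆' - 3 E₆ E₄'` has no zeros. -/
lemma bracketE₄E₆_ne_zero (z : ℍ) : bracketE₄E₆ z ≠ 0 := by
  obtain ⟨c, hc⟩ := exists_bracketE₄E₆_eq
  rw [hc]
  refine mul_ne_zero ?_ (discriminant_ne_zero z)
  rintro rfl
  set F := E₄ ∘ ofComplex with hF
  set G := E₆ ∘ ofComplex with hG
  have hFa := analyticAt_comp_ofComplex E₄.holo' rho
  have hGa := analyticAt_comp_ofComplex E₆.holo' rho
  change AnalyticAt ℂ F rho at hFa
  change AnalyticAt ℂ G rho at hGa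
  have hF0 : F rho = 0 := by simp [hF, E₄_rho]
  have hG0 : G rho ≠ 0 := by simpa [hG] using E₆_rho_ne_zero
  -- If c were 0, then 2 E₄E₆' = 3 E₆E₄' near ρ. As E₆(ρ) ≠ 0, the order of E₄ at ρ would be at most
  -- that of E₄', although differentiation lowers the order of a zero by one.
  have hEv : (fun w => F w * (2 * deriv G w)) =ᶠ[𝓝 (rho : ℂ)] fun w => deriv F w * (3 * G w) := by
    filter_upwards [isOpen_upperHalfPlaneSet.mem_nhds rho.im_pos] with w hw
    have h1 := hc ⟨w, hw⟩
    have d4 := deriv_comp_ofComplex E₄ ⟨w, hw⟩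
    have d6 := deriv_comp_ofComplex E₆ ⟨w, hw⟩
    rw [bracketE₄E₆, zero_mul, sub_eq_zero] at h1
    simp only [hF, hG, Function.comp_apply, ofComplex_apply_of_im_pos hw]
    rw [show deriv (E₆ ∘ ofComplex) w = _ from d6, show deriv (E₄ ∘ ofComplex) w = _ from d4]
    linear_combination (2 * Real.pi * Complex.I) * h1
  have hord := analyticOrderAt_congr hEv
  have hFt : analyticOrderAt F rho ≠ ⊤ :=
    analyticOrderAt_ne_top E₄.holo' (hasExpansion_of_modularForm E₄
      (E_ne_zero (k := 4) (by norm_num) (by decide))).ne_zero rho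
  have hd := hFa.analyticOrderAt_deriv_add_one
  simp only [hF0, sub_zero] at hd
  have hG2 : AnalyticAt ℂ (fun w => 2 * deriv G w) rho := analyticAt_const.mul hGa.deriv
  have hG3 : AnalyticAt ℂ (fun w => 3 * G w) rho := analyticAt_const.mul hGa
  have hord' := (analyticOrderAt_mul hFa hG2).symm.trans
    (hord.trans (analyticOrderAt_mul hFa.deriv hG3))
  have h3 : analyticOrderAt (fun w => 3 * G w) rho = 0 := by
    rw [hG3.analyticOrderAt_eq_zero]
    exact mul_ne_zero (by norm_num) hG0
  rw [h3, add_zero] at hord'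
  have hle : analyticOrderAt F rho ≤ analyticOrderAt (deriv F) rho := hord' ▸ le_self_add
  change _ = analyticOrderAt F rho at hd
  rw [← hd] at hle hFt
  have hdt : analyticOrderAt (deriv F) rho ≠ ⊤ := by
    intro h; rw [h] at hFt; simp at hFt
  obtain ⟨m, hm⟩ := ENat.ne_top_iff_exists.mp hdt
  rw [← hm] at hle
  have : m + 1 ≤ m := by exact_mod_cast hle
  omega

lemma ord_eq_one {f : ℍ → ℂ} (hf : MDiff f) {z : ℍ} (h0 : f z = 0)
    (hd : normalizedDerivOfComplex f z ≠ 0) : ord f z = 1 := by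
  have h := (analyticAt_comp_ofComplex hf z).analyticOrderAt_eq_one_of_zero_deriv_ne_zero
    (by simpa using h0) (by
      rw [deriv_comp_ofComplex]
      exact mul_ne_zero Complex.two_pi_I_ne_zero hd)
  rw [ord, analyticOrderNatAt, h]; rfl

/-- A double zero of E₄ at ρ would be a zero of the bracket, which has none. The same argument
serves for E₆ at i. -/
lemma ord_E₄_rho : ord E₄ rho = 1 := by
  refine ord_eq_one E₄.holo' E₄_rho fun h => bracketE₄E₆_ne_zero rho ?_
  rw [bracketE₄E₆, E₄_rho]
  rw [show normalizedDerivOfComplex E₄ rho = 0 from h]; ring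

lemma ord_E₆_I : ord E₆ I = 1 := by
  refine ord_eq_one E₆.holo' E₆_I fun h => bracketE₄E₆_ne_zero I ?_
  rw [bracketE₄E₆, E₆_I]
  rw [show normalizedDerivOfComplex E₆ I = 0 from h]; ring

end EisensteinZeros

/-! ### Bijectivity of j, the valence formula and the table value -/

namespace EisensteinZeros

open Filter Topology EisensteinSeries ModularForm UpperHalfPlane Derivative
open scoped Manifold

lemma tendsto_atImInfty_coeff_zero {k : ℤ} (f : ModularForm 𝒮ℒ k) :
    Tendsto f atImInfty (𝓝 ((qExpansion 1 f).coeff 0)) := by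
  have h1 : Tendsto (fun z : ℍ => cuspFunction 1 f (Function.Periodic.qParam 1 z)) atImInfty
      (𝓝 (cuspFunction 1 f 0)) :=
    (ModularFormClass.analyticAt_cuspFunction_zero f one_pos
      one_mem_strictPeriods_SL).continuousAt.tendsto.comp
      (qParam_tendsto_atImInfty one_pos)
  have h2 : (qExpansion 1 f).coeff 0 = cuspFunction 1 f 0 := by
    simp [qExpansion_coeff]
  rw [h2]
  refine h1.congr fun z => ?_
  exact SlashInvariantFormClass.eq_cuspFunction f z one_mem_strictPeriods_SL one_ne_zero

/-- The form `E₄³ - c Δ` of weight `12`. -/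
noncomputable def jForm (c : ℂ) : ModularForm 𝒮ℒ 12 :=
  ModularForm.mcast (by decide) (E₄.pow 3) - c • CuspForm.toModularFormₗ CuspForm.discriminant

lemma jForm_apply (c : ℂ) (z : ℍ) : jForm c z = E₄ z ^ 3 - c * discriminant z := rfl

lemma jForm_eq_zero_iff (c : ℂ) (z : ℍ) : jForm c z = 0 ↔ jInv z = c := by
  rw [jForm_apply, jInv, div_eq_iff (discriminant_ne_zero z), sub_eq_zero]

lemma tendsto_jForm (c : ℂ) : Tendsto (jForm c) atImInfty (𝓝 1) := by
  have h4 := tendsto_atImInfty_coeff_zero E₄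
  rw [E_qExpansion_coeff_zero (k := 4) (by norm_num) (by decide)] at h4
  have := (h4.pow 3).sub (discriminant_isZeroAtImInfty.const_mul c)
  rw [one_pow, mul_zero, sub_zero] at this
  exact this

lemma coeff_zero_jForm (c : ℂ) : (qExpansion 1 (jForm c)).coeff 0 = 1 :=
  tendsto_nhds_unique (tendsto_atImInfty_coeff_zero _) (tendsto_jForm c)

lemma jForm_ne_zero (c : ℂ) : jForm c ≠ 0 := by
  intro h
  have := coeff_zero_jForm c
  rw [h] at this
  simp [qExpansion_zero] at this

lemma hasExpansion_jForm (c : ℂ) : HasExpansion (jForm c) :=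
  hasExpansion_of_modularForm _ (jForm_ne_zero c)

lemma ordInfty_jForm (c : ℂ) : ordInfty (jForm c) = 0 := by
  rw [ordInfty, ENat.toNat_eq_zero]
  left
  rw [← not_ne_iff, PowerSeries.order_ne_zero_iff_constCoeff_eq_zero,
    ← PowerSeries.coeff_zero_eq_constantCoeff_apply, coeff_zero_jForm]
  exact one_ne_zero

lemma discriminant_div_jForm_slash (c : ℂ) (γ : SL(2, ℤ)) :
    (fun z => discriminant z / jForm c z) ∣[(0 : ℤ)] γ = fun z => discriminant z / jForm c z := by
  have hγ : (γ : GL (Fin 2) ℝ) ∈ 𝒮ℒ := MonoidHom.mem_range.mpr ⟨γ, rfl⟩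
  have h1 : ⇑CuspForm.discriminant ∣[(12 : ℤ)] γ = CuspForm.discriminant :=
    CuspForm.discriminant.slash_action_eq' γ hγ
  have h2 : ⇑(jForm c) ∣[(12 : ℤ)] γ = jForm c := (jForm c).slash_action_eq' γ hγ
  have := div_slash_SL2 12 12 γ CuspForm.discriminant (jForm c)
  rw [h1, h2] at this
  exact this

/-- The modular invariant is surjective. -/
theorem jInv_surjective : Function.Surjective jInv := by
  intro c
  by_contra! h
  have hne : ∀ z, jForm c z ≠ 0 := fun z hz => h z ((jForm_eq_zero_iff c z).mp hz)
  -- If j omits c, then E₄³ - cΔ has no zero in ℍ and tends to 1 at ∞. The quotient is a weight-0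
  -- form, hence constant, and its limit 0 at ∞ contradicts Δ ≠ 0.
  let φ : ModularForm 𝒮ℒ 0 :=
    { toFun z := discriminant z / jForm c z
      slash_action_eq' := fun _ ⟨γ, hγ⟩ => hγ ▸ discriminant_div_jForm_slash c γ
      holo' := CuspForm.discriminant.holo'.div (jForm c).holo' hne
      bdd_at_cusps' {c'} hc := by
        rw [Subgroup.IsArithmetic.isCusp_iff_isCusp_SL2Z] at hc
        rw [OnePoint.isBoundedAt_iff_forall_SL2Z hc]
        intro γ _
        rw [discriminant_div_jForm_slash c γ]
        have := discriminant_isZeroAtImInfty.div (tendsto_jForm c) one_ne_zero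
        exact this.isBigO_one ℝ }
  obtain ⟨a, ha⟩ := ModularFormClass.levelOne_weight_zero_const φ
  have h1 : Tendsto (fun _ : ℍ => a) atImInfty (𝓝 0) := by
    have := discriminant_isZeroAtImInfty.div (tendsto_jForm c) one_ne_zero
    rw [zero_div] at this
    exact this.congr fun z => congrFun ha z
  have ha0 : a = 0 := tendsto_nhds_unique tendsto_const_nhds h1
  have := congrFun ha I
  rw [ha0] at this
  exact div_ne_zero (discriminant_ne_zero I) (hne I) this

lemma jInv_smul (γ : SL(2, ℤ)) (z : ℍ) : jInv (γ • z) = jInv z := by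
  rw [← jForm_eq_zero_iff, apply_smul_eq_zero_iff, jForm_eq_zero_iff]

/-- `jInv` is a bijection from the strict fundamental domain onto `ℂ`. -/
lemma exists_jInv_eq (c : ℂ) : ∃ z ∈ strictFundamentalDomain, jInv z = c := by
  obtain ⟨z, hz⟩ := jInv_surjective c
  obtain ⟨g, hg⟩ := exists_smul_mem_strictFundamentalDomain z
  exact ⟨g • z, hg, by rw [jInv_smul, hz]⟩

lemma eq_of_jInv_eq {z w : ℍ} (hz : z ∈ strictFundamentalDomain)
    (hw : w ∈ strictFundamentalDomain) (h : jInv z = jInv w) : z = w := by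
  obtain ⟨γ, rfl⟩ := exists_smul_eq_of_jInv_eq h
  exact smul_eq_self_of_mem_strictFundamentalDomain hw hz

lemma jInv_rho : jInv rho = 0 := by rw [jInv, E₄_rho]; simp

lemma jInv_I : jInv I = 1728 := by
  have := discriminant_ne_zero I
  rw [jInv, div_eq_iff this, discriminant_eq_E₄_cube_sub_E₆_sq, E₆_I]
  ring

/-- The form is a combination of E₄³ and E₆². If it and its derivative vanish at z, eliminating E₄²
gives c·E₆(z)·bracket(z) = 0. But c = 0 forces z = ρ, E₆(z) = 0 forces z = i, and the bracket has no
zero. -/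
lemma ord_jForm_eq_one {c : ℂ} {z : ℍ} (hz : z ∈ strictFundamentalDomain) (h : jInv z = c)
    (hI : z ≠ I) (hρ : z ≠ rho) : ord (jForm c) z = 1 := by
  have hh := (jForm_eq_zero_iff c z).mpr h
  refine ord_eq_one (jForm c).holo' hh fun hd => ?_
  have hc0 : c ≠ 0 := by
    rintro rfl
    exact hρ (eq_of_jInv_eq hz rho_mem_strictFundamentalDomain (by rw [h, jInv_rho]))
  have h6 : E₆ z ≠ 0 := by
    intro h6
    apply hI
    refine eq_of_jInv_eq hz I_mem_strictFundamentalDomain ?_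
    have hD := discriminant_ne_zero z
    rw [jInv_I, jInv, div_eq_iff hD, discriminant_eq_E₄_cube_sub_E₆_sq, h6]
    ring
  have hfun : (jForm c : ℍ → ℂ) = (1 - c / 1728) • (⇑E₄ ^ 3) + (c / 1728) • (⇑E₆ ^ 2) := by
    ext w
    simp only [jForm_apply, Pi.add_apply, Pi.smul_apply, Pi.pow_apply, smul_eq_mul,
      discriminant_eq_E₄_cube_sub_E₆_sq]
    ring
  have m4 : MDiff (⇑E₄ ^ 3) := E₄.holo'.pow 3
  have m6 : MDiff (⇑E₆ ^ 2) := E₆.holo'.pow 2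
  change normalizedDerivOfComplex (jForm c) z = 0 at hd
  rw [hfun, normalizedDerivOfComplex_add _ _ (m4.const_smul _) (m6.const_smul _),
    normalizedDerivOfComplex_smul _ _ m4, normalizedDerivOfComplex_smul _ _ m6,
    normalizedDerivOfComplex_pow ⇑E₄ 3 E₄.holo', normalizedDerivOfComplex_pow ⇑E₆ 2 E₆.holo'] at hd
  rw [hfun] at hh
  simp only [Pi.add_apply, Pi.smul_apply, Pi.pow_apply, Pi.mul_apply, smul_eq_mul,
    Pi.natCast_apply] at hd hh
  have key : c / 1728 * E₆ z * bracketE₄E₆ z = 0 := by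
    rw [bracketE₄E₆]
    push_cast at hd
    simp only [pow_one] at hd
    linear_combination E₄ z * hd - 3 * normalizedDerivOfComplex E₄ z * hh
  exact mul_ne_zero (mul_ne_zero (div_ne_zero hc0 (by norm_num)) h6) (bracketE₄E₆_ne_zero z) key

lemma hasExpansion_E {k : ℕ} (hk : 3 ≤ k) (he : Even k) : HasExpansion (E hk) :=
  hasExpansion_of_modularForm _ (E_ne_zero hk he)

lemma ord_pow {f : ℍ → ℂ} (hf : HasExpansion f) (n : ℕ) (z : ℍ) : ord (f ^ n) z = n * ord f z := by
  have := analyticOrderNatAt_pow (analyticAt_comp_ofComplex hf.mdiff z) n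
  simpa [ord] using! this

/-- The single zero contributes 6 in every case. It is simple with weight 6 at a general point,
double with weight 3 at i (where c = 1728 and the form is E₆²), and triple with weight 2 at ρ (where
c = 0 and the form is E₄³). -/
lemma hasValence_jForm (c : ℂ) : HasValence (jForm c) 6 := by
  obtain ⟨z₀, hz₀, hj⟩ := exists_jInv_eq c
  have hzero : ∀ z ∈ strictFundamentalDomain, jForm c z = 0 ↔ z = z₀ := fun z hz => by
    rw [jForm_eq_zero_iff]
    exact ⟨fun h => eq_of_jInv_eq hz hz₀ (h.trans hj.symm), fun h => h ▸ hj⟩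
  have hord : ∀ z ∈ strictFundamentalDomain, z ≠ z₀ → ord (jForm c) z = 0 := fun z hz hne =>
    (ord_eq_zero_iff (hasExpansion_jForm c) z).mpr fun h => hne ((hzero z hz).mp h)
  refine ⟨(Set.finite_singleton z₀).subset fun z hz => (hzero z hz.1).mp hz.2, ?_⟩
  rw [ordInfty_jForm]
  by_cases hI : z₀ = I
  · subst hI
    have hc : c = 1728 := hj.symm.trans jInv_I
    have h1 : ord (jForm c) I = 2 := by
      have : (jForm c : ℍ → ℂ) = ⇑E₆ ^ 2 := by
        ext w
        rw [jForm_apply, hc, discriminant_eq_E₄_cube_sub_E₆_sq, Pi.pow_apply]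
        ring
      rw [this, ord_pow (hasExpansion_E _ (by decide)), ord_E₆_I]
    rw [h1, hord rho rho_mem_strictFundamentalDomain I_ne_rho.symm,
      finsum_mem_eq_zero_of_forall_eq_zero fun z hz => hord z hz.1 fun h => hz.2 (by simp [h])]
    norm_num
  by_cases hρ : z₀ = rho
  · subst hρ
    have hc : c = 0 := hj.symm.trans jInv_rho
    have h1 : ord (jForm c) rho = 3 := by
      have : (jForm c : ℍ → ℂ) = ⇑E₄ ^ 3 := by
        ext w
        rw [jForm_apply, hc, Pi.pow_apply]
        ring
      rw [this, ord_pow (hasExpansion_E _ (by decide)), ord_E₄_rho]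
    rw [h1, hord I I_mem_strictFundamentalDomain I_ne_rho,
      finsum_mem_eq_zero_of_forall_eq_zero fun z hz => hord z hz.1 fun h => hz.2 (by simp [h])]
    norm_num
  · have h1 := ord_jForm_eq_one hz₀ hj hI hρ
    have hsupp : generalDomain ∩ Function.support (ord (jForm c)) = {z₀} := by
      ext z
      rw [Set.mem_singleton_iff]
      constructor
      · rintro ⟨hz, hz'⟩
        by_contra hne
        exact hz' (hord z hz.1 hne)
      · rintro rfl
        exact ⟨⟨hz₀, by simp [hI, hρ]⟩, by rw [Function.mem_support, h1]; exact one_ne_zero⟩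
    rw [hord rho rho_mem_strictFundamentalDomain (Ne.symm hρ),
      hord I I_mem_strictFundamentalDomain (Ne.symm hI),
      ← finsum_mem_inter_support, hsupp, finsum_mem_singleton, h1]

lemma hasValence_multiset_prod (s : Multiset ℂ) :
    HasExpansion (s.map fun c => (jForm c : ℍ → ℂ)).prod ∧
      HasValence (s.map fun c => (jForm c : ℍ → ℂ)).prod (6 * s.card) := by
  induction s using Multiset.induction_on with
  | empty =>
    simp only [Multiset.map_zero, Multiset.prod_zero, Multiset.card_zero, mul_zero]
    exact ⟨hasExpansion_const one_ne_zero, hasValence_const one_ne_zero⟩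
  | cons a s ih =>
    rw [Multiset.map_cons, Multiset.prod_cons, Multiset.card_cons, mul_add, mul_one, add_comm]
    exact ⟨(hasExpansion_jForm a).mul ih.1,
      HasValence.mul (hasExpansion_jForm a) ih.1 (hasValence_jForm a) ih.2⟩

/-- The twelfth power of a nonzero form of weight `w` has weighted number of zeros `w`. -/
lemma hasValence_pow_twelve {w : ℕ} (f : ModularForm 𝒮ℒ (w : ℤ)) (hf : f ≠ 0) :
    HasValence (⇑f ^ 12) (6 * w) := by
  obtain ⟨P, hP, hfP⟩ := exists_polynomial_jInv w ((f.pow 12).mcast (by push_cast; ring))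
  simp only [coe_mcast, coe_pow, Pi.pow_apply] at hfP
  have hP0 : P ≠ 0 := by
    rintro rfl
    apply hf
    ext z
    have := hfP z
    simpa using this
  have hsplit := IsAlgClosed.splits P
  have hcard : P.roots.card = P.natDegree := hsplit.natDegree_eq_card_roots.symm
  have heval : ∀ z, discriminant z ^ P.natDegree * P.eval (jInv z) =
      P.leadingCoeff * (P.roots.map fun c => jForm c z).prod := by
    intro z
    have h1 : P.eval (jInv z) = P.leadingCoeff * (P.roots.map fun c => jInv z - c).prod := by
      conv_lhs => rw [hsplit.eq_prod_roots]
      rw [Polynomial.eval_mul, Polynomial.eval_C, Polynomial.eval_multiset_prod, Multiset.map_map]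
      simp
    have h2 : (P.roots.map fun c => jForm c z).prod =
        discriminant z ^ P.natDegree * (P.roots.map fun c => jInv z - c).prod := by
      rw [← hcard, ← Multiset.card_map (fun c => jInv z - c) P.roots, ← Multiset.prod_replicate,
        Multiset.card_map, ← Multiset.map_const', ← Multiset.prod_map_mul]
      congr 1
      refine Multiset.map_congr rfl fun c _ => ?_
      rw [jForm_apply, mul_sub, jInv, mul_div_cancel₀ _ (discriminant_ne_zero z)]
      ring
    rw [h1, h2]; ring
  -- Each linear factor of P absorbs one Δ to become some E₄³ - cΔ. The Δ's left over when deg P < w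
  -- are the zeros of f^12 at the cusp.
  have hfun : (⇑f ^ 12 : ℍ → ℂ) = discriminant ^ (w - P.natDegree) *
      ((fun _ => P.leadingCoeff) * (P.roots.map fun c => (jForm c : ℍ → ℂ)).prod) := by
    ext z
    have h3 : (P.roots.map fun c => (jForm c : ℍ → ℂ)).prod z =
        (P.roots.map fun c => jForm c z).prod := by
      rw [Pi.multiset_prod_apply, Multiset.map_map]
      rfl
    rw [Pi.pow_apply, hfP, Pi.mul_apply, Pi.mul_apply, h3, ← heval, Pi.pow_apply, ← mul_assoc,
      ← pow_add, Nat.sub_add_cancel hP]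
  have hl := Polynomial.leadingCoeff_ne_zero.mpr hP0
  obtain ⟨e1, v1⟩ := hasValence_multiset_prod P.roots
  have v2 := HasValence.mul (hasExpansion_const hl) e1 (hasValence_const hl) v1
  have v3 := HasValence.mul (hasExpansion_discriminant.pow _) ((hasExpansion_const hl).mul e1)
    (hasValence_discriminant.pow hasExpansion_discriminant (w - P.natDegree)) v2
  rw [hfun]
  convert v3 using 1
  rw [hcard]
  omega

lemma finite_zeros_of_modularForm {w : ℕ} (f : ModularForm 𝒮ℒ (w : ℤ)) (hf : f ≠ 0) :
    {z ∈ strictFundamentalDomain | f z = 0}.Finite := by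
  refine (hasValence_pow_twelve f hf).1.subset ?_
  rintro z ⟨hz, h0⟩
  exact ⟨hz, by simp [h0]⟩

/-- The valence formula for `SL(2, ℤ)`. -/
theorem valence_formula {w : ℕ} (f : ModularForm 𝒮ℒ (w : ℤ)) (hf : f ≠ 0) :
    12 * (6 * ordInfty f + 3 * ord f I + 2 * ord f rho + 6 * ∑ᶠ z ∈ generalDomain, ord f z)
      = 6 * w := by
  have hE := hasExpansion_of_modularForm f hf
  have h := (hasValence_pow_twelve f hf).2
  have hord : ∀ z, ord (⇑f ^ 12) z = 12 * ord f z := ord_pow hE 12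
  have hinf : ordInfty (⇑f ^ 12) = 12 * ordInfty f := by
    have : ∀ n : ℕ, ordInfty (⇑f ^ n) = n * ordInfty f := by
      intro n
      induction n with
      | zero =>
        have hne := hE.qExpansion_ne_zero
        have := ordInfty_mul (hE.pow 0) hE
        rw [pow_zero, one_mul] at this
        rw [pow_zero]
        omega
      | succ n ih => rw [pow_succ, ordInfty_mul (hE.pow n) hE, ih]; ring
    exact this 12
  have hsum : ∑ᶠ z ∈ generalDomain, ord (⇑f ^ 12) z = 12 * ∑ᶠ z ∈ generalDomain, ord f z := by
    have := AddMonoidHom.map_finsum_mem' (AddMonoidHom.mulLeft 12)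
      (finite_inter_support_ord hE (finite_zeros_of_modularForm f hf))
    simp only [AddMonoidHom.coe_mulLeft] at this
    rw [this]
    exact finsum_mem_congr rfl fun z _ => hord z
  rw [hord, hord, hinf, hsum] at h
  linarith

/-- The number of nontrivial zeros of a cusp form of even weight. -/
theorem nontrivialZeroCount_eq {w : ℕ} (f : CuspForm 𝒮ℒ (w : ℤ)) (hf : f ≠ 0) :
    nontrivialZeroCount w f =
      (w : ℚ) / 12 - 1 - (forcedOrdI w : ℚ) / 2 - (forcedOrdRho w : ℚ) / 3 := by
  have hg : CuspForm.toModularFormₗ f ≠ 0 := by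
    intro h
    apply hf
    ext z
    exact congrArg (fun F : ModularForm 𝒮ℒ (w : ℤ) => F z) h
  have h := valence_formula (CuspForm.toModularFormₗ f) hg
  have hc : ((CuspForm.toModularFormₗ f : ModularForm 𝒮ℒ (w : ℤ)) : ℍ → ℂ) = f := rfl
  rw [hc] at h
  have hq : (12 : ℚ) * (6 * ordInfty f + 3 * ord f I + 2 * ord f rho +
      6 * (∑ᶠ z ∈ generalDomain, ord f z : ℕ)) = 6 * w := by exact_mod_cast h
  rw [nontrivialZeroCount]
  rw [show strictFundamentalDomain \ {UpperHalfPlane.I, rho} = generalDomain from rfl]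
  linarith

/-- With ℓ = 6r + s the weight is 12(n + r) + 2s + j, so the difference from n + r depends only on s
and j and the eighteen entries can be checked one by one. -/
lemma tableValue_eq {k l n j : ℕ} (hk : Even k) (hl : Even l) (hkl : l ≤ k)
    (h : k - l = 12 * n + j) (hj : j < 12) :
    (tableValue n j l : ℚ) = ((k + l : ℕ) : ℚ) / 12 - 1 - (forcedOrdI (k + l) : ℚ) / 2 -
      (forcedOrdRho (k + l) : ℚ) / 3 := by
  have hk' : k = l + 12 * n + j := by omega
  subst hk'
  obtain ⟨r, s, hs, rfl⟩ : ∃ r s, s < 6 ∧ l = 6 * r + s :=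
    ⟨l / 6, l % 6, Nat.mod_lt _ (by norm_num), (Nat.div_add_mod l 6).symm⟩
  have hs2 : s = 0 ∨ s = 2 ∨ s = 4 := by
    obtain ⟨t, ht⟩ := hl; omega
  have hj2 : j = 0 ∨ j = 2 ∨ j = 4 ∨ j = 6 ∨ j = 8 ∨ j = 10 := by
    obtain ⟨t, ht⟩ := hk; obtain ⟨u, hu⟩ := hl; omega
  have e1 : (6 * r + s) / 6 = r := by omega
  have e2 : (6 * r + s) % 6 = s := by omega
  have e3 : (6 * r + s + 12 * n + j + (6 * r + s)) % 4 = (2 * s + j) % 4 := by omega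
  have e4 : (6 * r + s + 12 * n + j + (6 * r + s)) % 3 = (2 * s + j) % 3 := by omega
  rw [tableValue, forcedOrdI, forcedOrdRho, e1, e2, e3, e4]
  rcases hs2 with rfl | rfl | rfl <;> rcases hj2 with rfl | rfl | rfl | rfl | rfl | rfl <;>
    norm_num [tableOffset] <;> ring

end EisensteinZeros

/-! ### Tail bounds for Eisenstein series, and reality of Δ on the two lines -/

namespace EisensteinZeros

open Filter Topology EisensteinSeries ModularForm UpperHalfPlane

/-- The lattice sums of exponent `4` are uniformly bounded on `|x| ≤ 1`, `y ≥ 1 / 2`. -/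
lemma exists_tsum_latVec_le : ∃ C : ℝ, 0 < C ∧ ∀ z : ℍ, |z.re| ≤ 1 → 1 / 2 ≤ z.im →
    ∑' v : Fin 2 → ℤ, ‖((latVec z v)⁻¹) ^ 4‖ ≤ C := by
  have hB : (0 : ℝ) < 1 / 2 := by norm_num
  have hs := (summable_one_div_norm_rpow (k := 4) (by norm_num)).mul_left
    (r ⟨⟨1, 1 / 2⟩, hB⟩ ^ (-4 : ℝ))
  refine ⟨∑' v : Fin 2 → ℤ, r ⟨⟨1, 1 / 2⟩, hB⟩ ^ (-4 : ℝ) * ‖v‖ ^ (-4 : ℝ) + 1, ?_, ?_⟩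
  · have : 0 ≤ ∑' v : Fin 2 → ℤ, r ⟨⟨1, 1 / 2⟩, hB⟩ ^ (-4 : ℝ) * ‖v‖ ^ (-4 : ℝ) :=
      tsum_nonneg fun v => mul_nonneg (Real.rpow_nonneg (r_pos _).le _)
        (Real.rpow_nonneg (norm_nonneg _) _)
    linarith
  · intro z h1 h2
    refine (Summable.tsum_le_tsum (fun v => ?_) (summable_norm_latVec (by norm_num) z) hs).trans
      (le_add_of_nonneg_right zero_le_one)
    have := summand_bound_of_mem_verticalStrip (k := 4) (by norm_num) v hB (z := z) ⟨h1, h2⟩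
    refine le_trans (le_of_eq ?_) this
    rw [norm_pow, norm_inv, Real.rpow_neg (norm_nonneg _), inv_pow]
    norm_cast

/-- A constant bounding lattice sums of exponent `4` on `|x| ≤ 1`, `y ≥ 1 / 2`. -/
noncomputable def tailConst : ℝ := exists_tsum_latVec_le.choose

lemma tailConst_pos : 0 < tailConst := exists_tsum_latVec_le.choose_spec.1

lemma tsum_latVec_le {z : ℍ} (h1 : |z.re| ≤ 1) (h2 : 1 / 2 ≤ z.im) :
    ∑' v : Fin 2 → ℤ, ‖((latVec z v)⁻¹) ^ 4‖ ≤ tailConst :=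
  exists_tsum_latVec_le.choose_spec.2 z h1 h2

/-- Sums over lattice vectors of norm at least `μ`. -/
lemma tsum_subtype_latVec_le {z : ℍ} (h1 : |z.re| ≤ 1) (h2 : 1 / 2 ≤ z.im) {s : Set (Fin 2 → ℤ)}
    {μ : ℝ} (hμ : 0 < μ) (hs : ∀ v ∈ s, μ ≤ ‖latVec z v‖) (k : ℕ) :
    ∑' v : s, ‖((latVec z v)⁻¹) ^ (k + 4)‖ ≤ tailConst * (μ⁻¹) ^ k := by
  have hsum4 := summable_norm_latVec (k := 4) (by norm_num) z
  have hsumk := summable_norm_latVec (k := k + 4) (by omega) z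
  calc ∑' v : s, ‖((latVec z v)⁻¹) ^ (k + 4)‖
      ≤ ∑' v : s, ‖((latVec z v)⁻¹) ^ 4‖ * (μ⁻¹) ^ k := by
        refine Summable.tsum_le_tsum (fun v => ?_) (hsumk.subtype _)
          ((hsum4.subtype s).mul_right _)
        rw [norm_pow, norm_pow, norm_inv, pow_add, mul_comm]
        have := hs v v.2
        gcongr
    _ = (∑' v : s, ‖((latVec z v)⁻¹) ^ 4‖) * (μ⁻¹) ^ k := tsum_mul_right
    _ ≤ tailConst * (μ⁻¹) ^ k := by
        gcongr
        refine le_trans ?_ (tsum_latVec_le h1 h2)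
        exact Summable.tsum_subtype_le (fun v => ‖((latVec z v)⁻¹) ^ 4‖) s (fun _ => norm_nonneg _)
          hsum4

lemma tsum_gammaSet_eq_add {f : (Fin 2 → ℤ) → ℂ} (hf : Summable fun v => ‖f v‖)
    {s : Set (Fin 2 → ℤ)} (hs : s ⊆ gammaSet 1 1 0) :
    ∑' v : gammaSet 1 1 0, f v =
      ∑' v : s, f v + ∑' v : (gammaSet 1 1 0 \ s : Set (Fin 2 → ℤ)), f v := by
  have h := hf.of_norm
  have key : ∀ t : Set (Fin 2 → ℤ), s ⊆ t →
      ∑' v : t, f v = ∑' v : s, f v + ∑' v : (t \ s : Set (Fin 2 → ℤ)), f v := by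
    intro t ht
    have := Summable.tsum_union_disjoint (f := f) (s := s) (t := t \ s)
      Set.disjoint_sdiff_right (h.subtype s) (h.subtype (t \ s))
    rwa [Set.union_sdiff_cancel ht] at this
  exact key _ hs

/-- Approximation of `E_k` by a partial sum containing all short lattice vectors. -/
lemma norm_E_sub_le {z : ℍ} (h1 : |z.re| ≤ 1) (h2 : 1 / 2 ≤ z.im) {s : Set (Fin 2 → ℤ)}
    (hs : s ⊆ gammaSet 1 1 0) {μ : ℝ} (hμ : 0 < μ)
    (hsμ : ∀ v ∈ gammaSet 1 1 0, v ∉ s → μ ≤ ‖latVec z v‖) {k : ℕ} (hk : 3 ≤ k + 4) :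
    ‖E hk z - 1 / 2 * ∑' v : s, ((latVec z v)⁻¹) ^ (k + 4)‖ ≤ tailConst * (μ⁻¹) ^ k := by
  have hsum := summable_norm_latVec hk z
  rw [E_apply_eq_tsum, tsum_gammaSet_eq_add hsum hs]
  have hb := tsum_subtype_latVec_le h1 h2 hμ
    (s := gammaSet 1 1 0 \ s) (fun v hv => hsμ v hv.1 hv.2) k
  have hn := norm_tsum_le_tsum_norm (hsum.subtype (gammaSet 1 1 0 \ s))
  have : (1 / 2 : ℂ) * (∑' v : s, ((latVec z v)⁻¹) ^ (k + 4) +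
      ∑' v : (gammaSet 1 1 0 \ s : Set (Fin 2 → ℤ)), ((latVec z v)⁻¹) ^ (k + 4)) -
      1 / 2 * ∑' v : s, ((latVec z v)⁻¹) ^ (k + 4) =
      1 / 2 * ∑' v : (gammaSet 1 1 0 \ s : Set (Fin 2 → ℤ)), ((latVec z v)⁻¹) ^ (k + 4) := by ring
  rw [this, norm_mul]
  have h12 : ‖(1 / 2 : ℂ)‖ = 1 / 2 := by norm_num
  rw [h12]
  have hn' : ‖∑' v : (gammaSet 1 1 0 \ s : Set (Fin 2 → ℤ)), ((latVec z v)⁻¹) ^ (k + 4)‖ ≤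
    tailConst * (μ⁻¹) ^ k := hn.trans hb
  have h0 := (norm_nonneg _).trans hn'
  linarith

/-- The point `-z̄` of the upper half plane. -/
noncomputable def reflect (z : ℍ) : ℍ := ⟨⟨-z.re, z.im⟩, z.im_pos⟩

lemma coe_reflect (z : ℍ) : (reflect z : ℂ) = -(starRingEnd ℂ) z := by
  apply Complex.ext
  · show -z.re = _; simp
  · show z.im = _; simp

lemma conj_latVec (z : ℍ) (v : Fin 2 → ℤ) :
    (starRingEnd ℂ) (latVec z v) = latVec (reflect z) ![-v 0, v 1] := by
  simp [latVec, coe_reflect]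

/-- Conjugation turns cz + d into (-c)(-z̄) + d, and (c, d) ↦ (-c, d) permutes the primitive pairs.
-/
lemma conj_E {k : ℕ} (hk : 3 ≤ k) (z : ℍ) : (starRingEnd ℂ) (E hk z) = E hk (reflect z) := by
  have hmem : ∀ v : Fin 2 → ℤ, v ∈ gammaSet 1 1 0 → ![-v 0, v 1] ∈ gammaSet 1 1 0 := by
    intro v hv
    rw [mem_gammaSet_one] at hv ⊢
    simpa using hv.neg_left
  let e : gammaSet 1 1 0 ≃ gammaSet 1 1 0 :=
    { toFun v := ⟨![-v.1 0, v.1 1], hmem v v.2⟩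
      invFun v := ⟨![-v.1 0, v.1 1], hmem v v.2⟩
      left_inv v := by ext i; fin_cases i <;> simp
      right_inv v := by ext i; fin_cases i <;> simp }
  rw [E_apply_eq_tsum, E_apply_eq_tsum, map_mul, Complex.conj_tsum,
    ← e.tsum_eq fun v : gammaSet 1 1 0 => ((latVec (reflect z) v)⁻¹) ^ k]
  congr 1
  · rw [map_div₀, map_one, map_ofNat]
  · refine tsum_congr fun v => ?_
    rw [map_pow, map_inv₀, conj_latVec]
    rfl

/-- `Δ_{k,ℓ}` as a modular form. -/
noncomputable def deltaForm {k l : ℕ} (hk : 4 ≤ k) (hl : 4 ≤ l) :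
    ModularForm 𝒮ℒ ((k + l : ℕ) : ℤ) :=
  ModularForm.mcast (by push_cast; rfl)
    ((E (show 3 ≤ k by omega)).mul (E (show 3 ≤ l by omega))) - E (show 3 ≤ k + l by omega)

lemma coe_deltaForm {k l : ℕ} (hk : 4 ≤ k) (hl : 4 ≤ l) : ⇑(deltaForm hk hl) = Delta hk hl := rfl

lemma conj_Delta {k l : ℕ} (hk : 4 ≤ k) (hl : 4 ≤ l) (z : ℍ) :
    (starRingEnd ℂ) (Delta hk hl z) = Delta hk hl (reflect z) := by
  simp only [Delta, map_sub, map_mul, conj_E]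

lemma Delta_smul {k l : ℕ} (hk : 4 ≤ k) (hl : 4 ≤ l) (γ : SL(2, ℤ)) (z : ℍ) :
    Delta hk hl (γ • z) = denom γ z ^ (k + l) * Delta hk hl z := by
  have := apply_smul (deltaForm hk hl) γ z
  rw [zpow_natCast] at this
  exact this

/-- The point `e^{iθ}`. -/
noncomputable def arcPt (θ : ℝ) : ℍ := ofComplex (Complex.exp (θ * Complex.I))

lemma coe_arcPt {θ : ℝ} (h : 0 < Real.sin θ) : (arcPt θ : ℂ) = Complex.exp (θ * Complex.I) := by
  rw [arcPt, ofComplex_apply_of_im_pos (by simpa [Complex.exp_ofReal_mul_I_im] using h)]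

/-- The point `1/2 + iy`. -/
noncomputable def sidePt (y : ℝ) : ℍ := ofComplex (1 / 2 + y * Complex.I)

lemma coe_sidePt {y : ℝ} (h : 0 < y) : (sidePt y : ℂ) = 1 / 2 + y * Complex.I := by
  rw [sidePt, ofComplex_apply_of_im_pos (by simpa using h)]

lemma sidePt_re {y : ℝ} (h : 0 < y) : (sidePt y).re = 1 / 2 := by
  rw [← coe_re, coe_sidePt h]; simp

lemma sidePt_im {y : ℝ} (h : 0 < y) : (sidePt y).im = y := by
  rw [← coe_im, coe_sidePt h]; simp

/-- The real-valued normalisation `e^{iwθ/2} f(e^{iθ})` on the arc. -/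
noncomputable def arcVal (f : ℍ → ℂ) (w : ℕ) (θ : ℝ) : ℝ :=
  (Complex.exp (w * (θ / 2) * Complex.I) * f (arcPt θ)).re

/-- The real part of `f` on the line `x = 1/2`. -/
noncomputable def sideVal (f : ℍ → ℂ) (y : ℝ) : ℝ := (f (sidePt y)).re

/-- On the unit circle -z̄ = -1/z = Sz, so the conjugate of Δ(z) is z^w Δ(z). The factor e^{iwθ/2}
splits z^w evenly between the two sides. -/
lemma ofReal_arcVal {k l : ℕ} (hk : 4 ≤ k) (hl : 4 ≤ l) {θ : ℝ} (h : 0 < Real.sin θ) :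
    (arcVal (Delta hk hl) (k + l) θ : ℂ) =
      Complex.exp ((k + l : ℕ) * (θ / 2) * Complex.I) * Delta hk hl (arcPt θ) := by
  rw [arcVal, ← Complex.conj_eq_iff_re, map_mul, conj_Delta, ← Complex.exp_conj]
  have hz := coe_arcPt h
  have hr : reflect (arcPt θ) = ModularGroup.S • arcPt θ := by
    ext1
    rw [coe_reflect, hz, ← Complex.exp_conj, UpperHalfPlane.modular_S_smul]
    simp only [map_mul, Complex.conj_ofReal, Complex.conj_I]
    rw [UpperHalfPlane.coe_mk, hz, inv_neg, ← Complex.exp_neg]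
    congr 2; ring
  rw [hr, Delta_smul, ModularGroup.denom_S, hz, ← Complex.exp_nat_mul, ← mul_assoc,
    ← Complex.exp_add]
  congr 2
  simp only [map_mul, Complex.conj_I, map_natCast, map_div₀, Complex.conj_ofReal, map_ofNat]
  ring

/-- On x = 1/2 the reflection -z̄ is the translate z - 1, and Δ has period 1. -/
lemma ofReal_sideVal {k l : ℕ} (hk : 4 ≤ k) (hl : 4 ≤ l) {y : ℝ} (h : 0 < y) :
    (sideVal (Delta hk hl) y : ℂ) = Delta hk hl (sidePt y) := by
  rw [sideVal, ← Complex.conj_eq_iff_re, conj_Delta]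
  have hr : ModularGroup.T • reflect (sidePt y) = sidePt y := by
    ext1
    rw [UpperHalfPlane.modular_T_smul, UpperHalfPlane.coe_vadd, coe_reflect, coe_sidePt h]
    simp only [map_add, map_mul, Complex.conj_I, Complex.conj_ofReal, map_div₀, map_one, map_ofNat]
    push_cast
    ring
  have := Delta_smul hk hl ModularGroup.T (reflect (sidePt y))
  rw [hr] at this
  rw [this]
  simp [ModularGroup.denom_apply, ModularGroup.coe_T]

end EisensteinZeros

/-! ### The six short lattice vectors and the remainder after them -/

namespace EisensteinZeros

open Filter Topology EisensteinSeries ModularForm UpperHalfPlane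

/-- The lattice vectors `±1, ±z, ±(z - 1)`. -/
def shortVecs : Finset (Fin 2 → ℤ) := {![0, 1], ![0, -1], ![1, 0], ![-1, 0], ![1, -1], ![-1, 1]}

lemma normSq_latVec (z : ℍ) (v : Fin 2 → ℤ) :
    ‖latVec z v‖ ^ 2 = (v 0 * z.re + v 1) ^ 2 + (v 0 * z.im) ^ 2 := by
  rw [← Complex.normSq_eq_norm_sq, Complex.normSq_apply]
  simp [latVec]
  ring

lemma norm_sq_coe (z : ℍ) : ‖(z : ℂ)‖ ^ 2 = z.re ^ 2 + z.im ^ 2 := by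
  rw [← Complex.normSq_eq_norm_sq, Complex.normSq_apply, coe_re, coe_im]
  ring

lemma abs_mul_im_le_norm_latVec (z : ℍ) (v : Fin 2 → ℤ) : |(v 0 : ℝ)| * z.im ≤ ‖latVec z v‖ := by
  have h := normSq_latVec z v
  refine abs_le_of_sq_le_sq' ?_ (norm_nonneg _) |>.2
  rw [h, mul_pow, sq_abs]
  nlinarith [sq_nonneg (v 0 * z.re + v 1 : ℝ)]

lemma eq_of_mem_gammaSet_of_zero {v : Fin 2 → ℤ} (hv : v ∈ gammaSet 1 1 0) (h : v 0 = 0) :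
    v = ![0, 1] ∨ v = ![0, -1] := by
  rw [mem_gammaSet_one, h, isCoprime_zero_left, Int.isUnit_iff] at hv
  rcases hv with hv | hv
  · left; ext i; fin_cases i <;> simp [h, hv]
  · right; ext i; fin_cases i <;> simp [h, hv]

lemma shortVecs_subset : (shortVecs : Set (Fin 2 → ℤ)) ⊆ gammaSet 1 1 0 := by
  intro v hv
  rw [mem_gammaSet_one]
  simp only [shortVecs, Finset.coe_insert, Finset.coe_singleton, Set.mem_insert_iff,
    Set.mem_singleton_iff] at hv
  rcases hv with rfl | rfl | rfl | rfl | rfl | rfl <;>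
    simp [isCoprime_one_right, isCoprime_zero_right, IsCoprime.neg_right_iff]

/-- For c = ±1 the squared norm is |z|² + 2ex + e² with e = ±d an integer other than 0 and -1, and 0
≤ x ≤ 1/2 makes 2ex + e² ≥ 1. For |c| ≥ 2 it is at least 4y², which exceeds |z|² + 1 because y² ≥
3/4. -/
lemma le_norm_latVec_of_notMem {z : ℍ} (h0 : 0 ≤ z.re) (h1 : z.re ≤ 1 / 2) (h : 1 ≤ ‖(z : ℂ)‖)
    {v : Fin 2 → ℤ} (hv : v ∈ gammaSet 1 1 0) (hs : v ∉ (shortVecs : Set (Fin 2 → ℤ))) :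
    ‖(z : ℂ)‖ ^ 2 + 1 ≤ ‖latVec z v‖ ^ 2 := by
  rw [normSq_latVec]
  have hR : 1 ≤ z.re ^ 2 + z.im ^ 2 := by rw [← norm_sq_coe]; nlinarith
  rw [norm_sq_coe]
  have hex : ∀ c d : ℤ, v 0 = c → v 1 = d → ![c, d] ∉ shortVecs := by
    intro c d hc hd hmem
    apply hs
    have : v = ![c, d] := by ext i; fin_cases i <;> simp [hc, hd]
    rw [this]; exact hmem
  have key : ∀ e : ℤ, 1 ≤ e ∨ e ≤ -2 → 1 ≤ 2 * (e : ℝ) * z.re + (e : ℝ) ^ 2 := by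
    rintro e (he | he)
    · have : (1 : ℝ) ≤ e := by exact_mod_cast he
      nlinarith
    · have : (e : ℝ) ≤ -2 := by exact_mod_cast he
      nlinarith
  obtain hc | hc | hc | hc : v 0 = 0 ∨ v 0 = 1 ∨ v 0 = -1 ∨ 2 ≤ |v 0| := by
    rcases abs_cases (v 0) with h | h <;> omega
  · exfalso
    rcases eq_of_mem_gammaSet_of_zero hv hc with h | h <;> exact hs (by simp [shortVecs, h])
  · have h2 := key (v 1) (by
      by_contra hcon
      have := hex 1 (v 1) hc rfl
      obtain h | h : v 1 = 0 ∨ v 1 = -1 := by omega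
      all_goals rw [h] at this; simp [shortVecs] at this)
    rw [hc]; push_cast; nlinarith
  · have h2 := key (-v 1) (by
      by_contra hcon
      have := hex (-1) (v 1) hc rfl
      obtain h | h : v 1 = 0 ∨ v 1 = 1 := by omega
      all_goals rw [h] at this; simp [shortVecs] at this)
    rw [hc]; push_cast at h2 ⊢; nlinarith
  · have h4 : (4 : ℝ) ≤ (v 0 : ℝ) ^ 2 := by
      rw [← sq_abs]
      have : (2 : ℝ) ≤ |(v 0 : ℝ)| := by exact_mod_cast hc
      nlinarith
    nlinarith [sq_nonneg (v 0 * z.re + v 1 : ℝ), mul_le_mul_of_nonneg_right h4 (sq_nonneg z.im)]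

/-- The remainder of `E_k` after the terms of `±1, ±z, ±(z - 1)`. -/
noncomputable def shortRem {k : ℕ} (hk : 3 ≤ k) (z : ℍ) : ℂ :=
  E hk z - (1 + ((z : ℂ)⁻¹) ^ k + (((z : ℂ) - 1)⁻¹) ^ k)

lemma norm_shortRem_le {z : ℍ} (h0 : 0 ≤ z.re) (h1 : z.re ≤ 1 / 2) (h : 1 ≤ ‖(z : ℂ)‖)
    {k : ℕ} (hk : 3 ≤ k + 4) (he : Even k) :
    ‖shortRem hk z‖ ≤ tailConst * ((√(‖(z : ℂ)‖ ^ 2 + 1))⁻¹) ^ k := by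
  have him : 1 / 2 ≤ z.im := by
    have := norm_sq_coe z
    by_contra! hcon
    have := z.im_pos
    nlinarith
  have := norm_E_sub_le (z := z) (by rw [abs_le]; constructor <;> linarith) him shortVecs_subset
    (μ := √(‖(z : ℂ)‖ ^ 2 + 1)) (by positivity)
    (fun v hv hs => Real.sqrt_le_iff.2
      ⟨norm_nonneg _, le_norm_latVec_of_notMem h0 h1 h hv hs⟩) (k := k) hk
  refine le_trans (le_of_eq ?_) this
  rw [shortRem]
  congr 2
  rw [Finset.tsum_subtype' shortVecs fun v => ((latVec z v)⁻¹) ^ (k + 4)]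
  have he4 : Even (k + 4) := he.add (by decide)
  have n1 : (-1 + (z : ℂ)) = z - 1 := by ring
  have n2 : (-(z : ℂ) + 1) = -(z - 1) := by ring
  have n3 : ((z : ℂ) + -1) = z - 1 := by ring
  rw [shortVecs, Finset.sum_insert (by decide), Finset.sum_insert (by decide),
    Finset.sum_insert (by decide), Finset.sum_insert (by decide), Finset.sum_insert (by decide),
    Finset.sum_singleton]
  simp only [latVec, Matrix.cons_val_zero, Matrix.cons_val_one, Int.cast_zero, Int.cast_one,
    Int.cast_neg, zero_mul, one_mul, zero_add, add_zero, neg_mul, n2, n3, inv_neg, he4.neg_pow,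
    inv_one, one_pow]
  ring

end EisensteinZeros

/-! ### Signs on the arc -/

namespace EisensteinZeros

open Filter Topology EisensteinSeries ModularForm UpperHalfPlane

/-- At multiples of 2π/3 the cosine is at least -1/2, and 0.8661 lies just above √3/2, the slope
there. This linear loss is later set against the linear gain in `one_add_le_two_sin` or
`two_cos_le_one_sub`. -/
lemma neg_le_cos_add (p : ℕ) {x : ℝ} (hx : 0 ≤ x) :
    -(1 / 2 + 0.8661 * x) ≤ Real.cos (2 * Real.pi * p / 3 + x) := by
  have hsq : √3 ≤ 1.7322 := Real.sqrt_le_iff.2 ⟨by norm_num, by norm_num⟩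
  have hsq0 := Real.sqrt_nonneg 3
  have hs := Real.sin_le hx
  have hs' : -x ≤ Real.sin x := by
    have := Real.sin_le hx
    have h2 := Real.abs_sin_le_one x
    have := Real.abs_sin_lt_abs (x := x)
    rcases hx.eq_or_lt with h | h
    · simp [← h]
    · have := this h.ne'
      rw [abs_of_pos h] at this
      exact (abs_lt.1 this).1.le
  have hc := Real.cos_le_one x
  obtain ⟨q, r, hr, hp⟩ : ∃ q r : ℕ, r < 3 ∧ p = 3 * q + r :=
    ⟨p / 3, p % 3, Nat.mod_lt _ (by norm_num), (Nat.div_add_mod p 3).symm⟩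
  have hpe : 2 * Real.pi * p / 3 + x = 2 * Real.pi * r / 3 + x + q * (2 * Real.pi) := by
    rw [hp]; push_cast; ring
  rw [hpe, Real.cos_add_nat_mul_two_pi]
  interval_cases r
  · have h0 : 2 * Real.pi * (0 : ℕ) / 3 + x = x := by push_cast; ring
    rw [h0]
    rcases le_total x 1 with h | h
    · have := Real.one_sub_sq_div_two_le_cos (x := x)
      nlinarith
    · have := Real.neg_one_le_cos x
      nlinarith
  · have h0 : 2 * Real.pi * (1 : ℕ) / 3 + x = Real.pi - (Real.pi / 3 - x) := by push_cast; ring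
    rw [h0, Real.cos_pi_sub, Real.cos_sub, Real.cos_pi_div_three, Real.sin_pi_div_three]
    nlinarith
  · have h0 : 2 * Real.pi * (2 : ℕ) / 3 + x = Real.pi / 3 + x + Real.pi := by push_cast; ring
    rw [h0, Real.cos_add_pi, Real.cos_add, Real.cos_pi_div_three, Real.sin_pi_div_three]
    nlinarith

/-- The slope at h = 0 is √3; the value 1.55 is what remains of it up to h = π/12, the end of the
arc in the variable θ/2. -/
lemma one_add_le_two_sin {h : ℝ} (h0 : 0 ≤ h) (h1 : h ≤ Real.pi / 12) :
    1 + 1.55 * h ≤ 2 * Real.sin (Real.pi / 6 + h) := by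
  have hpi := Real.pi_lt_d2
  rw [Real.sin_add, Real.sin_pi_div_six, Real.cos_pi_div_six]
  have hsq : 1.732 ≤ √3 := Real.le_sqrt_of_sq_le (by norm_num)
  have hc := Real.one_sub_sq_div_two_le_cos (x := h)
  rcases h0.eq_or_lt with h | hpos
  · simp [← h]
  have hs := Real.sin_gt_sub_cube hpos
  have hle : h ≤ 0.2625 := by linarith
  have hs0 : 0 ≤ h - h ^ 3 / 6 := by nlinarith [mul_nonneg h0 h0, mul_nonneg h0 (mul_nonneg h0 h0)]
  have : 1.732 * (h - h ^ 3 / 6) ≤ √3 * Real.sin h := mul_le_mul hsq hs.le hs0 (by linarith)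
  nlinarith [mul_nonneg h0 h0, mul_nonneg h0 (mul_nonneg h0 h0)]

lemma two_cos_le_one_sub {h : ℝ} (h0 : 0 ≤ h) (h1 : h ≤ Real.pi / 6) :
    2 * Real.cos (Real.pi / 3 + h) ≤ 1 - 1.732 * h := by
  have hpi := Real.pi_lt_d2
  have hsq : 1.732 ≤ √3 := Real.le_sqrt_of_sq_le (by norm_num)
  rw [Real.cos_add, Real.cos_pi_div_three, Real.sin_pi_div_three]
  rcases h0.eq_or_lt with h | hpos
  · simp [← h]
  have hle : h ≤ 0.6 := by linarith
  have hs := Real.sin_gt_sub_cube hpos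
  have hs0 : 0 ≤ h - h ^ 3 / 6 := by nlinarith [mul_nonneg h0 h0, mul_nonneg h0 (mul_nonneg h0 h0)]
  have h2 : 1.732 * (h - h ^ 3 / 6) ≤ √3 * Real.sin h := mul_le_mul hsq hs.le hs0 (by linarith)
  have hc := (abs_le.1 (Real.cos_bound (x := h) (by rw [abs_of_pos hpos]; linarith))).2
  rw [abs_of_pos hpos] at hc
  nlinarith [mul_nonneg h0 h0, mul_nonneg h0 (mul_nonneg h0 h0),
    mul_nonneg (mul_nonneg h0 h0) (mul_nonneg h0 h0)]

lemma one_add_mul_le_pow_of_le {s a h : ℝ} (ha : 0 ≤ a * h) (hs : 1 + a * h ≤ s) (k : ℕ) :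
    1 + a * (k * h) ≤ s ^ k := by
  calc 1 + a * (k * h) = 1 + k * (a * h) := by ring
    _ ≤ (1 + a * h) ^ k := one_add_mul_le_pow (by linarith) k
    _ ≤ s ^ k := pow_le_pow_left₀ (by linarith) hs k

lemma norm_mul_sub_sub_le {a b c r s t : ℂ} {ε : ℝ} (ha : ‖a‖ ≤ 3) (hb : ‖b‖ ≤ 3) (hr : ‖r‖ ≤ ε)
    (hs : ‖s‖ ≤ ε) (ht : ‖t‖ ≤ ε) (hε : ε ≤ 1) :
    ‖((a + r) * (b + s) - (c + t)) - (a * b - c)‖ ≤ 8 * ε := by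
  have h : ((a + r) * (b + s) - (c + t)) - (a * b - c) = a * s + r * b + r * s - t := by ring
  rw [h]
  have h0 := norm_nonneg r
  calc ‖a * s + r * b + r * s - t‖ ≤ ‖a‖ * ‖s‖ + ‖r‖ * ‖b‖ + ‖r‖ * ‖s‖ + ‖t‖ := by
        simp only [← norm_mul]
        exact (norm_sub_le _ _).trans (add_le_add_left (norm_add₃_le) _)
    _ ≤ 3 * ε + ε * 3 + 1 * ε + ε := by
        have := hr.trans hε
        have := h0.trans hr
        gcongr
    _ = 8 * ε := by ring

/-- The real function approximating `e^{ikθ/2} E_k(e^{iθ})`. -/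
noncomputable def arcMain (k : ℕ) (θ : ℝ) : ℝ :=
  2 * Real.cos (k * (θ / 2)) + (-1) ^ (k / 2) * ((2 * Real.sin (θ / 2))⁻¹) ^ k

/-- The vectors ±1 and ±z combine to 2cos(kθ/2), while e^{iθ} - 1 = e^{iθ/2}·2i sin(θ/2) accounts
for the second summand and its sign (-1)^{k/2}. -/
lemma exp_mul_eq_arcMain {k : ℕ} (hk : Even k) (θ : ℝ) :
    Complex.exp (k * (θ / 2) * Complex.I) * (1 + ((Complex.exp (θ * Complex.I))⁻¹) ^ k +
      ((Complex.exp (θ * Complex.I) - 1)⁻¹) ^ k) = arcMain k θ := by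
  obtain ⟨p, hp⟩ := hk
  have hp2 : k / 2 = p := by omega
  set e := Complex.exp ((θ / 2 : ℝ) * Complex.I) with he
  have he0 : e ≠ 0 := Complex.exp_ne_zero _
  have hz : Complex.exp (θ * Complex.I) = e ^ 2 := by
    rw [he, ← Complex.exp_nat_mul]; congr 1; push_cast; ring
  have hk' : Complex.exp (k * (θ / 2) * Complex.I) = e ^ k := by
    rw [he, ← Complex.exp_nat_mul]; congr 1; push_cast; ring
  have hinv : e⁻¹ = Complex.exp (-((θ / 2 : ℝ) * Complex.I)) := by rw [he, Complex.exp_neg]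
  have hsin : e - e⁻¹ = Complex.I * (2 * Real.sin (θ / 2) : ℝ) := by
    rw [hinv, he, ← neg_mul, Complex.exp_mul_I, Complex.exp_mul_I, Complex.cos_neg, Complex.sin_neg]
    push_cast; ring
  have h1 : e ^ 2 - 1 = e * (Complex.I * (2 * Real.sin (θ / 2) : ℝ)) := by
    rw [← hsin]; field_simp
  have hcos : e ^ k + (e⁻¹) ^ k = 2 * Real.cos (k * (θ / 2)) := by
    rw [hinv, he, ← Complex.exp_nat_mul, ← Complex.exp_nat_mul]
    have e1 : (k : ℂ) * ((θ / 2 : ℝ) * Complex.I) = (k * (θ / 2) : ℝ) * Complex.I := by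
      push_cast; ring
    have e2 : (k : ℂ) * -((θ / 2 : ℝ) * Complex.I) = -(k * (θ / 2) : ℝ) * Complex.I := by
      push_cast; ring
    rw [e1, e2, Complex.exp_mul_I, Complex.exp_mul_I, Complex.cos_neg, Complex.sin_neg,
      Complex.ofReal_cos]
    ring
  have hI : (Complex.I⁻¹) ^ k = (-1) ^ p := by
    rw [hp, ← two_mul, pow_mul, inv_pow, Complex.I_sq]; norm_num
  rw [hz, hk', h1, arcMain, hp2]
  have : e ^ k * (1 + ((e ^ 2)⁻¹) ^ k + ((e * (Complex.I * (2 * Real.sin (θ / 2) : ℝ)))⁻¹) ^ k) =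
      (e ^ k + (e⁻¹) ^ k) + (Complex.I⁻¹) ^ k * (((2 * Real.sin (θ / 2) : ℝ) : ℂ)⁻¹) ^ k := by
    have h2 : e ^ k * ((e ^ 2)⁻¹) ^ k = (e⁻¹) ^ k := by
      rw [← mul_pow]; congr 1; field_simp
    have h3 : e ^ k * ((e * (Complex.I * (2 * Real.sin (θ / 2) : ℝ)))⁻¹) ^ k =
        (Complex.I⁻¹) ^ k * (((2 * Real.sin (θ / 2) : ℝ) : ℂ)⁻¹) ^ k := by
      rw [← mul_pow, ← mul_pow, mul_inv, mul_inv, mul_inv_cancel_left₀ he0]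
    rw [mul_add, mul_add, h2, h3, mul_one]
  rw [this, hcos, hI]
  push_cast
  ring

lemma abs_arcMain_le {k : ℕ} {θ : ℝ} (hs : 1 ≤ 2 * Real.sin (θ / 2)) : |arcMain k θ| ≤ 3 := by
  have h1 : ((2 * Real.sin (θ / 2))⁻¹) ^ k ≤ 1 :=
    pow_le_one₀ (by positivity) (inv_le_one_of_one_le₀ hs)
  have h2 := Real.abs_cos_le_one (k * (θ / 2))
  rw [arcMain]
  refine (abs_add_le _ _).trans ?_
  rw [abs_mul, abs_mul, abs_pow, abs_neg, abs_one, one_pow, one_mul, abs_two,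
    abs_of_nonneg (by positivity : 0 ≤ ((2 * Real.sin (θ / 2))⁻¹) ^ k)]
  linarith

lemma abs_arcVal_sub_le {k l : ℕ} (hk : 4 ≤ k) (hl : 4 ≤ l) (hke : Even k) (hle : Even l)
    {θ ε : ℝ} (h1 : Real.pi / 3 ≤ θ) (h2 : θ ≤ Real.pi / 2) (hlk : l ≤ k) (hε1 : ε ≤ 1)
    (hε : tailConst * ((√2)⁻¹) ^ (l - 4) ≤ ε) :
    |arcVal (Delta hk hl) (k + l) θ - (arcMain k θ * arcMain l θ - arcMain (k + l) θ)| ≤ 8 * ε := by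
  have hpi := Real.pi_pos
  have hsin : 0 < Real.sin θ := Real.sin_pos_of_pos_of_lt_pi (by linarith) (by linarith)
  have hs2 : 1 ≤ 2 * Real.sin (θ / 2) := by
    have := one_add_le_two_sin (h := θ / 2 - Real.pi / 6) (by linarith) (by linarith)
    rw [add_sub_cancel] at this
    linarith
  have hz := coe_arcPt hsin
  have hnz : ‖(arcPt θ : ℂ)‖ = 1 := by rw [hz, Complex.norm_exp_ofReal_mul_I]
  have hre : (arcPt θ).re = Real.cos θ := by rw [← coe_re, hz, Complex.exp_ofReal_mul_I_re]
  have hre0 : 0 ≤ (arcPt θ).re := by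
    rw [hre]; exact Real.cos_nonneg_of_neg_pi_div_two_le_of_le (by linarith) h2
  have hre1 : (arcPt θ).re ≤ 1 / 2 := by
    rw [hre, ← Real.cos_pi_div_three]
    exact Real.cos_le_cos_of_nonneg_of_le_pi (by linarith) (by linarith) h1
  have hq : ((√2)⁻¹) ≤ 1 := inv_le_one_of_one_le₀ (Real.one_le_sqrt.2 (by norm_num))
  have hrem : ∀ {n : ℕ} (hn : 3 ≤ n) (_ : Even n), l ≤ n → ‖shortRem hn (arcPt θ)‖ ≤ ε := by
    intro n hn hne hln
    obtain ⟨n', rfl⟩ : ∃ n', n = n' + 4 := ⟨n - 4, by omega⟩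
    have hne' : Even n' := by
      have := hne.tsub (show Even 4 by decide); simpa using this
    have := norm_shortRem_le hre0 hre1 hnz.ge hn hne'
    rw [hnz] at this
    norm_num at this
    refine this.trans (le_trans ?_ hε)
    rw [← inv_pow]
    exact mul_le_mul_of_nonneg_left (pow_le_pow_of_le_one (by positivity) hq (by omega))
      tailConst_pos.le
  have hE : ∀ {n : ℕ} (hn : 3 ≤ n) (_ : Even n), Complex.exp (n * (θ / 2) * Complex.I) *
      E hn (arcPt θ) = arcMain n θ +
        Complex.exp (n * (θ / 2) * Complex.I) * shortRem hn (arcPt θ) := by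
    intro n hn hne
    rw [← exp_mul_eq_arcMain hne, shortRem, ← hz]
    ring
  have hn1 : ∀ {n : ℕ} (w : ℂ), ‖Complex.exp (n * (θ / 2) * Complex.I) * w‖ = ‖w‖ := by
    intro n w
    have : ((n : ℂ) * (θ / 2) * Complex.I) = ((n * (θ / 2) : ℝ) : ℂ) * Complex.I := by push_cast; rfl
    rw [norm_mul, this, Complex.norm_exp_ofReal_mul_I, one_mul]
  rw [← Real.norm_eq_abs, ← Complex.norm_real, Complex.ofReal_sub, ofReal_arcVal hk hl hsin, Delta,
    mul_sub, hE (show 3 ≤ k + l by omega) (hke.add hle)]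
  have hexp : Complex.exp ((k + l : ℕ) * (θ / 2) * Complex.I) =
      Complex.exp (k * (θ / 2) * Complex.I) * Complex.exp (l * (θ / 2) * Complex.I) := by
    rw [← Complex.exp_add]; congr 1; push_cast; ring
  have := norm_mul_sub_sub_le (a := arcMain k θ) (b := arcMain l θ) (c := arcMain (k + l) θ)
    (r := Complex.exp (k * (θ / 2) * Complex.I) * shortRem (show 3 ≤ k by omega) (arcPt θ))
    (s := Complex.exp (l * (θ / 2) * Complex.I) * shortRem (show 3 ≤ l by omega) (arcPt θ))
    (t := Complex.exp ((k + l : ℕ) * (θ / 2) * Complex.I) *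
      shortRem (show 3 ≤ k + l by omega) (arcPt θ)) (ε := ε)
    (by rw [Complex.norm_real]; exact abs_arcMain_le hs2)
    (by rw [Complex.norm_real]; exact abs_arcMain_le hs2)
    (by rw [hn1]; exact hrem _ hke hlk) (by rw [hn1]; exact hrem _ hle le_rfl)
    (by rw [hn1]; exact hrem _ (hke.add hle) (by omega)) hε1
  rw [← hE _ hke, ← hE _ hle] at this
  refine le_trans (le_of_eq ?_) this
  congr 1
  rw [hexp]
  push_cast
  ring

/-- With b = ℓθ/2 the cosines alone give 2(-1)^m. What is left is 2Λ(-1)^{ℓ/2}cos b and a term of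
size at most 2K, where Λ and K are the ℓ-th and k-th powers of 1/(2 sin(θ/2)). Near ρ both powers
may be close to 1, so Λ has to be weighed against the phase of cos b. -/
lemma arc_main_pos {k l m : ℕ} (hke : Even k) (hle : Even l) {θ : ℝ} (hlk : l < k)
    (hm1 : k - l + 2 ≤ 6 * m) (hm2 : 4 * m ≤ k - l) (hθ : θ = 2 * Real.pi * m / (k - l : ℕ)) :
    0.1 ≤ (-1) ^ m * (arcMain k θ * arcMain l θ - arcMain (k + l) θ) := by
  have hpi := Real.pi_gt_d2
  obtain ⟨p, rfl⟩ := hle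
  obtain ⟨q, rfl⟩ := hke
  have e1 : (p + p) / 2 = p := by omega
  have e2 : (q + q) / 2 = q := by omega
  have e3 : (q + q + (p + p)) / 2 = q + p := by omega
  simp only [arcMain, e1, e2, e3]
  set h : ℝ := θ / 2 - Real.pi / 6 with hh
  set D := q + q - (p + p) with hD
  have hDpos : (0 : ℝ) < D := by have : 0 < D := by omega
                                 exact_mod_cast this
  have hDcast : (D : ℝ) = (q + q : ℕ) - (p + p : ℕ) := by rw [hD, Nat.cast_sub hlk.le]
  have hDθ : D * (θ / 2) = Real.pi * m := by rw [hθ]; field_simp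
  have hm1' : (D : ℝ) + 2 ≤ 6 * m := by exact_mod_cast hm1
  have hm2' : (4 : ℝ) * m ≤ D := by exact_mod_cast hm2
  -- As k - ℓ is even, 6m > k - ℓ means 6m ≥ k - ℓ + 2. This keeps the sample far enough from ρ for
  -- K ≤ 0.382.
  have hDh : Real.pi / 3 ≤ D * h := by
    rw [hh, mul_sub, hDθ]; nlinarith
  have hh0 : 0 ≤ h := by
    by_contra! hcon
    nlinarith
  have hh1 : h ≤ Real.pi / 12 := by
    have : D * h ≤ D * (Real.pi / 12) := by
      rw [hh, mul_sub, hDθ]; nlinarith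
    exact le_of_mul_le_mul_left this hDpos
  have hs := one_add_le_two_sin hh0 hh1
  rw [hh, add_sub_cancel] at hs
  set s := 2 * Real.sin (θ / 2) with hsdef
  set x := ((p + p : ℕ) : ℝ) * h with hx
  have hx0 : 0 ≤ x := by positivity
  have hsl := one_add_mul_le_pow_of_le (by positivity) hs (p + p)
  have hsk := one_add_mul_le_pow_of_le (by positivity) hs (q + q)
  rw [← hh, ← hx] at hsl
  rw [← hh] at hsk
  have hs0 : 0 < s := by nlinarith
  set b := ((p + p : ℕ) : ℝ) * (θ / 2) with hb
  have ha : ((q + q : ℕ) : ℝ) * (θ / 2) = b + m * Real.pi := by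
    rw [hb, mul_comm (m : ℝ), ← hDθ, hDcast]; ring
  have hab : ((q + q + (p + p) : ℕ) : ℝ) * (θ / 2) = b + m * Real.pi + b := by
    rw [← ha, hb]; push_cast; ring
  have hcos := neg_le_cos_add (2 * p) hx0
  have hcos' : 2 * Real.pi * (2 * p : ℕ) / 3 + x = b + p * Real.pi := by
    rw [hx, hh, hb]; push_cast; ring
  rw [hcos', Real.cos_add_nat_mul_pi] at hcos
  rw [ha, hab, Real.cos_add (b + m * Real.pi), Real.cos_add_nat_mul_pi, Real.sin_add_nat_mul_pi]
  set Λ := (s⁻¹) ^ (p + p) with hΛ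
  set K := (s⁻¹) ^ (q + q) with hK
  have hΛ0 : 0 < Λ := by positivity
  have hK0 : 0 < K := by positivity
  have hΛ1 : Λ * (1 + 1.55 * x) ≤ 1 := by
    rw [hΛ, inv_pow, inv_mul_le_iff₀ (by positivity), mul_one]; exact hsl
  have hqD : (D : ℝ) * h ≤ ((q + q : ℕ) : ℝ) * h := by
    apply mul_le_mul_of_nonneg_right _ hh0
    rw [hDcast]; have : (0 : ℝ) ≤ ((p + p : ℕ) : ℝ) := by positivity
    linarith
  have hK1 : K ≤ 0.382 := by
    have : K * (1 + 1.55 * (((q + q : ℕ) : ℝ) * h)) ≤ 1 := by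
      rw [hK, inv_pow, inv_mul_le_iff₀ (by positivity), mul_one]; exact hsk
    nlinarith
  -- The bound is (1/2 + 0.8661x)/(1 + 1.55x) ≤ 0.8661/1.55 < 0.559. Then 2 - 2·0.559 - 2·0.382 >
  -- 0.1.
  have hΛc : -0.559 ≤ Λ * ((-1) ^ p * Real.cos b) := by
    nlinarith
  have hKc : -0.382 ≤ (-1) ^ m * (-1) ^ q * K * Real.cos b := by
    have : |(-1) ^ m * (-1) ^ q * K * Real.cos b| ≤ K := by
      rw [abs_mul, abs_mul, abs_mul, abs_pow, abs_pow, abs_neg, abs_one, one_pow, one_pow, one_mul,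
        one_mul, abs_of_pos hK0]
      exact mul_le_of_le_one_right hK0.le (Real.abs_cos_le_one _)
    linarith [neg_abs_le ((-1) ^ m * (-1) ^ q * K * Real.cos b)]
  have hm : ((-1 : ℝ) ^ m) * (-1) ^ m = 1 := by rw [← mul_pow]; simp
  have hsc := Real.sin_sq_add_cos_sq b
  rw [pow_add s⁻¹ (q + q), ← hΛ, ← hK, pow_add (-1 : ℝ) q p]
  have : (-1) ^ m * ((2 * ((-1) ^ m * Real.cos b) + (-1) ^ q * K) *
      (2 * Real.cos b + (-1) ^ p * Λ) - (2 * ((-1) ^ m * Real.cos b * Real.cos b -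
      (-1) ^ m * Real.sin b * Real.sin b) + (-1) ^ q * (-1) ^ p * (K * Λ))) =
      ((-1) ^ m * (-1) ^ m) * (2 * (Real.sin b ^ 2 + Real.cos b ^ 2) +
        2 * (Λ * ((-1) ^ p * Real.cos b))) + 2 * ((-1) ^ m * (-1) ^ q * K * Real.cos b) := by ring
  rw [this, hm, hsc]
  linarith

/-- Signs of `e^{iwθ/2} Δ_{k,ℓ}(e^{iθ})` at the points where `cos ((k - ℓ) θ / 2) = ±1`. -/
lemma exists_arcVal_pos : ∃ L : ℕ, ∀ (k l m : ℕ) (hk : 4 ≤ k) (hl : 4 ≤ l), Even k → Even l →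
    L ≤ l → l < k → k - l + 2 ≤ 6 * m → 4 * m ≤ k - l →
    0 < (-1) ^ m * arcVal (Delta hk hl) (k + l) (2 * Real.pi * m / (k - l : ℕ)) := by
  have hlim : Tendsto (fun l : ℕ => tailConst * ((√2)⁻¹) ^ (l - 4)) atTop (𝓝 0) := by
    rw [← mul_zero tailConst]
    refine Tendsto.const_mul _ ((tendsto_pow_atTop_nhds_zero_of_lt_one (by positivity)
      (inv_lt_one_of_one_lt₀ ?_)).comp (tendsto_sub_atTop_nat 4))
    exact Real.lt_sqrt_of_sq_lt (by norm_num)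
  obtain ⟨L, hL⟩ := eventually_atTop.1 (hlim.eventually_le_const (u := 0.01) (by norm_num))
  refine ⟨L, fun k l m hk hl hke hle hLl hlk hm1 hm2 => ?_⟩
  set θ := 2 * Real.pi * m / (k - l : ℕ) with hθ
  have hmain := arc_main_pos hke hle hlk hm1 hm2 hθ
  have hpi := Real.pi_pos
  have hD : (0 : ℝ) < (k - l : ℕ) := by exact_mod_cast (by omega : 0 < k - l)
  have hm1' : ((k - l : ℕ) : ℝ) + 2 ≤ 6 * m := by exact_mod_cast hm1
  have hm2' : (4 : ℝ) * m ≤ (k - l : ℕ) := by exact_mod_cast hm2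
  have := abs_arcVal_sub_le hk hl hke hle (θ := θ) (ε := 0.01)
    (by rw [hθ, le_div_iff₀ hD]; nlinarith) (by rw [hθ, div_le_iff₀ hD]; nlinarith) hlk.le
    (by norm_num) (hL l hLl)
  have h2 : |(-1 : ℝ) ^ m * (arcVal (Delta hk hl) (k + l) θ -
      (arcMain k θ * arcMain l θ - arcMain (k + l) θ))| ≤ 8 * 0.01 := by
    rw [abs_mul, abs_pow, abs_neg, abs_one, one_pow, one_mul]; exact this
  rw [mul_sub] at h2
  linarith [(abs_le.1 h2).1]

end EisensteinZeros

/-! ### Signs on the half-line at moderate height -/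

namespace EisensteinZeros

open Filter Topology EisensteinSeries ModularForm UpperHalfPlane

lemma half_tan_pos {φ : ℝ} (h0 : 0 < φ) (h1 : φ < Real.pi / 2) : 0 < Real.tan φ / 2 :=
  half_pos (Real.tan_pos_of_pos_of_lt_pi_div_two h0 h1)

lemma coe_sidePt_tan {φ : ℝ} (h0 : 0 < φ) (h1 : φ < Real.pi / 2) :
    (sidePt (Real.tan φ / 2) : ℂ) =
      ((2 * Real.cos φ : ℝ) : ℂ)⁻¹ * Complex.exp (φ * Complex.I) := by
  have hc : Real.cos φ ≠ 0 := (Real.cos_pos_of_mem_Ioo ⟨by linarith, h1⟩).ne'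
  have hc' : Complex.cos φ ≠ 0 := by rw [← Complex.ofReal_cos]; exact_mod_cast hc
  rw [coe_sidePt (half_tan_pos h0 h1), Real.tan_eq_sin_div_cos, Complex.exp_mul_I,
    ← Complex.ofReal_cos, ← Complex.ofReal_sin]
  push_cast
  field_simp

lemma norm_sidePt_tan {φ : ℝ} (h0 : 0 < φ) (h1 : φ < Real.pi / 2) :
    ‖(sidePt (Real.tan φ / 2) : ℂ)‖ = (2 * Real.cos φ)⁻¹ := by
  have hc : 0 < Real.cos φ := Real.cos_pos_of_mem_Ioo ⟨by linarith, h1⟩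
  rw [coe_sidePt_tan h0 h1, norm_mul, Complex.norm_exp_ofReal_mul_I, mul_one, norm_inv,
    Complex.norm_real, Real.norm_of_nonneg (by positivity)]

/-- On the line z - 1 = -z̄, so for even k the two inverse powers are conjugate and add up to twice
a real part. -/
lemma inv_pow_add_inv_pow_sidePt {φ : ℝ} (h0 : 0 < φ) (h1 : φ < Real.pi / 2) {k : ℕ}
    (hk : Even k) :
    ((sidePt (Real.tan φ / 2) : ℂ)⁻¹) ^ k + (((sidePt (Real.tan φ / 2) : ℂ) - 1)⁻¹) ^ k =
      ((2 * (2 * Real.cos φ) ^ k * Real.cos (k * φ) : ℝ) : ℂ) := by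
  have hz := coe_sidePt_tan h0 h1
  have hz1 : (sidePt (Real.tan φ / 2) : ℂ) - 1 =
      -(((2 * Real.cos φ : ℝ) : ℂ)⁻¹ * Complex.exp (-(φ * Complex.I))) := by
    have : (sidePt (Real.tan φ / 2) : ℂ) - 1 = -(starRingEnd ℂ) (sidePt (Real.tan φ / 2)) := by
      rw [coe_sidePt (half_tan_pos h0 h1)]
      simp only [map_add, map_mul, Complex.conj_I, Complex.conj_ofReal, map_div₀, map_one,
        map_ofNat]
      ring
    rw [this, hz, map_mul, ← Complex.exp_conj, map_mul, map_inv₀, Complex.conj_ofReal,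
      Complex.conj_ofReal, Complex.conj_I, mul_neg]
  rw [hz1, hz, inv_neg, hk.neg_pow, mul_inv, mul_inv, inv_inv, ← Complex.exp_neg,
    ← Complex.exp_neg, neg_neg, mul_pow, mul_pow, ← mul_add, ← Complex.exp_nat_mul,
    ← Complex.exp_nat_mul]
  have e1 : (k : ℂ) * (φ * Complex.I) = (k * φ : ℝ) * Complex.I := by push_cast; ring
  have e2 : (k : ℂ) * -(φ * Complex.I) = -(k * φ : ℝ) * Complex.I := by push_cast; ring
  rw [e1, e2, Complex.exp_mul_I, Complex.exp_mul_I, Complex.cos_neg, Complex.sin_neg,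
    Complex.ofReal_mul (2 * (2 * Real.cos φ) ^ k), Complex.ofReal_cos (k * φ)]
  push_cast
  ring

/-- Here P = q^ℓ, Q = q^{k-ℓ}, c = cos((k - ℓ)φ) and s = (-1)^m. The expression collapses to 2P(1 +
Qc + sPQc). Negative c costs at most 0.501 through Q and 0.357·0.501 through PQ, leaving more than
0.3. -/
lemma near_main_aux {P Q c x s : ℝ} (hP0 : 0 ≤ P) (hP1 : P ≤ 0.357) (hQ0 : 0 ≤ Q) (hx : 0 ≤ x)
    (hQ : Q * (1 + 1.732 * x) ≤ 1) (hc : -(1 / 2 + 0.8661 * x) ≤ c) (hs : s * s = 1) :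
    0.6 * P ≤ s * ((1 + 2 * (P * Q) * (s * c)) * (1 + 2 * P * s) - (1 + 2 * (P * Q * P) * c)) := by
  have key : s * ((1 + 2 * (P * Q) * (s * c)) * (1 + 2 * P * s) - (1 + 2 * (P * Q * P) * c)) =
      2 * P * ((s * s) * (1 + Q * c)) + 2 * P * (2 * (s * s) * (s * (P * Q * c)) -
        s * (P * Q * c)) := by
    ring
  rw [key, hs]
  have hs1 : |s| = 1 := by
    rcases mul_self_eq_one_iff.1 hs with h | h <;> simp [h]
  have habs : -|P * Q * c| ≤ s * (P * Q * c) := by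
    have : |s * (P * Q * c)| = |P * Q * c| := by rw [abs_mul, hs1, one_mul]
    rw [← this]; exact neg_abs_le _
  rw [abs_mul, abs_mul, abs_of_nonneg hP0, abs_of_nonneg hQ0] at habs
  have hfin : 0.3 ≤ 1 + Q * c + s * (P * Q * c) := by
    rcases le_total 0 c with h0 | h0
    · rw [abs_of_nonneg h0] at habs
      have : P * (Q * c) ≤ 1 * (Q * c) :=
        mul_le_mul_of_nonneg_right (by linarith) (mul_nonneg hQ0 h0)
      linarith
    · rw [abs_of_nonpos h0] at habs
      have h1 : Q * (-c) ≤ 0.501 := by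
        have : Q * (-c) ≤ Q * (1 / 2 + 0.8661 * x) :=
          mul_le_mul_of_nonneg_left (by linarith) hQ0
        have h3 := mul_nonneg hQ0 hx
        linarith
      have h2 : P * (Q * (-c)) ≤ 0.357 * (Q * (-c)) :=
        mul_le_mul_of_nonneg_right hP1 (mul_nonneg hQ0 (by linarith))
      linarith
  have := mul_le_mul_of_nonneg_left hfin hP0
  linarith

lemma near_main_pos {k l m : ℕ} (hke : Even k) (hle : Even l) {φ : ℝ} (hlk : l ≤ k)
    (hm1 : l + 1 ≤ 3 * m) (hm2 : 2 * m ≤ l) (hφ : φ = Real.pi * m / l) :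
    0.6 * (2 * Real.cos φ) ^ l ≤ (-1) ^ m * ((1 + 2 * (2 * Real.cos φ) ^ k * Real.cos (k * φ)) *
      (1 + 2 * (2 * Real.cos φ) ^ l * Real.cos (l * φ)) -
      (1 + 2 * (2 * Real.cos φ) ^ (k + l) * Real.cos ((k + l : ℕ) * φ))) := by
  have hpi := Real.pi_gt_d2
  obtain ⟨d, hd⟩ : ∃ d, k = l + (d + d) := by
    obtain ⟨p, rfl⟩ := hle
    obtain ⟨q, rfl⟩ := hke
    exact ⟨q - p, by omega⟩
  subst hd
  set h : ℝ := φ - Real.pi / 3 with hh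
  have hl0 : (0 : ℝ) < l := by exact_mod_cast (by omega : 0 < l)
  have hlφ : l * φ = m * Real.pi := by rw [hφ]; field_simp
  have hm1' : (l : ℝ) + 1 ≤ 3 * m := by exact_mod_cast hm1
  have hm2' : 2 * (m : ℝ) ≤ l := by exact_mod_cast hm2
  have hlh : Real.pi / 3 ≤ l * h := by rw [hh, mul_sub, hlφ]; nlinarith
  have hh0 : 0 ≤ h := by
    by_contra! hcon
    nlinarith
  have hh1 : h ≤ Real.pi / 6 := by
    have : l * h ≤ l * (Real.pi / 6) := by rw [hh, mul_sub, hlφ]; nlinarith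
    exact le_of_mul_le_mul_left this hl0
  have hq := two_cos_le_one_sub hh0 hh1
  rw [hh, add_sub_cancel, ← hh] at hq
  have hq0 : 0 ≤ 2 * Real.cos φ := by
    have : 0 ≤ Real.cos φ := Real.cos_nonneg_of_neg_pi_div_two_le_of_le (by linarith) (by linarith)
    linarith
  set q := 2 * Real.cos φ with hqdef
  have hqs : ∀ n : ℕ, q ^ n * (1 + 1.732 * (n * h)) ≤ 1 := by
    intro n
    have h1 : q * (1 + 1.732 * h) ≤ 1 := by nlinarith
    have h2 : 1 + 1.732 * (n * h) ≤ (1 + 1.732 * h) ^ n :=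
      one_add_mul_le_pow_of_le (by positivity) le_rfl n
    calc q ^ n * (1 + 1.732 * (n * h)) ≤ q ^ n * (1 + 1.732 * h) ^ n := by gcongr
      _ = (q * (1 + 1.732 * h)) ^ n := (mul_pow _ _ _).symm
      _ ≤ 1 := pow_le_one₀ (by positivity) h1
  have hcos := neg_le_cos_add d (x := (d + d : ℕ) * h) (by positivity)
  have hD : 2 * Real.pi * d / 3 + (d + d : ℕ) * h = (d + d : ℕ) * φ := by
    rw [hh]; push_cast; ring
  rw [hD] at hcos
  set c := Real.cos ((d + d : ℕ) * φ) with hc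
  have e1 : ((l + (d + d) : ℕ) : ℝ) * φ = (d + d : ℕ) * φ + m * Real.pi := by
    rw [← hlφ]; push_cast; ring
  have e2 : ((l + (d + d) + l : ℕ) : ℝ) * φ = (d + d : ℕ) * φ + m * (2 * Real.pi) := by
    have : (m : ℝ) * (2 * Real.pi) = 2 * (m * Real.pi) := by ring
    rw [this, ← hlφ]; push_cast; ring
  rw [e1, e2, hlφ, Real.cos_add_nat_mul_pi, Real.cos_add_nat_mul_two_pi, Real.cos_nat_mul_pi,
    ← hc]
  have hm : ((-1 : ℝ) ^ m) * (-1) ^ m = 1 := by rw [← mul_pow]; simp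
  set Q := q ^ (d + d) with hQ
  set P := q ^ l with hP
  have hP0 : 0 ≤ P := pow_nonneg hq0 _
  have hQ0 : 0 ≤ Q := pow_nonneg hq0 _
  -- The condition ℓ + 1 ≤ 3m gives ℓh ≥ π/3, and 1/(1 + 1.732·π/3) < 0.357.
  have hP1 : P ≤ 0.357 := by
    have := hqs l
    rw [← hP] at this
    nlinarith
  have hQc := hqs (d + d)
  rw [← hQ] at hQc
  rw [pow_add q (l + (d + d)), pow_add q l, ← hP, ← hQ]
  exact near_main_aux hP0 hP1 hQ0 (by positivity) hQc hcos hm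

/-- Signs of `Δ_{k,ℓ}` on the line `x = 1/2` at the points of argument `πm/ℓ` which are not
too high. -/
lemma exists_sideVal_pos_of_le : ∃ L : ℕ, ∀ (k l m : ℕ) (hk : 4 ≤ k) (hl : 4 ≤ l), Even k →
    Even l → L ≤ l → l ≤ k → l + 1 ≤ 3 * m → 2 * m < l → 1 / 2 ≤ 2 * Real.cos (Real.pi * m / l) →
    0 < (-1) ^ m * sideVal (Delta hk hl) (Real.tan (Real.pi * m / l) / 2) := by
  have hlim : Tendsto (fun l : ℕ => 16 * tailConst * ((√1.25)⁻¹) ^ (l - 4)) atTop (𝓝 0) := by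
    rw [← mul_zero (16 * tailConst)]
    refine Tendsto.const_mul _ ((tendsto_pow_atTop_nhds_zero_of_lt_one (by positivity)
      (inv_lt_one_of_one_lt₀ ?_)).comp (tendsto_sub_atTop_nat 4))
    exact Real.lt_sqrt_of_sq_lt (by norm_num)
  obtain ⟨L, hL⟩ := eventually_atTop.1 (hlim.eventually_le_const (u := 0.01) (by norm_num))
  refine ⟨L, fun k l m hk hl hke hle hLl hlk hm1 hm2 hq2 => ?_⟩
  have hε := hL l hLl
  set φ := Real.pi * m / l with hφ
  have hmain := near_main_pos hke hle hlk hm1 hm2.le hφ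
  have hpi := Real.pi_pos
  have hl0 : (0 : ℝ) < l := by exact_mod_cast (by omega : 0 < l)
  have hm1' : (l : ℝ) + 1 ≤ 3 * m := by exact_mod_cast hm1
  have hm2' : 2 * (m : ℝ) < l := by exact_mod_cast hm2
  have hφ1 : Real.pi / 3 ≤ φ := by rw [hφ, le_div_iff₀ hl0]; nlinarith
  have hφ2 : φ < Real.pi / 2 := by rw [hφ, div_lt_iff₀ hl0]; nlinarith
  have hφ0 : 0 < φ := by linarith
  have hq1 : 2 * Real.cos φ ≤ 1 := by
    have := Real.cos_le_cos_of_nonneg_of_le_pi (by linarith) (by linarith) hφ1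
    rw [Real.cos_pi_div_three] at this
    linarith
  have hn := norm_sidePt_tan hφ0 hφ2
  have hx := fun {n : ℕ} (hn : Even n) => inv_pow_add_inv_pow_sidePt hφ0 hφ2 hn
  have hy := half_tan_pos hφ0 hφ2
  set y := Real.tan φ / 2 with hydef
  set q := 2 * Real.cos φ with hq
  have hq0 : 0 < q := by linarith
  have hrem : ∀ {n : ℕ} (hn : 3 ≤ n) (_ : Even n), l ≤ n →
      ‖shortRem hn (sidePt y)‖ ≤ 0.01 * q ^ l := by
    intro n hn' hne hln
    obtain ⟨n', rfl⟩ : ∃ n', n = n' + 4 := ⟨n - 4, by omega⟩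
    have hne' : Even n' := by
      have := hne.tsub (show Even 4 by decide); simpa using this
    have := norm_shortRem_le (z := sidePt y) (by rw [sidePt_re hy]; norm_num)
      (by rw [sidePt_re hy]) (by rw [hn]; exact one_le_inv_iff₀.2 ⟨hq0, hq1⟩) hn' hne'
    rw [hn] at this
    -- Since q ≥ 1/2 means |z| ≤ 2, the next shortest vectors exceed |z| by the fixed factor √1.25.
    -- The error is then exponentially small relative to q^ℓ, even though q^ℓ itself decays.
    have hsq : (√(q⁻¹ ^ 2 + 1))⁻¹ ≤ q * (√1.25)⁻¹ := by
      rw [inv_le_comm₀ (by positivity) (by positivity), mul_inv, inv_inv]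
      apply Real.le_sqrt_of_sq_le
      rw [mul_pow, Real.sq_sqrt (by norm_num)]
      have : 1 ≤ q⁻¹ ^ 2 * 0.25 * 4 := by
        have := one_le_pow₀ (one_le_inv_iff₀.2 ⟨hq0, hq1⟩) (n := 2)
        linarith
      have h4 : q⁻¹ ^ 2 ≤ 4 := by
        have : q⁻¹ ≤ 2 := by rw [inv_le_comm₀ hq0 (by norm_num)]; linarith
        have := pow_le_pow_left₀ (by positivity) this 2
        linarith
      linarith
    have hs1 : (√1.25)⁻¹ ≤ 1 := inv_le_one_of_one_le₀ (Real.one_le_sqrt.2 (by norm_num))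
    calc _ ≤ _ := this
      _ ≤ tailConst * (q * (√1.25)⁻¹) ^ n' :=
        mul_le_mul_of_nonneg_left (pow_le_pow_left₀ (by positivity) hsq _) tailConst_pos.le
      _ ≤ tailConst * (16 * q ^ l * ((√1.25)⁻¹) ^ (l - 4)) := by
        rw [mul_pow]
        refine mul_le_mul_of_nonneg_left (mul_le_mul ?_ ?_ (by positivity) (by positivity))
          tailConst_pos.le
        -- The tail bound loses four powers of q, and q ≥ 1/2 pays for them with the factor 16.
        · have h16 : 1 ≤ 16 * q ^ 4 := by
            have := pow_le_pow_left₀ (by norm_num) hq2 4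
            norm_num at this ⊢; linarith
          calc q ^ n' ≤ q ^ n' * (16 * q ^ 4) := le_mul_of_one_le_right (by positivity) h16
            _ = 16 * q ^ (n' + 4) := by ring
            _ ≤ 16 * q ^ l := by
              have := pow_le_pow_of_le_one hq0.le hq1 hln
              linarith
        · exact pow_le_pow_of_le_one (by positivity) hs1 (by omega)
      _ = (16 * tailConst * ((√1.25)⁻¹) ^ (l - 4)) * q ^ l := by ring
      _ ≤ _ := by gcongr
  have hE : ∀ {n : ℕ} (hn : 3 ≤ n) (_ : Even n), E hn (sidePt y) =
      ((1 + 2 * q ^ n * Real.cos (n * φ) : ℝ) : ℂ) + shortRem hn (sidePt y) := by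
    intro n hn hne
    rw [shortRem, add_assoc 1, hx hne]
    push_cast
    ring
  have hM : ∀ n : ℕ, ‖((1 + 2 * q ^ n * Real.cos (n * φ) : ℝ) : ℂ)‖ ≤ 3 := by
    intro n
    rw [Complex.norm_real, Real.norm_eq_abs]
    refine (abs_add_le _ _).trans ?_
    rw [abs_one, abs_mul, abs_mul, abs_two, abs_of_nonneg (by positivity : 0 ≤ q ^ n)]
    have h1 : q ^ n ≤ 1 := pow_le_one₀ hq0.le hq1
    have h2 := Real.abs_cos_le_one (n * φ)
    nlinarith [mul_le_mul h1 h2 (abs_nonneg _) zero_le_one]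
  have := norm_mul_sub_sub_le (ε := 0.01 * q ^ l) (hM k) (hM l)
    (c := ((1 + 2 * q ^ (k + l) * Real.cos ((k + l : ℕ) * φ) : ℝ) : ℂ))
    (hrem (show 3 ≤ k by omega) hke hlk)
    (hrem (show 3 ≤ l by omega) hle le_rfl) (hrem (show 3 ≤ k + l by omega) (hke.add hle)
      (by omega)) (by have : q ^ l ≤ 1 := pow_le_one₀ hq0.le hq1
                      linarith)
  rw [← hE _ hke, ← hE _ hle, ← hE _ (hke.add hle)] at this
  change ‖Delta hk hl (sidePt y) - _‖ ≤ _ at this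
  rw [← ofReal_sideVal hk hl hy,
    ← Complex.ofReal_mul, ← Complex.ofReal_sub, ← Complex.ofReal_sub, Complex.norm_real,
    Real.norm_eq_abs] at this
  have h2 : |(-1 : ℝ) ^ m * (sideVal (Delta hk hl) y -
      ((1 + 2 * q ^ k * Real.cos (k * φ)) * (1 + 2 * q ^ l * Real.cos (l * φ)) -
      (1 + 2 * q ^ (k + l) * Real.cos ((k + l : ℕ) * φ))))| ≤ 8 * (0.01 * q ^ l) := by
    rw [abs_mul, abs_pow, abs_neg, abs_one, one_pow, one_mul]; exact this
  rw [mul_sub] at h2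
  have hql : 0 < q ^ l := by positivity
  linarith [(abs_le.1 h2).1]

end EisensteinZeros

/-! ### Row sums over the vectors z + d -/

namespace EisensteinZeros

open Filter Topology EisensteinSeries ModularForm UpperHalfPlane

/-- The sum of `(z + d)^{-k}` over all integers `d`. -/
noncomputable def rowSum (k : ℕ) (z : ℍ) : ℂ := ∑' d : ℤ, (((z : ℂ) + d)⁻¹) ^ k

lemma norm_E_sub_one_le {z : ℍ} (h1 : |z.re| ≤ 1) (h2 : 1 / 2 ≤ z.im) {k : ℕ} (hk : 3 ≤ k + 4)
    (he : Even k) : ‖E hk z - 1‖ ≤ tailConst * ((z.im)⁻¹) ^ k := by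
  have hsub : (({![0, 1], ![0, -1]} : Finset (Fin 2 → ℤ)) : Set (Fin 2 → ℤ)) ⊆ gammaSet 1 1 0 :=
    Set.Subset.trans (by intro v hv; simp [shortVecs] at hv ⊢; tauto) shortVecs_subset
  have := norm_E_sub_le h1 h2 hsub z.im_pos (fun v hv hs => by
    have hv0 : v 0 ≠ 0 := by
      intro h0
      rcases eq_of_mem_gammaSet_of_zero hv h0 with h | h <;> exact hs (by simp [h])
    have h3 : (1 : ℝ) ≤ |(v 0 : ℝ)| := by exact_mod_cast Int.one_le_abs hv0
    have := abs_mul_im_le_norm_latVec z v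
    nlinarith [z.im_pos]) hk
  refine le_trans (le_of_eq ?_) this
  congr 2
  rw [Finset.tsum_subtype' {![0, 1], ![0, -1]} fun v => ((latVec z v)⁻¹) ^ (k + 4),
    Finset.sum_insert (by decide), Finset.sum_singleton]
  have he4 : Even (k + 4) := he.add (by decide)
  simp only [latVec, Matrix.cons_val_zero, Matrix.cons_val_one, Int.cast_zero, Int.cast_one,
    Int.cast_neg, zero_mul, zero_add, inv_neg, he4.neg_pow, inv_one, one_pow]
  norm_num

/-- The rows c = 0 and c = ±1 are kept whole and every other row has vectors of norm at least 2y. At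
great height many vectors z + d have nearly the same norm, so a whole row must be kept for the error
to be relatively small. -/
lemma norm_E_sub_rowSum_le {z : ℍ} (h1 : |z.re| ≤ 1) (h2 : 1 / 2 ≤ z.im) {k : ℕ} (hk : 3 ≤ k + 4)
    (he : Even k) : ‖E hk z - (1 + rowSum (k + 4) z)‖ ≤ tailConst * ((2 * z.im)⁻¹) ^ k := by
  have he4 : Even (k + 4) := he.add (by decide)
  have hS := (summable_norm_latVec hk z).of_norm
  set s0 : Set (Fin 2 → ℤ) := (({![0, 1], ![0, -1]} : Finset (Fin 2 → ℤ)) : Set (Fin 2 → ℤ))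
    with hs0
  set s1 : Set (Fin 2 → ℤ) := Set.range fun d : ℤ => ![1, d] with hs1
  set s2 : Set (Fin 2 → ℤ) := Set.range fun d : ℤ => ![-1, -d] with hs2
  have m0 : ∀ v ∈ s0, v 0 = 0 := by
    intro v hv
    simp only [hs0, Finset.coe_insert, Finset.coe_singleton, Set.mem_insert_iff,
      Set.mem_singleton_iff] at hv
    rcases hv with rfl | rfl <;> rfl
  have m1 : ∀ v ∈ s1, v 0 = 1 := by rintro v ⟨d, rfl⟩; rfl
  have m2 : ∀ v ∈ s2, v 0 = -1 := by rintro v ⟨d, rfl⟩; rfl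
  have d01 : Disjoint s0 s1 := Set.disjoint_left.2 fun v h h' => by
    have := m0 v h; have := m1 v h'; omega
  have d012 : Disjoint (s0 ∪ s1) s2 := Set.disjoint_left.2 fun v h h' => by
    have := m2 v h'
    rcases h with h | h
    · have := m0 v h; omega
    · have := m1 v h; omega
  have hsub : s0 ∪ s1 ∪ s2 ⊆ gammaSet 1 1 0 := by
    rintro v ((h | ⟨d, rfl⟩) | ⟨d, rfl⟩)
    · exact Set.Subset.trans (by intro v hv; simp [hs0, shortVecs] at hv ⊢; tauto)
        shortVecs_subset h
    · rw [mem_gammaSet_one]; exact isCoprime_one_left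
    · rw [mem_gammaSet_one]; exact isCoprime_one_left.neg_left
  have := norm_E_sub_le h1 h2 hsub (μ := 2 * z.im) (by linarith [z.im_pos]) (fun v hv hs => by
    have h3 : 2 ≤ |v 0| := by
      by_contra! hcon
      obtain h | h | h : v 0 = 0 ∨ v 0 = 1 ∨ v 0 = -1 := by
        rcases abs_cases (v 0) with h | h <;> omega
      · apply hs; left; left
        rcases eq_of_mem_gammaSet_of_zero hv h with h | h <;> simp [hs0, h]
      · apply hs; left; right
        exact ⟨v 1, by ext i; fin_cases i <;> simp [h]⟩
      · apply hs; right
        exact ⟨-v 1, by ext i; fin_cases i <;> simp [h]⟩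
    have h4 : (2 : ℝ) ≤ |(v 0 : ℝ)| := by exact_mod_cast h3
    have := abs_mul_im_le_norm_latVec z v
    nlinarith [z.im_pos]) hk
  refine le_trans (le_of_eq ?_) this
  congr 2
  rw [Summable.tsum_union_disjoint (f := fun v => ((latVec z v)⁻¹) ^ (k + 4)) d012
      (hS.subtype _) (hS.subtype _),
    Summable.tsum_union_disjoint (f := fun v => ((latVec z v)⁻¹) ^ (k + 4)) d01
      (hS.subtype _) (hS.subtype _), hs0,
    Finset.tsum_subtype' {![0, 1], ![0, -1]} fun v => ((latVec z v)⁻¹) ^ (k + 4),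
    Finset.sum_insert (by decide), Finset.sum_singleton, hs1, hs2,
    tsum_range (fun v => ((latVec z v)⁻¹) ^ (k + 4)) (g := fun d : ℤ => ![1, d]) (fun a b h => by
      simpa using congrFun h 1),
    tsum_range (fun v => ((latVec z v)⁻¹) ^ (k + 4)) (g := fun d : ℤ => ![-1, -d]) (fun a b h => by
      simpa using congrFun h 1)]
  have e2 : ∀ d : ℤ, ((latVec z ![-1, -d])⁻¹) ^ (k + 4) = (((z : ℂ) + d)⁻¹) ^ (k + 4) := by
    intro d
    have : latVec z ![-1, -d] = -(z + d) := by simp [latVec]; ring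
    rw [this, inv_neg, he4.neg_pow]
  have e1 : ∀ d : ℤ, ((latVec z ![1, d])⁻¹) ^ (k + 4) = (((z : ℂ) + d)⁻¹) ^ (k + 4) := by
    intro d
    simp [latVec]
  simp only [e1, e2, rowSum]
  simp [latVec, inv_neg, he4.neg_pow]
  ring

lemma tsum_le_of_le_inv_mul_succ {g : ℕ → ℝ} {A : ℝ} (hA : 0 ≤ A) (h0 : ∀ n, 0 ≤ g n)
    (hg : ∀ n : ℕ, g n ≤ A * (1 / (((n : ℝ) + 1) * (n + 2)))) :
    Summable g ∧ ∑' n, g n ≤ A := by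
  have hpart : ∀ n, ∑ i ∈ Finset.range n, g i ≤ A := by
    intro n
    have htel : ∀ n : ℕ, ∑ i ∈ Finset.range n, 1 / (((i : ℝ) + 1) * (i + 2)) =
        1 - 1 / ((n : ℝ) + 1) := by
      intro n
      induction n with
      | zero => simp
      | succ n ih =>
        rw [Finset.sum_range_succ, ih]
        push_cast
        field_simp
        ring
    calc ∑ i ∈ Finset.range n, g i
        ≤ ∑ i ∈ Finset.range n, A * (1 / (((i : ℝ) + 1) * (i + 2))) :=
          Finset.sum_le_sum fun i _ => hg i
      _ = A * (1 - 1 / ((n : ℝ) + 1)) := by rw [← Finset.mul_sum, htel]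
      _ ≤ A * 1 := by
          apply mul_le_mul_of_nonneg_left _ hA
          have : 0 ≤ 1 / ((n : ℝ) + 1) := by positivity
          linarith
      _ = A := mul_one A
  exact ⟨summable_of_sum_range_le h0 hpart, Real.tsum_le_of_sum_range_le h0 hpart⟩

lemma norm_tsum_nat_sub_le {f : ℕ → ℂ} {A : ℝ} (hA : 0 ≤ A)
    (hf : ∀ n : ℕ, ‖f (n + 1)‖ ≤ A * (1 / (((n : ℝ) + 1) * (n + 2)))) :
    Summable f ∧ ‖∑' n, f n - f 0‖ ≤ A := by
  obtain ⟨h1, h2⟩ := tsum_le_of_le_inv_mul_succ hA (fun n => norm_nonneg (f (n + 1))) hf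
  have hs : Summable f := (summable_nat_add_iff 1).1 h1.of_norm
  refine ⟨hs, ?_⟩
  rw [hs.tsum_eq_zero_add, add_sub_cancel_left]
  exact (norm_tsum_le_tsum_norm h1).trans h2

/-- On the line `x = 1 / 2` the two terms of least norm dominate the row sum as long as
the weight is large compared to `‖z‖²`. -/
lemma norm_rowSum_sub_le {φ : ℝ} (h0 : 0 < φ) (h1 : φ < Real.pi / 2) {k : ℕ} (hk : Even k)
    (hq : 4 ≤ k * (2 * Real.cos φ) ^ 2) :
    ‖rowSum k (sidePt (Real.tan φ / 2)) -
      ((2 * (2 * Real.cos φ) ^ k * Real.cos (k * φ) : ℝ) : ℂ)‖ ≤ (2 * Real.cos φ) ^ k := by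
  rw [← inv_pow_add_inv_pow_sidePt h0 h1 hk]
  have hc : 0 < Real.cos φ := Real.cos_pos_of_mem_Ioo ⟨by linarith, h1⟩
  have hy := half_tan_pos h0 h1
  have hn := norm_sidePt_tan h0 h1
  set q := 2 * Real.cos φ with hqdef
  have hq0 : 0 < q := by positivity
  have hre := sidePt_re hy
  set z := sidePt (Real.tan φ / 2) with hz
  obtain ⟨h, rfl⟩ := hk
  -- With weight h + h, Bernoulli and hq² ≥ 2 give (1 + q²x)^h ≥ 2x for x = (n + 1)(n + 2). Since ∑
  -- 1/((n + 1)(n + 2)) telescopes to 1, the vectors d > 0 and the vectors d < -1 contribute at most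
  -- q^k/2 each.
  have hbound : ∀ (w : ℂ) (n : ℕ), ‖w‖ ^ 2 = ‖(z : ℂ)‖ ^ 2 + ((n : ℝ) + 1) * (n + 2) →
      ‖(w⁻¹) ^ (h + h)‖ ≤ q ^ (h + h) / 2 * (1 / (((n : ℝ) + 1) * (n + 2))) := by
    intro w n hw
    set x : ℝ := ((n : ℝ) + 1) * (n + 2) with hx
    have hx0 : 0 < x := by positivity
    have hw' : ‖w‖ ^ 2 = (q ^ 2)⁻¹ * (1 + q ^ 2 * x) := by
      rw [hw, hn]; field_simp
    have hb : 2 * x ≤ (1 + q ^ 2 * x) ^ h := by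
      have := one_add_mul_le_pow (a := q ^ 2 * x) (by nlinarith [mul_pos (pow_pos hq0 2) hx0]) h
      push_cast at hq
      nlinarith
    rw [norm_pow, norm_inv, ← two_mul, pow_mul, pow_mul, inv_pow, hw', mul_inv, inv_inv, mul_pow,
      inv_pow, div_eq_mul_inv, mul_assoc]
    refine mul_le_mul_of_nonneg_left ?_ (by positivity)
    rw [one_div, ← mul_inv]
    exact inv_anti₀ (by positivity) hb
  have hnsq : ∀ (w : ℂ) (t : ℝ), w = z + (t : ℂ) → ‖w‖ ^ 2 = ‖(z : ℂ)‖ ^ 2 + t * (t + 1) := by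
    intro w t hw
    rw [norm_sq_coe, hre, ← Complex.normSq_eq_norm_sq, Complex.normSq_apply, hw]
    simp only [Complex.add_re, Complex.add_im, Complex.ofReal_re, Complex.ofReal_im, coe_re, coe_im,
      hre]
    ring
  have hA : 0 ≤ q ^ (h + h) / 2 := by positivity
  obtain ⟨s1, b1⟩ := norm_tsum_nat_sub_le (f := fun n : ℕ => (((z : ℂ) + n)⁻¹) ^ (h + h)) hA
    (fun n => hbound _ n (by rw [hnsq _ ((n : ℝ) + 1) (by push_cast; ring)]; ring))
  obtain ⟨s2, b2⟩ := norm_tsum_nat_sub_le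
    (f := fun n : ℕ => (((z : ℂ) + ((-((n : ℤ) + 1) : ℤ) : ℂ))⁻¹) ^ (h + h)) hA
    (fun n => hbound _ n (by rw [hnsq _ (-((n : ℝ) + 2)) (by push_cast; ring)]; ring))
  have hs := HasSum.of_nat_of_neg_add_one (f := fun d : ℤ => (((z : ℂ) + d)⁻¹) ^ (h + h))
    (m := ∑' n : ℕ, (((z : ℂ) + n)⁻¹) ^ (h + h)) (by simpa only [Int.cast_natCast] using s1.hasSum)
    s2.hasSum
  rw [rowSum, hs.tsum_eq]
  have e0 : (((z : ℂ) + ((-(((0 : ℕ) : ℤ) + 1) : ℤ) : ℂ))⁻¹) ^ (h + h) =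
      (((z : ℂ) - 1)⁻¹) ^ (h + h) := by
    norm_num [sub_eq_add_neg]
  have e1 : (((z : ℂ) + ((0 : ℕ) : ℂ))⁻¹) ^ (h + h) = ((z : ℂ)⁻¹) ^ (h + h) := by simp
  rw [e0] at b2
  rw [e1] at b1
  rw [add_sub_add_comm]
  exact (norm_add_le _ _).trans (by linarith)

end EisensteinZeros

/-! ### Signs at intermediate height, and the dominant Lipschitz term -/

namespace EisensteinZeros

open Filter Topology EisensteinSeries ModularForm UpperHalfPlane

lemma pos_of_norm_ofReal_sub_le {x c s b : ℝ} (hs : s * s = 1) (h : ‖(x : ℂ) - ((c * s : ℝ) : ℂ)‖ ≤ b)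
    (hb : b < c) : 0 < s * x := by
  rw [← Complex.ofReal_sub, Complex.norm_real, Real.norm_eq_abs] at h
  have hs1 : |s| = 1 := by rcases mul_self_eq_one_iff.1 hs with h | h <;> simp [h]
  have : |s * (x - c * s)| ≤ b := by rwa [abs_mul, hs1, one_mul]
  have h2 : s * (x - c * s) = s * x - c * (s * s) := by ring
  rw [h2, hs] at this
  linarith [(abs_le.1 this).1]

lemma neg_one_pow_mul_self (m : ℕ) : (-1 : ℝ) ^ m * (-1) ^ m = 1 := by rw [← mul_pow]; simp

/-- Signs of `Δ_{k,ℓ}` on the line `x = 1/2` at the points of argument `πm/ℓ` which are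
neither too low nor too high. -/
lemma exists_sideVal_pos_of_ge : ∃ L : ℕ, ∀ (k l m : ℕ) (hk : 4 ≤ k) (hl : 4 ≤ l), Even k →
    Even l → L ≤ l → l + 12 ≤ k → l + 1 ≤ 3 * m → 2 * m < l →
    2 * Real.cos (Real.pi * m / l) ≤ 1 / 2 → 4 ≤ l * (2 * Real.cos (Real.pi * m / l)) ^ 2 →
    0 < (-1) ^ m * sideVal (Delta hk hl) (Real.tan (Real.pi * m / l) / 2) := by
  have hlim : Tendsto (fun l : ℕ => tailConst * 1.7 ^ 4 * ((l : ℝ) ^ 2 * ((1.7)⁻¹) ^ l))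
      atTop (𝓝 0) := by
    rw [← mul_zero (tailConst * 1.7 ^ 4)]
    exact (tendsto_pow_const_mul_const_pow_of_lt_one 2 (by norm_num) (by norm_num)).const_mul _
  obtain ⟨L, hL⟩ := eventually_atTop.1 (hlim.eventually_le_const (u := 0.01) (by norm_num))
  refine ⟨L, fun k l m hk hl hke hle hLl hlk hm1 hm2 hq2 hq4 => ?_⟩
  have hε := hL l hLl
  set φ := Real.pi * m / l with hφ
  have hpi := Real.pi_pos
  have hl0 : (0 : ℝ) < l := by exact_mod_cast (by omega : 0 < l)
  have hm1' : (l : ℝ) + 1 ≤ 3 * m := by exact_mod_cast hm1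
  have hm2' : 2 * (m : ℝ) < l := by exact_mod_cast hm2
  have hφ1 : Real.pi / 3 ≤ φ := by rw [hφ, le_div_iff₀ hl0]; nlinarith
  have hφ2 : φ < Real.pi / 2 := by rw [hφ, div_lt_iff₀ hl0]; nlinarith
  have hφ0 : 0 < φ := by linarith
  have hlφ : l * φ = m * Real.pi := by rw [hφ]; field_simp
  have hc : 0 < Real.cos φ := Real.cos_pos_of_mem_Ioo ⟨by linarith, hφ2⟩
  have hs : 0.85 ≤ Real.sin φ := by
    have := Real.sin_le_sin_of_le_of_le_pi_div_two (by linarith) hφ2.le hφ1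
    rw [Real.sin_pi_div_three] at this
    have hsq : 1.732 ≤ √3 := Real.le_sqrt_of_sq_le (by norm_num)
    linarith
  have hy := half_tan_pos hφ0 hφ2
  have htan : Real.tan φ = 2 * Real.sin φ / (2 * Real.cos φ) := by
    rw [Real.tan_eq_sin_div_cos, mul_div_mul_left _ _ two_ne_zero]
  have hrow := fun {n : ℕ} (hn : Even n) => norm_rowSum_sub_le hφ0 hφ2 hn
  set y := Real.tan φ / 2 with hydef
  set q := 2 * Real.cos φ with hq
  have hq0 : 0 < q := by positivity
  -- φ ≥ π/3 gives 2 sin φ ≥ √3 > 1.7, so 2y ≥ 1.7/q and the remaining rows are smaller than q^n by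
  -- a factor of order 1.7^{-n}.
  have hinv : (2 * y)⁻¹ ≤ q * (1.7)⁻¹ := by
    have h2y : 2 * y = 2 * Real.sin φ / q := by rw [hydef, htan]; ring
    rw [h2y, inv_div, div_eq_mul_inv]
    exact mul_le_mul_of_nonneg_left (inv_anti₀ (by norm_num) (by linarith)) hq0.le
  have hy1 : 1 / 2 ≤ y := by
    have : 2 * y = 2 * Real.sin φ / q := by rw [hydef, htan]; ring
    have h2 : 1 ≤ 2 * Real.sin φ / q := by rw [le_div_iff₀ hq0]; linarith
    linarith
  have hrem : ∀ {n : ℕ} (hn : 3 ≤ n) (_ : Even n), l ≤ n →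
      ‖E hn (sidePt y) - (1 + rowSum n (sidePt y))‖ ≤ 0.01 * q ^ l := by
    intro n hn' hne hln
    obtain ⟨n', rfl⟩ : ∃ n', n = n' + 4 := ⟨n - 4, by omega⟩
    have hne' : Even n' := by
      have := hne.tsub (show Even 4 by decide); simpa using this
    have := norm_E_sub_rowSum_le (z := sidePt y) (by rw [sidePt_re hy]; norm_num)
      (by rw [sidePt_im hy]; exact hy1) hn' hne'
    rw [sidePt_im hy] at this
    -- Four powers of q are lost in the tail bound. The hypothesis ℓq² ≥ 4 replaces them by the
    -- polynomial factor ℓ², which 1.7^{-ℓ} absorbs.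
    have hql : 1 ≤ q ^ 4 * (l : ℝ) ^ 2 := by
      have : 4 ^ 2 ≤ (l * q ^ 2) ^ 2 := pow_le_pow_left₀ (by norm_num) hq4 2
      rw [mul_pow] at this
      linarith
    calc _ ≤ _ := this
      _ ≤ tailConst * (q * (1.7)⁻¹) ^ n' :=
        mul_le_mul_of_nonneg_left (pow_le_pow_left₀ (by positivity) hinv _) tailConst_pos.le
      _ ≤ tailConst * ((l : ℝ) ^ 2 * q ^ l * (1.7 ^ 4 * ((1.7)⁻¹) ^ l)) := by
        rw [mul_pow]
        refine mul_le_mul_of_nonneg_left (mul_le_mul ?_ ?_ (by positivity) (by positivity))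
          tailConst_pos.le
        · calc q ^ n' ≤ q ^ n' * (q ^ 4 * (l : ℝ) ^ 2) := le_mul_of_one_le_right (by positivity) hql
            _ = (l : ℝ) ^ 2 * q ^ (n' + 4) := by ring
            _ ≤ (l : ℝ) ^ 2 * q ^ l :=
              mul_le_mul_of_nonneg_left (pow_le_pow_of_le_one hq0.le (by linarith) hln)
                (by positivity)
        · calc ((1.7 : ℝ)⁻¹) ^ n' = 1.7 ^ 4 * ((1.7)⁻¹) ^ (n' + 4) := by
                rw [pow_add]; ring_nf
            _ ≤ 1.7 ^ 4 * ((1.7)⁻¹) ^ l :=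
              mul_le_mul_of_nonneg_left (pow_le_pow_of_le_one (by norm_num) (by norm_num) hln)
                (by norm_num)
      _ = (tailConst * 1.7 ^ 4 * ((l : ℝ) ^ 2 * ((1.7)⁻¹) ^ l)) * q ^ l := by ring
      _ ≤ _ := by gcongr
  have hX : ∀ {n : ℕ} (_ : Even n), l ≤ n → ‖rowSum n (sidePt y)‖ ≤ 3 * q ^ n := by
    intro n hne hln
    have hln' : (l : ℝ) ≤ n := by exact_mod_cast hln
    have h1 := hrow hne (hq4.trans (by gcongr))
    have h2 := norm_le_insert' (rowSum n (sidePt y)) ((2 * q ^ n * Real.cos (n * φ) : ℝ) : ℂ)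
    rw [Complex.norm_real, Real.norm_eq_abs, abs_mul, abs_of_nonneg (by positivity)] at h2
    have h3 := mul_le_mul_of_nonneg_left (Real.abs_cos_le_one (n * φ))
      (by positivity : 0 ≤ 2 * q ^ n)
    linarith
  have hq4' : ∀ {n : ℕ}, 4 ≤ n → q ^ n ≤ 1 / 16 := by
    intro n hn
    calc q ^ n ≤ (1 / 2) ^ n := pow_le_pow_left₀ hq0.le hq2 n
      _ ≤ (1 / 2) ^ 4 := pow_le_pow_of_le_one (by norm_num) (by norm_num) hn
      _ = 1 / 16 := by norm_num
  -- Because k ≥ ℓ + 12 and q ≤ 1/2, the contributions of weights k and k + ℓ are at least 2^12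
  -- times smaller than q^ℓ, and only E_ℓ - 1 decides the sign.
  have hqk : ∀ {n : ℕ}, l + 12 ≤ n → q ^ n ≤ q ^ l / 4096 := by
    intro n hn
    calc q ^ n ≤ q ^ (l + 12) := pow_le_pow_of_le_one hq0.le (by linarith) hn
      _ = q ^ l * q ^ 12 := pow_add _ _ _
      _ ≤ q ^ l * (1 / 2) ^ 12 := by gcongr
      _ = q ^ l / 4096 := by norm_num; ring
  have hM : ∀ {n : ℕ} (_ : Even n), l ≤ n → ‖1 + rowSum n (sidePt y)‖ ≤ 3 := by
    intro n hne hln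
    have h1 := hX hne hln
    have h2 := hq4' (hl.trans hln)
    have h3 := norm_add_le 1 (rowSum n (sidePt y))
    rw [norm_one] at h3
    linarith
  have hql : 0 < q ^ l := by positivity
  have h1 := norm_mul_sub_sub_le (ε := 0.01 * q ^ l) (hM hke (by omega)) (hM hle le_rfl)
    (c := 1 + rowSum (k + l) (sidePt y))
    (hrem (show 3 ≤ k by omega) hke (by omega))
    (hrem (show 3 ≤ l by omega) hle le_rfl) (hrem (show 3 ≤ k + l by omega) (hke.add hle)
      (by omega)) (by have := hq4' hl
                      linarith)
  simp only [add_sub_cancel] at h1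
  change ‖Delta hk hl (sidePt y) - _‖ ≤ _ at h1
  rw [← ofReal_sideVal hk hl hy] at h1
  have h2 : ‖rowSum k (sidePt y) + rowSum k (sidePt y) * rowSum l (sidePt y)
      - rowSum (k + l) (sidePt y)‖ ≤ 0.01 * q ^ l := by
    refine (norm_sub_le _ _).trans ((add_le_add_left (norm_add_le _ _) _).trans ?_)
    rw [norm_mul]
    have hk1 := hX hke (by omega)
    have hl1 := (hX hle le_rfl).trans (b := 3 * q ^ l) (c := 1) (by linarith [hq4' hl])
    have hw1 := hX (hke.add hle) (by omega)
    have hk2 := hqk hlk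
    have hw2 := hqk (show l + 12 ≤ k + l by omega)
    have := mul_le_mul hk1 hl1 (norm_nonneg _) (by positivity)
    linarith
  have h3 := hrow hle hq4
  rw [hlφ, Real.cos_nat_mul_pi] at h3
  refine pos_of_norm_ofReal_sub_le (neg_one_pow_mul_self m) (c := 2 * q ^ l) (b := 1.09 * q ^ l) ?_
    (by linarith)
  have hsum : (sideVal (Delta hk hl) y : ℂ) - ((2 * q ^ l * (-1) ^ m : ℝ) : ℂ) =
      ((sideVal (Delta hk hl) y : ℂ) - ((1 + rowSum k (sidePt y)) * (1 + rowSum l (sidePt y)) -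
        (1 + rowSum (k + l) (sidePt y)))) + (rowSum k (sidePt y) +
        rowSum k (sidePt y) * rowSum l (sidePt y) - rowSum (k + l) (sidePt y)) +
      (rowSum l (sidePt y) - ((2 * q ^ l * (-1) ^ m : ℝ) : ℂ)) := by ring
  rw [hsum]
  exact norm_add₃_le.trans (by linarith)

/-- Away from the peak index m the terms decay geometrically, with ratio a upwards and b downwards,
so both tails are dominated by geometric series. -/
lemma abs_alternating_tsum_sub_le {f : ℕ → ℝ} (h0 : ∀ n, 0 ≤ f n) (hf : Summable f) {a b : ℝ}
    (ha0 : 0 ≤ a) (ha1 : a < 1) (hb0 : 0 ≤ b) (hb1 : b < 1) {m : ℕ}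
    (ha : ∀ n, m ≤ n → f (n + 1) ≤ a * f n) (hb : ∀ n, n < m → f n ≤ b * f (n + 1)) :
    |∑' n, (-1) ^ n * f n - (-1) ^ m * f m| ≤ (a / (1 - a) + b / (1 - b)) * f m := by
  have hup : ∀ j, f (j + (m + 1)) ≤ f m * a * a ^ j := by
    intro j
    induction j with
    | zero => have := ha m le_rfl; rw [zero_add, pow_zero]; linarith
    | succ j ih =>
      have := ha (j + (m + 1)) (by omega)
      rw [show j + 1 + (m + 1) = j + (m + 1) + 1 by ring, pow_succ]
      nlinarith
  have hdown : ∀ j, j < m → f (m - 1 - j) ≤ f m * b * b ^ j := by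
    intro j
    induction j with
    | zero =>
      intro hj
      have := hb (m - 1) (by omega)
      rw [show m - 1 + 1 = m by omega] at this
      rw [Nat.sub_zero, pow_zero]; linarith
    | succ j ih =>
      intro hj
      have h1 := ih (by omega)
      have := hb (m - 1 - (j + 1)) (by omega)
      rw [show m - 1 - (j + 1) + 1 = m - 1 - j by omega] at this
      rw [pow_succ]
      nlinarith
  have hs : Summable fun n => (-1) ^ n * f n := by
    refine hf.of_norm_bounded fun n => ?_
    rw [norm_mul, norm_pow, norm_neg, norm_one, one_pow, one_mul, Real.norm_of_nonneg (h0 n)]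
  rw [← hs.sum_add_tsum_nat_add (m + 1), Finset.sum_range_succ]
  have e : ∀ A B C : ℝ, A + B + C - B = C + A := by intros; ring
  rw [e]
  refine (abs_add_le _ _).trans ?_
  rw [add_mul]
  have hgeo := (hasSum_geometric_of_lt_one ha0 ha1).mul_left (f m * a)
  refine add_le_add ?_ ?_
  · have := tsum_of_norm_bounded (f := fun j => (-1) ^ (j + (m + 1)) * f (j + (m + 1))) hgeo
      (fun j => by
        rw [norm_mul, norm_pow, norm_neg, norm_one, one_pow, one_mul, Real.norm_of_nonneg (h0 _)]
        exact hup j)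
    rw [Real.norm_eq_abs] at this
    refine this.trans (le_of_eq ?_)
    rw [div_eq_mul_inv]; ring
  · have hgeo2 := hasSum_geometric_of_lt_one hb0 hb1
    calc |∑ i ∈ Finset.range m, (-1) ^ i * f i|
        ≤ ∑ i ∈ Finset.range m, |(-1) ^ i * f i| := Finset.abs_sum_le_sum_abs _ _
      _ = ∑ i ∈ Finset.range m, f i := by
          refine Finset.sum_congr rfl fun i _ => ?_
          rw [abs_mul, abs_pow, abs_neg, abs_one, one_pow, one_mul, abs_of_nonneg (h0 i)]
      _ = ∑ j ∈ Finset.range m, f (m - 1 - j) := (Finset.sum_range_reflect _ _).symm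
      _ ≤ ∑ j ∈ Finset.range m, f m * b * b ^ j :=
          Finset.sum_le_sum fun j hj => hdown j (Finset.mem_range.1 hj)
      _ = f m * b * ∑ j ∈ Finset.range m, b ^ j := by rw [Finset.mul_sum]
      _ ≤ f m * b * (1 - b)⁻¹ := by
          apply mul_le_mul_of_nonneg_left _ (mul_nonneg (h0 m) hb0)
          exact sum_le_hasSum _ (fun _ _ => pow_nonneg hb0 _) hgeo2
      _ = b / (1 - b) * f m := by rw [div_eq_mul_inv]; ring

/-- The linear terms cancel at the peak of n^N e^{-nN/m}. The quadratic correction kept here and in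
`one_sub_le_exp_neg_sub_sq` is what makes the neighbouring terms smaller. -/
lemma one_add_le_exp_sub_sq {v : ℝ} (h0 : 0 ≤ v) (h1 : v ≤ 1) :
    1 + v ≤ Real.exp (v - v ^ 2 / 4) := by
  have := Real.quadratic_le_exp_of_nonneg (x := v - v ^ 2 / 4) (by nlinarith)
  refine le_trans ?_ this
  nlinarith [mul_nonneg h0 h0, mul_nonneg (mul_nonneg h0 h0) (sub_nonneg.2 h1),
    mul_nonneg (mul_nonneg h0 h0) (mul_nonneg h0 h0)]

lemma one_sub_le_exp_neg_sub_sq {v : ℝ} (h0 : 0 ≤ v) (h1 : v ≤ 1) :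
    1 - v ≤ Real.exp (-v - v ^ 2 / 2) := by
  rcases h1.eq_or_lt with rfl | h1
  · simp [Real.exp_nonneg]
  · have hs := Real.hasSum_pow_div_log_of_abs_lt_one (x := v) (by rw [abs_of_nonneg h0]; exact h1)
    have := sum_le_hasSum (Finset.range 2) (fun i _ => by positivity) hs
    rw [Finset.sum_range_succ, Finset.sum_range_one] at this
    norm_num at this
    rw [← Real.exp_log (sub_pos.2 h1)]
    exact Real.exp_le_exp.2 (by linarith)

/-- The terms of the Lipschitz formula at height `N / (2πm)`. -/
noncomputable def lipTerm (N m n : ℕ) : ℝ := (n : ℝ) ^ N * Real.exp (-(n * (N / m)))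

/-- With u = 1/m and v = 1/n ≤ u, the logarithm of the ratio is at most N(v - v²/4 - u) ≤ -Nu²/4 ≤
-1, and e^{-1} < 0.369. -/
lemma lipTerm_succ_le {N m n : ℕ} (hm : 1 ≤ m) (hN : 4 * m ^ 2 ≤ N) (hn : m ≤ n) :
    lipTerm N m (n + 1) ≤ 0.369 * lipTerm N m n := by
  have hm0 : (0 : ℝ) < m := by exact_mod_cast hm
  have hn0 : (0 : ℝ) < n := by exact_mod_cast hm.trans hn
  have hN' : 4 * (m : ℝ) ^ 2 ≤ N := by exact_mod_cast hN
  set u : ℝ := (m : ℝ)⁻¹ with hu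
  set v : ℝ := (n : ℝ)⁻¹ with hv
  have hvu : v ≤ u := inv_anti₀ hm0 (by exact_mod_cast hn)
  have hv0 : 0 < v := by positivity
  have hu1 : u ≤ 1 := inv_le_one_of_one_le₀ (by exact_mod_cast hm)
  have hNu : 4 ≤ N * u ^ 2 := by
    rw [hu, inv_pow, ← div_eq_mul_inv, le_div_iff₀ (by positivity)]; exact hN'
  have h1 : ((n + 1 : ℕ) : ℝ) ^ N ≤ (n : ℝ) ^ N * Real.exp (N * (v - v ^ 2 / 4)) := by
    rw [Real.exp_nat_mul, ← mul_pow]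
    apply pow_le_pow_left₀ (by positivity)
    calc ((n + 1 : ℕ) : ℝ) = n * (1 + v) := by rw [hv]; push_cast; field_simp
      _ ≤ _ := mul_le_mul_of_nonneg_left (one_add_le_exp_sub_sq hv0.le (hvu.trans hu1)) hn0.le
  have h2 : Real.exp (-1) ≤ 0.369 := by
    have := Real.exp_one_gt_d9
    rw [Real.exp_neg, inv_le_comm₀ (Real.exp_pos _) (by norm_num)]
    norm_num at this ⊢; linarith
  rw [lipTerm, lipTerm]
  calc ((n + 1 : ℕ) : ℝ) ^ N * Real.exp (-((n + 1 : ℕ) * (N / m)))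
      ≤ (n : ℝ) ^ N * Real.exp (N * (v - v ^ 2 / 4)) * Real.exp (-((n + 1 : ℕ) * (N / m))) := by
        gcongr
    _ = Real.exp (N * (v - v ^ 2 / 4) - N * u) * ((n : ℝ) ^ N * Real.exp (-(n * (N / m)))) := by
        rw [mul_assoc, ← Real.exp_add, mul_left_comm, ← Real.exp_add]
        congr 2
        push_cast
        rw [hu]; ring
    _ ≤ 0.369 * ((n : ℝ) ^ N * Real.exp (-(n * (N / m)))) := by
        apply mul_le_mul_of_nonneg_right _ (by positivity)
        refine le_trans (Real.exp_le_exp.2 ?_) h2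
        have h3 : v - v ^ 2 / 4 ≤ u - u ^ 2 / 4 := by nlinarith
        have := mul_le_mul_of_nonneg_left h3 (Nat.cast_nonneg N)
        linarith

/-- With u = 1/m and v = 1/(n + 1) ≥ u, the logarithm of the ratio is at most N(u - v - v²/2) ≤
-Nu²/2 ≤ -2, and e^{-2} < 0.136. -/
lemma lipTerm_le_succ {N m n : ℕ} (hm : 1 ≤ m) (hN : 4 * m ^ 2 ≤ N) (hn : n < m) :
    lipTerm N m n ≤ 0.136 * lipTerm N m (n + 1) := by
  have hm0 : (0 : ℝ) < m := by exact_mod_cast hm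
  have hN' : 4 * (m : ℝ) ^ 2 ≤ N := by exact_mod_cast hN
  set p : ℝ := ((n + 1 : ℕ) : ℝ) with hp
  have hp1 : 1 ≤ p := by rw [hp]; push_cast; linarith [(Nat.cast_nonneg n : (0 : ℝ) ≤ n)]
  have hp0 : 0 < p := by linarith
  set u : ℝ := (m : ℝ)⁻¹ with hu
  set v : ℝ := p⁻¹ with hv
  have hvu : u ≤ v := inv_anti₀ hp0 (by rw [hp]; exact_mod_cast hn)
  have hu0 : 0 < u := by positivity
  have hv1 : v ≤ 1 := inv_le_one_of_one_le₀ hp1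
  have hNu : 4 ≤ N * u ^ 2 := by
    rw [hu, inv_pow, ← div_eq_mul_inv, le_div_iff₀ (by positivity)]; exact hN'
  have h1 : (n : ℝ) ^ N ≤ p ^ N * Real.exp (N * (-v - v ^ 2 / 2)) := by
    rw [Real.exp_nat_mul, ← mul_pow]
    apply pow_le_pow_left₀ (by positivity)
    calc (n : ℝ) = p * (1 - v) := by rw [hv, mul_sub, mul_inv_cancel₀ hp0.ne', hp]; push_cast; ring
      _ ≤ _ := mul_le_mul_of_nonneg_left (one_sub_le_exp_neg_sub_sq (by linarith) hv1) hp0.le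
  have h2 : Real.exp (-2) ≤ 0.136 := by
    have h3 := Real.exp_one_gt_d9
    have h4 : Real.exp 2 = Real.exp 1 ^ 2 := by rw [← Real.exp_nat_mul]; norm_num
    rw [Real.exp_neg, inv_le_comm₀ (Real.exp_pos _) (by norm_num), h4]
    norm_num at h3 ⊢; nlinarith
  rw [lipTerm, lipTerm, ← hp]
  calc (n : ℝ) ^ N * Real.exp (-(n * (N / m)))
      ≤ p ^ N * Real.exp (N * (-v - v ^ 2 / 2)) * Real.exp (-(n * (N / m))) := by
        gcongr
    _ = Real.exp (N * (-v - v ^ 2 / 2) + N * u) * (p ^ N * Real.exp (-(p * (N / m)))) := by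
        rw [mul_assoc, ← Real.exp_add, mul_left_comm, ← Real.exp_add]
        congr 2
        rw [hp]
        push_cast
        rw [hu]; ring
    _ ≤ 0.136 * (p ^ N * Real.exp (-(p * (N / m)))) := by
        apply mul_le_mul_of_nonneg_right _ (by positivity)
        refine le_trans (Real.exp_le_exp.2 ?_) h2
        have h3 : -v - v ^ 2 / 2 ≤ -u - u ^ 2 / 2 := by nlinarith
        have := mul_le_mul_of_nonneg_left h3 (Nat.cast_nonneg N)
        linarith

lemma summable_lipTerm {N m : ℕ} (hm : 1 ≤ m) (hN : 1 ≤ N) : Summable (lipTerm N m) := by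
  have hm0 : (0 : ℝ) < m := by exact_mod_cast hm
  have hN0 : (0 : ℝ) < N := by exact_mod_cast hN
  have := summable_pow_mul_geometric_of_norm_lt_one N (r := Real.exp (-(N / m : ℝ))) (by
    rw [Real.norm_of_nonneg (Real.exp_nonneg _), Real.exp_lt_one_iff]
    have : (0 : ℝ) < N / m := by positivity
    linarith)
  refine this.congr fun n => ?_
  rw [lipTerm, ← Real.exp_nat_mul, mul_neg]

/-- 0.369/0.631 + 0.136/0.864 < 0.75, so both tails together leave at least a quarter of the peak
term. -/
lemma quarter_lipTerm_le {N m : ℕ} (hm : 1 ≤ m) (hN : 4 * m ^ 2 ≤ N) :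
    0.25 * lipTerm N m m ≤ (-1) ^ m * ∑' n, (-1) ^ n * lipTerm N m n := by
  have hf0 : ∀ n, 0 ≤ lipTerm N m n := fun n => by rw [lipTerm]; positivity
  have h := abs_alternating_tsum_sub_le hf0 (summable_lipTerm hm (by nlinarith))
    (by norm_num) (by norm_num) (by norm_num) (by norm_num) (fun n hn => lipTerm_succ_le hm hN hn)
    (fun n hn => lipTerm_le_succ hm hN hn)
  have h2 : |(-1) ^ m * (∑' n, (-1) ^ n * lipTerm N m n - (-1) ^ m * lipTerm N m m)| ≤
      0.75 * lipTerm N m m := by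
    rw [abs_mul, abs_pow, abs_neg, abs_one, one_pow, one_mul]
    refine h.trans (mul_le_mul_of_nonneg_right (by norm_num) (hf0 m))
  rw [mul_sub, ← mul_assoc, neg_one_pow_mul_self, one_mul] at h2
  linarith [(abs_le.1 h2).1]

end EisensteinZeros

/-! ### Signs high up on the half-line -/

namespace EisensteinZeros

open Filter Topology EisensteinSeries ModularForm UpperHalfPlane

/-- The Stirling sequence decreases from its value e/√2 at 1, and √N ≤ N. The extra factor √N does
no harm later. -/
lemma factorial_le_stirling {N : ℕ} (hN : 1 ≤ N) :
    (N.factorial : ℝ) ≤ Real.exp 1 * N * ((N : ℝ) / Real.exp 1) ^ N := by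
  have hN0 : (1 : ℝ) ≤ N := by exact_mod_cast hN
  have h : Stirling.stirlingSeq N ≤ Stirling.stirlingSeq 1 := by
    have := Stirling.stirlingSeq'_antitone (Nat.zero_le (N - 1))
    simpa [Nat.sub_add_cancel hN] using this
  rw [Stirling.stirlingSeq_one, Stirling.stirlingSeq, div_le_iff₀ (by positivity)] at h
  refine h.trans ?_
  rw [← mul_assoc]
  refine mul_le_mul_of_nonneg_right ?_ (by positivity)
  rw [Real.sqrt_mul (by norm_num), ← mul_assoc, div_mul_cancel₀ _ (by positivity)]
  refine mul_le_mul_of_nonneg_left ?_ (Real.exp_nonneg _)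
  rw [Real.sqrt_le_left (by linarith)]
  nlinarith

/-- This is the Lipschitz formula at x = 1/2, where e^{2πiz} = -e^{-2πy} makes the series alternate.
The height y = N/(2πm) puts the maximum of n^N e^{-2πny} at n = m. -/
lemma rowSum_sidePt {N m : ℕ} (hN : 1 ≤ N) (hm : 1 ≤ m) (he : Even (N + 1)) :
    rowSum (N + 1) (sidePt (N / (2 * Real.pi * m))) =
      (((-1) ^ ((N + 1) / 2) * (2 * Real.pi) ^ (N + 1) / N.factorial *
        ∑' n, (-1) ^ n * lipTerm N m n : ℝ) : ℂ) := by
  have hm0 : (0 : ℝ) < m := by exact_mod_cast hm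
  have hN0 : (0 : ℝ) < N := by exact_mod_cast hN
  have hy : 0 < (N : ℝ) / (2 * Real.pi * m) := by positivity
  have hz := coe_sidePt hy
  have h := qExpansion_identity hN (sidePt (N / (2 * Real.pi * m)))
  rw [rowSum]
  simp only [one_div, ← inv_pow] at h
  rw [h]
  have hq : Complex.exp (2 * Real.pi * Complex.I * (sidePt (N / (2 * Real.pi * m)) : ℂ)) =
      ((-Real.exp (-(N / m : ℝ)) : ℝ) : ℂ) := by
    rw [hz]
    have : 2 * Real.pi * Complex.I * (1 / 2 + ((N / (2 * Real.pi * m) : ℝ) : ℂ) * Complex.I) =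
        Real.pi * Complex.I + ((-(N / m : ℝ) : ℝ) : ℂ) := by
      have hpi : (Real.pi : ℂ) ≠ 0 := by exact_mod_cast Real.pi_ne_zero
      have hmc : (m : ℂ) ≠ 0 := by exact_mod_cast hm0.ne'
      push_cast
      field_simp
      linear_combination (N : ℂ) * Complex.I_sq
    rw [this, Complex.exp_add, Complex.exp_pi_mul_I, ← Complex.ofReal_exp]
    push_cast; ring
  rw [hq]
  obtain ⟨p, hp⟩ := he
  have hI : (-2 * Real.pi * Complex.I) ^ (N + 1) = (-1) ^ ((N + 1) / 2) * (2 * Real.pi) ^ (N + 1) := by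
    have h1 : (N + 1) / 2 = p := by omega
    have h2 : (-2 * Real.pi * Complex.I) ^ 2 = (-1) * (2 * Real.pi : ℂ) ^ 2 := by
      linear_combination (4 * (Real.pi : ℂ) ^ 2) * Complex.I_sq
    rw [h1, hp, ← two_mul, pow_mul, h2, mul_pow, ← pow_mul]
  rw [hI]
  push_cast
  congr 1
  refine tsum_congr fun n => ?_
  rw [lipTerm, neg_pow, ← Complex.exp_nat_mul]
  push_cast
  rw [mul_neg]
  ring

/-- The peak term is (m/e)^N. With Stirling's bound for N! a quarter of it becomes y^{-N}/N times
π/(2e) > 0.5, a size comparable with the error bounds in powers of 1/y. -/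
lemma le_rowSum_sidePt {N m : ℕ} (hm : 1 ≤ m) (hN : 4 * m ^ 2 ≤ N) :
    0.5 * (((N / (2 * Real.pi * m) : ℝ)⁻¹) ^ N / N) ≤ (2 * Real.pi) ^ (N + 1) / N.factorial *
        ((-1) ^ m * ∑' n, (-1) ^ n * lipTerm N m n) := by
  have hN1 : 1 ≤ N := by nlinarith
  have hm0 : (0 : ℝ) < m := by exact_mod_cast hm
  have hN0 : (0 : ℝ) < N := by exact_mod_cast hN1
  have h1 := quarter_lipTerm_le hm hN
  have hf := factorial_le_stirling hN1
  have hfac : (0 : ℝ) < N.factorial := by exact_mod_cast N.factorial_pos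
  have hpi := Real.pi_gt_d2
  have he := Real.exp_one_lt_d9
  have he0 := Real.exp_pos 1
  refine le_trans ?_ (mul_le_mul_of_nonneg_left h1 (by positivity))
  have hlip : lipTerm N m m = (m : ℝ) ^ N / Real.exp 1 ^ N := by
    rw [lipTerm, mul_div_cancel₀ _ hm0.ne', Real.exp_neg, ← Real.exp_nat_mul, mul_one, div_eq_mul_inv]
  rw [hlip]
  have hfi : (Real.exp 1 * N * ((N : ℝ) / Real.exp 1) ^ N)⁻¹ ≤ (N.factorial : ℝ)⁻¹ :=
    inv_anti₀ hfac hf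
  calc 0.5 * (((N / (2 * Real.pi * m) : ℝ)⁻¹) ^ N / N)
      ≤ (Real.pi / (2 * Real.exp 1)) * (((N / (2 * Real.pi * m) : ℝ)⁻¹) ^ N / N) := by
        apply mul_le_mul_of_nonneg_right _ (by positivity)
        rw [le_div_iff₀ (by positivity)]
        norm_num at he ⊢; linarith
    _ = (2 * Real.pi) ^ (N + 1) * (Real.exp 1 * N * ((N : ℝ) / Real.exp 1) ^ N)⁻¹ *
          (0.25 * ((m : ℝ) ^ N / Real.exp 1 ^ N)) := by
        rw [inv_div, div_pow, div_pow, pow_succ, mul_pow (2 * Real.pi)]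
        field_simp
        norm_num
    _ ≤ (2 * Real.pi) ^ (N + 1) * (N.factorial : ℝ)⁻¹ *
          (0.25 * ((m : ℝ) ^ N / Real.exp 1 ^ N)) := by gcongr
    _ = _ := by rw [div_eq_mul_inv ((2 * Real.pi) ^ (N + 1))]

/-- Signs of `Δ_{k,ℓ}` high up on the line `x = 1/2`. -/
lemma exists_sideVal_pos_high : ∃ L : ℕ, ∀ (k l m : ℕ) (hk : 4 ≤ k) (hl : 4 ≤ l), Even k →
    Even l → L ≤ l → l + 12 ≤ k → 1 ≤ m → 4 * m ^ 2 ≤ l - 1 →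
    0 < (-1) ^ (l / 2 + m) * sideVal (Delta hk hl) ((l - 1 : ℕ) / (2 * Real.pi * m)) := by
  have hlim : Tendsto (fun N : ℕ => tailConst * 2 ^ 3 * ((N : ℝ) ^ 4 * (2⁻¹) ^ N))
      atTop (𝓝 0) := by
    rw [show (𝓝 (0 : ℝ)) = 𝓝 (tailConst * 2 ^ 3 * 0) by rw [mul_zero]]
    exact (tendsto_pow_const_mul_const_pow_of_lt_one 4 (by norm_num) (by norm_num)).const_mul _
  obtain ⟨L, hL⟩ := eventually_atTop.1 (hlim.eventually_le_const (u := 0.1) (by norm_num))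
  obtain ⟨L', hL'⟩ := exists_nat_ge (3 * 10 ^ 5 * tailConst + 10 + tailConst)
  refine ⟨max L L' + 1, fun k l m hk hl hke hle hLl hlk hm hN => ?_⟩
  obtain ⟨N, rfl⟩ : ∃ N, l = N + 1 := ⟨l - 1, by omega⟩
  rw [Nat.add_sub_cancel] at hN ⊢
  have hLN := hL N (by omega)
  have hLN' : 3 * 10 ^ 5 * tailConst + 10 + tailConst ≤ N := hL'.trans (by exact_mod_cast (by omega))
  have hC := tailConst_pos
  have hm0 : (0 : ℝ) < m := by exact_mod_cast hm
  have hm1 : (1 : ℝ) ≤ m := by exact_mod_cast hm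
  have hN0 : (0 : ℝ) < N := by linarith
  have hN' : 4 * (m : ℝ) ^ 2 ≤ N := by exact_mod_cast hN
  have hpi := Real.pi_gt_d2
  have hpi' := Real.pi_lt_d2
  have hlow := le_rowSum_sidePt hm hN
  have hrow := rowSum_sidePt (by omega : 1 ≤ N) hm hle
  set y : ℝ := N / (2 * Real.pi * m) with hy
  have hy0 : 0 < y := by positivity
  have hyN : y ≤ N := div_le_self hN0.le (by nlinarith)
  -- The condition 4m² ≤ N gives y² ≥ N/π². So y grows with N, and a fixed number of spare powers of
  -- 1/y beats both the factor N in T and the constant.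
  have hy2 : (N : ℝ) ≤ 10 * y ^ 2 := by
    rw [hy, div_pow, mul_div_assoc', le_div_iff₀ (by positivity)]
    have : (2 * Real.pi * m) ^ 2 ≤ 10 * N := by
      have : Real.pi ^ 2 ≤ 10 := by nlinarith
      calc (2 * Real.pi * (m : ℝ)) ^ 2 = Real.pi ^ 2 * (4 * (m : ℝ) ^ 2) := by ring
        _ ≤ 10 * (N : ℝ) := mul_le_mul this hN' (by positivity) (by norm_num)
    nlinarith
  have hy1 : 1 ≤ y := by nlinarith
  have hre := sidePt_re hy0
  have him := sidePt_im hy0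
  set z := sidePt y with hz
  have hi1 : y⁻¹ ≤ 1 := inv_le_one_of_one_le₀ hy1
  set T : ℝ := (y⁻¹) ^ N / N with hT
  have hT0 : 0 < T := by positivity
  have hyT : ∀ {n : ℕ}, N + 9 ≤ n → tailConst * (y⁻¹) ^ n ≤ 0.05 * T := by
    intro n hn
    have h1 : (y⁻¹) ^ n ≤ (y⁻¹) ^ (N + 8) := pow_le_pow_of_le_one (by positivity) hi1 (by omega)
    have h2 : tailConst * (y⁻¹) ^ 8 ≤ 0.05 / N := by
      rw [inv_pow, ← div_eq_mul_inv, div_le_div_iff₀ (by positivity) hN0]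
      have h3 : (N : ℝ) ^ 4 ≤ 10 ^ 4 * y ^ 8 := by
        calc (N : ℝ) ^ 4 ≤ (10 * y ^ 2) ^ 4 := pow_le_pow_left₀ hN0.le hy2 4
          _ = 10 ^ 4 * y ^ 8 := by ring
      have h4 : 2 * 10 ^ 5 * tailConst * N ≤ (N : ℝ) ^ 4 := by
        have h5 : 2 * 10 ^ 5 * tailConst ≤ N := by linarith
        have h6 : (1 : ℝ) ≤ (N : ℝ) ^ 2 := one_le_pow₀ (by linarith)
        calc 2 * 10 ^ 5 * tailConst * N ≤ N * N := by gcongr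
          _ ≤ N * N * N ^ 2 := le_mul_of_one_le_right (by positivity) h6
          _ = (N : ℝ) ^ 4 := by ring
      linarith
    calc tailConst * (y⁻¹) ^ n ≤ tailConst * (y⁻¹) ^ (N + 8) := by gcongr
      _ = (y⁻¹) ^ N * (tailConst * (y⁻¹) ^ 8) := by rw [pow_add]; ring
      _ ≤ (y⁻¹) ^ N * (0.05 / N) := by gcongr
      _ = 0.05 * T := by rw [hT]; ring
  have habs : |z.re| ≤ 1 := by rw [hre]; norm_num
  have him' : 1 / 2 ≤ z.im := by rw [him]; linarith
  have hE1 : ∀ {n : ℕ} (hn : 3 ≤ n) (_ : Even n), 4 ≤ n →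
      ‖E hn z - 1‖ ≤ tailConst * (y⁻¹) ^ (n - 4) := by
    intro n hn hne h4
    obtain ⟨n', rfl⟩ : ∃ n', n = n' + 4 := ⟨n - 4, by omega⟩
    have hne' : Even n' := by
      have := hne.tsub (show Even 4 by decide); simpa using this
    have := norm_E_sub_one_le habs him' hn hne'
    rw [him] at this
    simpa using this
  have hk1 := (hE1 (show 3 ≤ k by omega) hke hk).trans (hyT (by omega))
  have hw1 := (hE1 (show 3 ≤ k + (N + 1) by omega) (hke.add hle) (by omega)).trans (hyT (by omega))
  have hl1 : ‖E (show 3 ≤ N + 1 by omega) z‖ ≤ 2 := by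
    have h1 := hE1 (show 3 ≤ N + 1 by omega) hle hl
    have h2 : tailConst * (y⁻¹) ^ (N + 1 - 4) ≤ 1 := by
      have h3 : (10 : ℕ) ≤ N := by
        have : (10 : ℝ) ≤ N := by linarith
        exact_mod_cast this
      have h4 : (y⁻¹) ^ (N + 1 - 4) ≤ (y⁻¹) ^ 2 :=
        pow_le_pow_of_le_one (by positivity) hi1 (by omega)
      have h5 : tailConst * (y⁻¹) ^ 2 ≤ 1 := by
        rw [inv_pow, ← div_eq_mul_inv, div_le_one (by positivity)]
        nlinarith
      exact (mul_le_mul_of_nonneg_left h4 hC.le).trans h5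
    have := norm_le_insert' (E (show 3 ≤ N + 1 by omega) z) 1
    rw [norm_one] at this
    linarith
  have hrl : ‖E (show 3 ≤ N + 1 by omega) z - (1 + rowSum (N + 1) z)‖ ≤ 0.1 * T := by
    obtain ⟨n', hn'⟩ : ∃ n', N + 1 = n' + 4 := ⟨N - 3, by omega⟩
    have hNn : N = n' + 3 := by omega
    have hne' : Even n' := by
      have : Even (n' + 4) := by rw [← hn']; exact hle
      have := this.tsub (show Even 4 by decide); simpa using this
    have h := norm_E_sub_rowSum_le habs him' (k := n') (by omega) hne'
    rw [him] at h
    have hcast : ‖E (show 3 ≤ N + 1 by omega) z - (1 + rowSum (N + 1) z)‖ ≤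
        tailConst * ((2 * y)⁻¹) ^ n' := by
      have hgen : ∀ M (hM : 3 ≤ M), M = n' + 4 →
          ‖E hM z - (1 + rowSum M z)‖ ≤ tailConst * ((2 * y)⁻¹) ^ n' := by
        rintro M hM rfl; exact h
      exact hgen _ _ hn'
    refine hcast.trans ?_
    -- The rows with |c| ≥ 2 lose only the factor N·y³ ≤ N^4 against T, which 2^{-N} absorbs.
    have h1 : tailConst * ((2 * y)⁻¹) ^ n' =
        tailConst * 2 ^ 3 * ((N * y ^ 3) * (2⁻¹) ^ N) * T := by
      rw [hT, hNn, mul_inv, mul_pow, pow_add, pow_add]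
      field_simp
    rw [h1]
    refine mul_le_mul_of_nonneg_right (le_trans ?_ hLN) hT0.le
    have : N * y ^ 3 ≤ (N : ℝ) ^ 4 := by
      calc N * y ^ 3 ≤ N * (N : ℝ) ^ 3 := by gcongr
        _ = (N : ℝ) ^ 4 := by ring
    gcongr
  set S : ℝ := ∑' n, (-1) ^ n * lipTerm N m n with hS
  have hcoef : 0.5 * T ≤ (2 * Real.pi) ^ (N + 1) / N.factorial * ((-1) ^ m * S) := hlow
  set c : ℝ := (2 * Real.pi) ^ (N + 1) / N.factorial * ((-1) ^ m * S) with hc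
  refine pos_of_norm_ofReal_sub_le (neg_one_pow_mul_self ((N + 1) / 2 + m)) (c := c)
    (b := 0.25 * T) ?_ (by linarith)
  have hcr : ((c * (-1) ^ ((N + 1) / 2 + m) : ℝ) : ℂ) = rowSum (N + 1) z := by
    rw [hrow]
    congr 1
    rw [hc, pow_add]
    have := neg_one_pow_mul_self m
    linear_combination ((2 * Real.pi) ^ (N + 1) / N.factorial * S * (-1) ^ ((N + 1) / 2)) * this
  rw [hcr, ofReal_sideVal hk hl hy0, Delta]
  have hsum : E (show 3 ≤ k by omega) z * E (show 3 ≤ N + 1 by omega) z -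
      E (show 3 ≤ k + (N + 1) by omega) z - rowSum (N + 1) z =
      (E (show 3 ≤ k by omega) z - 1) * E (show 3 ≤ N + 1 by omega) z -
      (E (show 3 ≤ k + (N + 1) by omega) z - 1) +
      (E (show 3 ≤ N + 1 by omega) z - (1 + rowSum (N + 1) z)) := by ring
  rw [hsum]
  refine (norm_add_le _ _).trans ((add_le_add_left (norm_sub_le _ _) _).trans ?_)
  rw [norm_mul]
  have := mul_le_mul hk1 hl1 (norm_nonneg _) (by positivity)
  linarith

end EisensteinZeros

/-! ### Sample points on the half-line and zeros from sign changes -/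

namespace EisensteinZeros

open Filter Topology EisensteinSeries ModularForm UpperHalfPlane

/-- Heights of sample points on the line `x = 1/2`. -/
noncomputable def sideSample (l m : ℕ) : ℝ :=
  if 4 * m ^ 2 ≤ l - 1 then (l - 1 : ℕ) / (2 * Real.pi * m)
  else Real.tan (Real.pi * (l / 2 - m : ℕ) / l) / 2

lemma pi_mul_div_eq {l m : ℕ} (hle : Even l) (hl : 0 < l) (hm : m ≤ l / 2) :
    Real.pi * (l / 2 - m : ℕ) / l = Real.pi / 2 - Real.pi * m / l := by
  obtain ⟨p, rfl⟩ := hle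
  have hp : (p : ℝ) ≠ 0 := by
    have : 0 < p := by omega
    exact_mod_cast this.ne'
  have h2 : (p + p) / 2 = p := by omega
  rw [h2] at hm ⊢
  rw [Nat.cast_sub hm]
  push_cast
  field_simp
  ring

lemma sqrt_three_div_two_lt_sideSample {l m : ℕ} (hle : Even l) (hl : 41 ≤ l) (hm : 1 ≤ m)
    (hml : 6 * m + 2 ≤ l) : √3 / 2 < sideSample l m := by
  have hpi := Real.pi_gt_d2
  have hpi' := Real.pi_lt_d2
  have hm0 : (0 : ℝ) < m := by exact_mod_cast hm
  have hl0 : (0 : ℝ) < l := by exact_mod_cast (by omega : 0 < l)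
  rw [sideSample]
  split_ifs with h
  · obtain ⟨N, rfl⟩ : ∃ N, l = N + 1 := ⟨l - 1, by omega⟩
    rw [Nat.add_sub_cancel] at h ⊢
    have hN : (40 : ℝ) ≤ N := by exact_mod_cast (by omega : 40 ≤ N)
    have hN' : 4 * (m : ℝ) ^ 2 ≤ N := by exact_mod_cast h
    have hsq : √3 / 2 < 1 := by
      have : √3 < 2 := by rw [Real.sqrt_lt' (by norm_num)]; norm_num
      linarith
    refine hsq.trans ?_
    rw [lt_div_iff₀ (by positivity), one_mul]
    have h1 : (2 * Real.pi * m) ^ 2 < (N : ℝ) ^ 2 := by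
      calc (2 * Real.pi * (m : ℝ)) ^ 2 = Real.pi ^ 2 * (4 * (m : ℝ) ^ 2) := by ring
        _ ≤ 10 * (N : ℝ) := mul_le_mul (by nlinarith) hN' (by positivity) (by norm_num)
        _ < (N : ℝ) ^ 2 := by nlinarith
    exact lt_of_pow_lt_pow_left₀ 2 (by positivity) h1
  · have hφ := pi_mul_div_eq hle (by omega) (show m ≤ l / 2 by omega)
    rw [hφ]
    have h1 : 6 * (m : ℝ) + 2 ≤ l := by exact_mod_cast hml
    have hx : Real.pi * m / l < Real.pi / 6 := by
      rw [div_lt_iff₀ hl0]; nlinarith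
    have hx0 : 0 < Real.pi * m / l := by positivity
    have := Real.tan_lt_tan_of_nonneg_of_lt_pi_div_two (x := Real.pi / 3)
      (y := Real.pi / 2 - Real.pi * m / l) (by positivity) (by linarith) (by linarith)
    rw [Real.tan_pi_div_three] at this
    linarith

/-- Heights decrease in m. Where the two definitions meet, tan x > x gives cot(π(m+1)/ℓ)/2 <
ℓ/(2π(m+1)) ≤ (ℓ - 1)/(2πm). -/
lemma sideSample_succ_lt {l m : ℕ} (hle : Even l) (hm : 1 ≤ m) (hml : 6 * (m + 1) + 2 ≤ l) :
    sideSample l (m + 1) < sideSample l m := by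
  have hpi := Real.pi_gt_d2
  have hm0 : (0 : ℝ) < m := by exact_mod_cast hm
  have hl0 : (0 : ℝ) < l := by exact_mod_cast (by omega : 0 < l)
  have hml' : 6 * ((m : ℝ) + 1) + 2 ≤ l := by exact_mod_cast hml
  have hN : ((l - 1 : ℕ) : ℝ) = l - 1 := by push_cast [show 1 ≤ l by omega]; rfl
  have hN0 : (0 : ℝ) < l - 1 := by linarith
  have hx : Real.pi * ((m + 1 : ℕ) : ℝ) / l < Real.pi / 2 := by
    rw [div_lt_iff₀ hl0]; push_cast; nlinarith
  have hx0 : 0 < Real.pi * ((m + 1 : ℕ) : ℝ) / l := by positivity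
  rw [sideSample, sideSample]
  split_ifs with h1 h2 h2
  · rw [hN]
    apply div_lt_div_of_pos_left hN0 (by positivity)
    push_cast
    nlinarith
  · exfalso; apply h2; nlinarith
  · rw [pi_mul_div_eq hle (by omega) (by omega), Real.tan_pi_div_two_sub, hN]
    have ht := Real.lt_tan hx0 hx
    have h3 : (Real.tan (Real.pi * ((m + 1 : ℕ) : ℝ) / l))⁻¹ <
        (Real.pi * ((m + 1 : ℕ) : ℝ) / l)⁻¹ := inv_strictAnti₀ hx0 ht
    have h4 : (Real.pi * ((m + 1 : ℕ) : ℝ) / l)⁻¹ / 2 ≤ (l - 1) / (2 * Real.pi * m) := by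
      rw [inv_div, div_div, div_le_div_iff₀ (by positivity) (by positivity)]
      push_cast
      nlinarith
    linarith
  · rw [pi_mul_div_eq hle (by omega) (by omega), pi_mul_div_eq hle (by omega) (by omega)]
    have h3 : Real.pi * (m : ℝ) / l < Real.pi * ((m + 1 : ℕ) : ℝ) / l := by
      gcongr
      exact_mod_cast Nat.lt_succ_self m
    have h4 : 0 < Real.pi * (m : ℝ) / l := by positivity
    have := Real.tan_lt_tan_of_nonneg_of_lt_pi_div_two
      (x := Real.pi / 2 - Real.pi * ((m + 1 : ℕ) : ℝ) / l)
      (y := Real.pi / 2 - Real.pi * m / l) (by linarith) (by linarith) (by linarith)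
    linarith

/-- The three height ranges share one sign rule: below the high range the argument is π(ℓ/2 - m)/ℓ,
and ℓ/2 - m has the parity of ℓ/2 + m. -/
lemma exists_sideVal_sideSample_pos : ∃ L : ℕ, ∀ (k l m : ℕ) (hk : 4 ≤ k) (hl : 4 ≤ l), Even k →
    Even l → L ≤ l → l + 12 ≤ k → 1 ≤ m → 6 * m + 2 ≤ l →
    0 < (-1) ^ (l / 2 + m) * sideVal (Delta hk hl) (sideSample l m) := by
  obtain ⟨L1, h1⟩ := exists_sideVal_pos_of_le
  obtain ⟨L2, h2⟩ := exists_sideVal_pos_of_ge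
  obtain ⟨L3, h3⟩ := exists_sideVal_pos_high
  refine ⟨max L1 (max L2 L3), fun k l m hk hl hke hle hL hlk hm hml => ?_⟩
  rw [sideSample]
  split_ifs with h
  · exact h3 k l m hk hl hke hle (by omega) hlk hm h
  · have hpar : (-1 : ℝ) ^ (l / 2 + m) = (-1) ^ (l / 2 - m) := by
      rw [show l / 2 + m = l / 2 - m + 2 * m by omega, pow_add, pow_mul]; simp
    rw [hpar]
    have hm1 : l + 1 ≤ 3 * (l / 2 - m) := by
      obtain ⟨p, rfl⟩ := hle; omega
    have hm2 : 2 * (l / 2 - m) < l := by omega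
    rcases le_total (1 / 2) (2 * Real.cos (Real.pi * (l / 2 - m : ℕ) / l)) with hq | hq
    · exact h1 k l _ hk hl hke hle (by omega) (by omega) hm1 hm2 hq
    · refine h2 k l _ hk hl hke hle (by omega) hlk hm1 hm2 hq ?_
      have hl0 : (0 : ℝ) < l := by exact_mod_cast (by omega : 0 < l)
      have hml' : 6 * (m : ℝ) + 2 ≤ l := by exact_mod_cast hml
      have hpi := Real.pi_pos
      rw [pi_mul_div_eq hle (by omega) (by omega), Real.cos_pi_div_two_sub]
      -- Jordan's inequality gives q = 2 sin(πm/ℓ) ≥ 4m/ℓ. Outside the high range ℓ ≤ 4m², hence ℓq²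
      -- ≥ 16m²/ℓ ≥ 4.
      have hsin := Real.mul_le_sin (x := Real.pi * m / l) (by positivity) (by
        rw [div_le_iff₀ hl0]; nlinarith)
      have he : 2 / Real.pi * (Real.pi * m / l) = 2 * m / l := by field_simp
      rw [he] at hsin
      have h4 : (l : ℝ) ≤ 4 * (m : ℝ) ^ 2 := by
        have : l ≤ 4 * m ^ 2 := by omega
        exact_mod_cast this
      have h5 : (2 * m / l : ℝ) ^ 2 ≤ Real.sin (Real.pi * m / l) ^ 2 :=
        pow_le_pow_left₀ (by positivity) hsin 2
      have h6 : 1 ≤ l * (2 * m / l : ℝ) ^ 2 := by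
        rw [div_pow, mul_div_assoc', le_div_iff₀ (by positivity)]; nlinarith
      nlinarith

/-- Zeros of a real function located by sign changes. -/
lemma exists_finset_zeros {f : ℝ → ℝ} {a b : ℝ} (hf : ContinuousOn f (Set.Ioc a b)) {N : ℕ}
    {x : ℕ → ℝ} (ha : ∀ i ≤ N, a < x i) (hb : ∀ i ≤ N, x i ≤ b) (hx : ∀ i < N, x i < x (i + 1))
    (hs : ∀ i < N, f (x i) * f (x (i + 1)) < 0) :
    ∃ T : Finset ℝ, T.card = N ∧ ∀ t ∈ T, t ∈ Set.Ioo a b ∧ f t = 0 := by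
  have key : ∀ i : Fin N, ∃ t ∈ Set.Ioo (x i) (x (i + 1)), f t = 0 := by
    intro i
    have hi := i.2
    have hc : ContinuousOn f (Set.Icc (x i) (x (i + 1))) := hf.mono fun t ht =>
      ⟨(ha i hi.le).trans_le ht.1, ht.2.trans (hb _ hi)⟩
    have hsi := hs i hi
    rcases mul_neg_iff.1 hsi with ⟨h1, h2⟩ | ⟨h1, h2⟩
    · exact intermediate_value_Ioo' (hx i hi).le hc ⟨h2, h1⟩
    · exact intermediate_value_Ioo (hx i hi).le hc ⟨h1, h2⟩
  choose t ht h0 using key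
  have hmono : ∀ i j, i ≤ j → j ≤ N → x i ≤ x j := by
    intro i j hij
    induction j, hij using Nat.le_induction with
    | base => intro _; exact le_rfl
    | succ j hij ih => intro hj; exact (ih (by omega)).trans (hx j (by omega)).le
  have hlt : ∀ i j : Fin N, i < j → t i < t j := fun i j hij =>
    ((ht i).2.trans_le (hmono _ _ hij j.2.le)).trans (ht j).1
  have hinj : Function.Injective t := by
    intro i j hij
    rcases lt_trichotomy i j with h | h | h
    · exact absurd hij (hlt i j h).ne
    · exact h
    · exact absurd hij (hlt j i h).ne'
  refine ⟨Finset.univ.image t, by rw [Finset.card_image_of_injective _ hinj]; simp, ?_⟩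
  intro s hs'
  obtain ⟨i, -, rfl⟩ := Finset.mem_image.1 hs'
  exact ⟨⟨(ha i i.2.le).trans (ht i).1, (ht i).2.trans_le (hb _ i.2)⟩, h0 i⟩

/-- Zeros located by the signs at sample points and the sign near the left end point. -/
lemma exists_finset_zeros_of_eventually {f : ℝ → ℝ} {a b : ℝ} (hf : ContinuousOn f (Set.Ioc a b))
    {N : ℕ} {x : ℕ → ℝ} (ha : ∀ i ≤ N, a < x i) (hb : ∀ i ≤ N, x i ≤ b)
    (hx : ∀ i < N, x i < x (i + 1)) {p q : ℕ}
    (hs : ∀ i ≤ N, 0 < (-1) ^ (p + i) * f (x i)) (hq : ∀ᶠ t in 𝓝[>] a, 0 < (-1) ^ q * f t) :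
    ∃ T : Finset ℝ, T.card = N + (if (p + q) % 2 = 0 then 0 else 1) ∧
      ∀ t ∈ T, t ∈ Set.Ioo a b ∧ f t = 0 := by
  have hmul : ∀ u v : ℝ, ∀ i j : ℕ, 0 < (-1) ^ i * u → 0 < (-1) ^ j * v → (i + j) % 2 = 1 →
      u * v < 0 := by
    intro u v i j hu hv hij
    have h1 := mul_pos hu hv
    have h2 : (-1 : ℝ) ^ i * u * ((-1) ^ j * v) = (-1) ^ (i + j) * (u * v) := by rw [pow_add]; ring
    rw [h2, Odd.neg_one_pow (Nat.odd_iff.2 hij)] at h1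
    linarith
  split_ifs with h
  · exact exists_finset_zeros hf ha hb hx fun i hi =>
      hmul _ _ _ _ (hs i hi.le) (hs (i + 1) hi) (by omega)
  · obtain ⟨t, ht1, ht2⟩ := (hq.and (Ioo_mem_nhdsGT (ha 0 (Nat.zero_le _)))).exists
    refine exists_finset_zeros (x := fun i => if i = 0 then t else x (i - 1)) hf ?_ ?_ ?_ ?_
    · intro i hi
      rcases i with - | i
      · simpa using ht2.1
      · simpa using ha i (by omega)
    · intro i hi
      rcases i with - | i
      · simpa using (ht2.2.trans_le (hb 0 (Nat.zero_le _))).le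
      · simpa using hb i (by omega)
    · intro i hi
      rcases i with - | i
      · simpa using ht2.2
      · simpa using hx i (by omega)
    · intro i hi
      rcases i with - | i
      · simpa using hmul _ _ _ _ ht1 (hs 0 (Nat.zero_le _)) (by omega)
      · simpa using hmul _ _ _ _ (hs i (by omega)) (hs (i + 1) (by omega)) (by omega)

end EisensteinZeros

/-! ### Taylor expansion at ρ in the disc coordinate -/

namespace EisensteinZeros

open Filter Topology EisensteinSeries ModularForm UpperHalfPlane

/-- The lattice sums `½ ∑ v̄^m v^{-k-m}` over the primitive vectors of `ℤρ + ℤ`. -/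
noncomputable def rhoSum (m k : ℕ) : ℂ :=
  1 / 2 * ∑' v : gammaSet 1 1 0,
    (starRingEnd ℂ (latVec rho v)) ^ m * ((latVec rho v)⁻¹) ^ (k + m)

/-- `E_k` in the disc coordinate `u = (z - ρ) / (z - ρ̄)`. -/
noncomputable def discE (k : ℕ) (u : ℂ) : ℂ :=
  1 / 2 * ∑' v : gammaSet 1 1 0, ((latVec rho v - starRingEnd ℂ (latVec rho v) * u)⁻¹) ^ k

/-- Every lattice vector satisfies v(z)(1 - u) = v(ρ) - conj(v(ρ))·u, because z solves this for the
vectors z and 1. -/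
lemma E_eq_discE {k : ℕ} (hk : 3 ≤ k) {z : ℍ} {u : ℂ} (hu : 1 - u ≠ 0)
    (hz : (z : ℂ) * (1 - u) = rho - starRingEnd ℂ rho * u) :
    E hk z = (1 - u) ^ k * discE k u := by
  rw [E_apply_eq_tsum, discE, mul_left_comm, ← tsum_mul_left (a := (1 - u) ^ k)
    (f := fun v : gammaSet 1 1 0 => ((latVec rho v - starRingEnd ℂ (latVec rho v) * u)⁻¹) ^ k)]
  congr 1
  refine tsum_congr fun v => ?_
  have h : latVec rho v - starRingEnd ℂ (latVec rho v) * u = latVec z v * (1 - u) := by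
    simp only [latVec, map_add, map_mul, map_intCast]
    linear_combination (-(v.1 0 : ℂ)) * hz
  rw [h, mul_inv, mul_pow, ← mul_assoc, mul_comm ((1 - u) ^ k), mul_assoc, ← mul_pow,
    mul_inv_cancel₀ hu, one_pow, mul_one]

lemma norm_term_rhoSum (m k : ℕ) (v : Fin 2 → ℤ) :
    ‖(starRingEnd ℂ (latVec rho v)) ^ m * ((latVec rho v)⁻¹) ^ (k + m)‖ =
      ‖((latVec rho v)⁻¹) ^ k‖ ∨ latVec rho v = 0 := by
  rcases eq_or_ne (latVec rho v) 0 with h | h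
  · exact Or.inr h
  · left
    have h' := norm_ne_zero_iff.2 h
    rw [norm_mul, norm_pow, norm_pow, norm_pow, Complex.norm_conj, norm_inv, pow_add,
      mul_left_comm, ← mul_pow, mul_inv_cancel₀ h', one_pow, mul_one]

lemma norm_term_rhoSum_eq {m k : ℕ} (v : gammaSet 1 1 0) :
    ‖(starRingEnd ℂ (latVec rho v)) ^ m * ((latVec rho v)⁻¹) ^ (k + m)‖ =
      ‖((latVec rho v)⁻¹) ^ k‖ :=
  (norm_term_rhoSum m k v).resolve_right (latVec_ne_zero _ (ne_zero_of_mem_gammaSet v.2))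

lemma summable_rhoSum (m : ℕ) {k : ℕ} (hk : 3 ≤ k) : Summable fun v : gammaSet 1 1 0 =>
    (starRingEnd ℂ (latVec rho v)) ^ m * ((latVec rho v)⁻¹) ^ (k + m) := by
  refine Summable.of_norm_bounded ((summable_norm_latVec hk rho).subtype _) fun v => ?_
  exact (norm_term_rhoSum_eq v).le

lemma exists_norm_inv_pow_sub_le (k : ℕ) : ∃ C : ℝ, 0 ≤ C ∧ ∀ w : ℂ, ‖w‖ ≤ 1 / 2 →
    ‖((1 - w)⁻¹) ^ k - (1 + k * w + k * (k + 1) / 2 * w ^ 2)‖ ≤ C * ‖w‖ ^ 3 := by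
  induction k with
  | zero => exact ⟨0, le_rfl, fun w _ => by simp⟩
  | succ k ih =>
    obtain ⟨C, hC, h⟩ := ih
    refine ⟨2 * (C + (k + 1) * (k + 2) / 2), by positivity, fun w hw => ?_⟩
    have h1 : 1 / 2 ≤ ‖1 - w‖ := by
      have := norm_sub_norm_le 1 w
      rw [norm_one] at this
      linarith
    have h0 : 1 - w ≠ 0 := by rw [← norm_pos_iff]; linarith
    have h2 : ‖(1 - w)⁻¹‖ ≤ 2 := by
      rw [norm_inv, inv_le_comm₀ (by linarith) (by norm_num)]; linarith
    have he : ((1 - w)⁻¹) ^ (k + 1) - (1 + ((k + 1 : ℕ) : ℂ) * w +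
        ((k + 1 : ℕ) : ℂ) * (((k + 1 : ℕ) : ℂ) + 1) / 2 * w ^ 2) =
        (1 - w)⁻¹ * ((((1 - w)⁻¹) ^ k - (1 + k * w + k * (k + 1) / 2 * w ^ 2)) +
          (k + 1) * (k + 2) / 2 * w ^ 3) := by
      rw [pow_succ]
      push_cast
      linear_combination (1 + ((k : ℂ) + 1) * w + ((k : ℂ) + 1) * ((k : ℂ) + 1 + 1) / 2 * w ^ 2) *
        inv_mul_cancel₀ h0
    rw [he, norm_mul]
    have h3 : ‖((k : ℂ) + 1) * (k + 2) / 2 * w ^ 3‖ = (k + 1) * (k + 2) / 2 * ‖w‖ ^ 3 := by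
      have : ((k : ℂ) + 1) * (k + 2) / 2 = (((k + 1) * (k + 2) / 2 : ℝ) : ℂ) := by push_cast; ring
      rw [this, norm_mul, Complex.norm_real, Real.norm_of_nonneg (by positivity), norm_pow]
    calc ‖(1 - w)⁻¹‖ * _ ≤ 2 * (C * ‖w‖ ^ 3 + (k + 1) * (k + 2) / 2 * ‖w‖ ^ 3) := by
          refine mul_le_mul h2 ((norm_add_le _ _).trans (add_le_add (h w hw) h3.le))
            (norm_nonneg _) (by norm_num)
      _ = _ := by ring

/-- Taylor expansion of `E_k` at `ρ` in the disc coordinate. -/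
lemma exists_norm_discE_sub_le {k : ℕ} (hk : 3 ≤ k) : ∃ C : ℝ, 0 ≤ C ∧ ∀ u : ℂ, ‖u‖ ≤ 1 / 2 →
    ‖discE k u - (rhoSum 0 k + k * rhoSum 1 k * u + k * (k + 1) / 2 * rhoSum 2 k * u ^ 2)‖ ≤
      C * ‖u‖ ^ 3 := by
  obtain ⟨C, hC, h⟩ := exists_norm_inv_pow_sub_le k
  have hS : Summable fun v : gammaSet 1 1 0 => ‖((latVec rho v)⁻¹) ^ k‖ :=
    (summable_norm_latVec hk rho).subtype (gammaSet 1 1 0)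
  refine ⟨1 / 2 * ((∑' v : gammaSet 1 1 0, ‖((latVec rho v)⁻¹) ^ k‖) * C), ?_, fun u hu => ?_⟩
  · have : 0 ≤ ∑' v : gammaSet 1 1 0, ‖((latVec rho v)⁻¹) ^ k‖ := tsum_nonneg fun _ => norm_nonneg _
    positivity
  set V : gammaSet 1 1 0 → ℂ := fun v => latVec rho v with hV
  have hV0 : ∀ v, V v ≠ 0 := fun v => latVec_ne_zero _ (ne_zero_of_mem_gammaSet v.2)
  have hs0 := summable_rhoSum 0 hk
  have hs1 := (summable_rhoSum 1 hk).mul_left (k * u)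
  have hs2 := (summable_rhoSum 2 hk).mul_left (k * (k + 1) / 2 * u ^ 2)
  have hbd : ∀ v, ‖((V v - starRingEnd ℂ (V v) * u)⁻¹) ^ k -
      ((starRingEnd ℂ (V v)) ^ 0 * ((V v)⁻¹) ^ (k + 0) +
        k * u * ((starRingEnd ℂ (V v)) ^ 1 * ((V v)⁻¹) ^ (k + 1)) +
        k * (k + 1) / 2 * u ^ 2 * ((starRingEnd ℂ (V v)) ^ 2 * ((V v)⁻¹) ^ (k + 2)))‖ ≤
      ‖((V v)⁻¹) ^ k‖ * (C * ‖u‖ ^ 3) := by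
    intro v
    set w := starRingEnd ℂ (V v) * (V v)⁻¹ * u with hw
    have hwn : ‖w‖ = ‖u‖ := by
      rw [hw, norm_mul, norm_mul, Complex.norm_conj, norm_inv,
        mul_inv_cancel₀ (norm_ne_zero_iff.2 (hV0 v)), one_mul]
    have := h w (by rw [hwn]; exact hu)
    rw [hwn] at this
    refine le_trans (le_of_eq ?_) (mul_le_mul_of_nonneg_left this (norm_nonneg _))
    rw [← norm_mul]
    congr 1
    have h1 : V v - starRingEnd ℂ (V v) * u = V v * (1 - w) := by
      rw [hw]; field_simp [hV0 v]
    rw [h1, mul_inv, mul_pow, hw]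
    ring
  have hD : Summable fun v => ((V v - starRingEnd ℂ (V v) * u)⁻¹) ^ k := by
    have h1 := Summable.of_norm_bounded (hS.mul_right (C * ‖u‖ ^ 3)) hbd
    have h2 := h1.add ((hs0.add hs1).add hs2)
    refine h2.congr fun v => ?_
    simp only [hV]; ring
  have hsum : ‖∑' v, (((V v - starRingEnd ℂ (V v) * u)⁻¹) ^ k -
      ((starRingEnd ℂ (V v)) ^ 0 * ((V v)⁻¹) ^ (k + 0) +
        k * u * ((starRingEnd ℂ (V v)) ^ 1 * ((V v)⁻¹) ^ (k + 1)) +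
        k * (k + 1) / 2 * u ^ 2 * ((starRingEnd ℂ (V v)) ^ 2 * ((V v)⁻¹) ^ (k + 2))))‖ ≤
      ∑' v, ‖((V v)⁻¹) ^ k‖ * (C * ‖u‖ ^ 3) :=
    tsum_of_norm_bounded (hS.mul_right (C * ‖u‖ ^ 3)).hasSum hbd
  rw [tsum_mul_right, hD.tsum_sub ((hs0.add hs1).add hs2), (hs0.add hs1).tsum_add hs2,
    hs0.tsum_add hs1, tsum_mul_left, tsum_mul_left] at hsum
  rw [discE, rhoSum, rhoSum, rhoSum]
  have e : ∀ A B0 B1 B2 a b : ℂ, 1 / 2 * A - (1 / 2 * B0 + k * (1 / 2 * B1) * a +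
      b * (1 / 2 * B2) * a ^ 2) = 1 / 2 * (A - (B0 + k * a * B1 + b * a ^ 2 * B2)) := by
    intros; ring
  have h12 : ‖(1 / 2 : ℂ)‖ = 1 / 2 := by norm_num
  rw [e, norm_mul, h12]
  refine (mul_le_mul_of_nonneg_left hsum (by norm_num)).trans (le_of_eq ?_)
  simp only [hV]
  ring

lemma latVec_rho_rotate (v : Fin 2 → ℤ) :
    latVec rho ![v 0 + v 1, -v 0] = rho * latVec rho v := by
  have := rho_sq
  simp only [latVec, Matrix.cons_val_zero, Matrix.cons_val_one]
  push_cast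
  linear_combination (-(v 0 : ℂ)) * this

/-- Multiplication by ρ permutes the primitive vectors of ℤρ + ℤ and multiplies the sum by ρ^{-(k +
2m)}, which is not 1 because ρ has order 6. -/
lemma rhoSum_eq_zero {m k : ℕ} (hk : 3 ≤ k) (he : Even k) (h : (k + 2 * m) % 6 ≠ 0) :
    rhoSum m k = 0 := by
  have hmem : ∀ v : Fin 2 → ℤ, v ∈ gammaSet 1 1 0 → ![v 0 + v 1, -v 0] ∈ gammaSet 1 1 0 := by
    intro v hv
    rw [mem_gammaSet_one] at hv ⊢
    obtain ⟨a, b, hab⟩ := hv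
    exact ⟨b, b - a, by simp; linarith⟩
  have hmem' : ∀ v : Fin 2 → ℤ, v ∈ gammaSet 1 1 0 → ![-v 1, v 0 + v 1] ∈ gammaSet 1 1 0 := by
    intro v hv
    rw [mem_gammaSet_one] at hv ⊢
    obtain ⟨a, b, hab⟩ := hv
    exact ⟨a - b, a, by simp; linarith⟩
  let e : gammaSet 1 1 0 ≃ gammaSet 1 1 0 :=
    { toFun v := ⟨![v.1 0 + v.1 1, -v.1 0], hmem v v.2⟩
      invFun v := ⟨![-v.1 1, v.1 0 + v.1 1], hmem' v v.2⟩
      left_inv v := by ext i; fin_cases i <;> simp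
      right_inv v := by ext i; fin_cases i <;> simp }
  have hr0 : (rho : ℂ) ≠ 0 := ne_zero rho
  have hconj : starRingEnd ℂ (rho : ℂ) = (rho : ℂ)⁻¹ := by
    rw [Complex.inv_def, normSq_rho]; simp
  have key : rhoSum m k = ((rho : ℂ)⁻¹) ^ (k + 2 * m) * rhoSum m k := by
    conv_lhs => rw [rhoSum, ← e.tsum_eq fun v : gammaSet 1 1 0 =>
        (starRingEnd ℂ (latVec rho v)) ^ m * ((latVec rho v)⁻¹) ^ (k + m)]
    rw [rhoSum, mul_left_comm, ← tsum_mul_left (a := ((rho : ℂ)⁻¹) ^ (k + 2 * m))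
      (f := fun v : gammaSet 1 1 0 =>
        (starRingEnd ℂ (latVec rho v)) ^ m * ((latVec rho v)⁻¹) ^ (k + m))]
    congr 1
    refine tsum_congr fun v => ?_
    have : latVec rho (e v) = rho * latVec rho v := latVec_rho_rotate v
    rw [this, map_mul, hconj, mul_pow, mul_inv, mul_pow]
    ring
  have h3 := rho_pow_three
  have h2 := rho_sq
  have hne : ((rho : ℂ)⁻¹) ^ (k + 2 * m) ≠ 1 := by
    rw [inv_pow, Ne, inv_eq_one]
    obtain ⟨p, rfl⟩ := he
    intro hcon
    have him : ((rho : ℂ)).im ≠ 0 := by rw [coe_im]; exact rho.im_pos.ne'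
    obtain ⟨q, hq | hq⟩ : ∃ q, p + p + 2 * m = 6 * q + 2 ∨ p + p + 2 * m = 6 * q + 4 :=
      ⟨(p + p + 2 * m) / 6, by omega⟩
    · rw [hq, pow_add, show 6 * q = 3 * (2 * q) by ring, pow_mul, h3, pow_mul,
        neg_one_sq, one_pow, one_mul] at hcon
      have h5 : (rho : ℂ) = 2 := by
        rw [h2] at hcon
        linear_combination hcon
      apply him; rw [h5]; simp
    · rw [hq, pow_add, show 6 * q = 3 * (2 * q) by ring, pow_mul, h3, pow_mul,
        neg_one_sq, one_pow, one_mul] at hcon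
      have h5 : (rho : ℂ) = -1 := by
        rw [show (4 : ℕ) = 3 + 1 by rfl, pow_succ, h3] at hcon
        linear_combination -hcon
      apply him; rw [h5]; simp
  have : (((rho : ℂ)⁻¹) ^ (k + 2 * m) - 1) * rhoSum m k = 0 := by linear_combination -key
  exact (mul_eq_zero.1 this).resolve_left (sub_ne_zero.2 hne)

end EisensteinZeros

/-! ### Numerical values of the Taylor coefficients at ρ -/

namespace EisensteinZeros

open Filter Topology EisensteinSeries ModularForm UpperHalfPlane

lemma norm_sq_latVec_rho (v : Fin 2 → ℤ) :
    ‖latVec rho v‖ ^ 2 = ((v 0 ^ 2 + v 0 * v 1 + v 1 ^ 2 : ℤ) : ℝ) := by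
  have h1 : rho.re = 1 / 2 := rfl
  have h2 : rho.im = √3 / 2 := rfl
  have h3 : √3 ^ 2 = 3 := Real.sq_sqrt (by norm_num)
  rw [normSq_latVec, h1, h2]
  push_cast
  linear_combination ((v 0 : ℝ) ^ 2 / 4) * h3

/-- The primitive vectors of norm `1` and `√3` in `ℤρ + ℤ`. -/
def mediumVecs : Finset (Fin 2 → ℤ) :=
  {![0, 1], ![0, -1], ![1, 0], ![-1, 0], ![1, -1], ![-1, 1],
    ![1, 1], ![-1, -1], ![-2, 1], ![2, -1], ![1, -2], ![-1, 2]}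

lemma mediumVecs_subset : (mediumVecs : Set (Fin 2 → ℤ)) ⊆ gammaSet 1 1 0 := by
  intro v hv
  rw [Finset.mem_coe] at hv
  rw [mem_gammaSet_one, Int.isCoprime_iff_gcd_eq_one]
  revert v
  decide

lemma eq_vec_of_eq {v : Fin 2 → ℤ} {c d : ℤ} (hc : v 0 = c) (hd : v 1 = d) : v = ![c, d] := by
  ext i; fin_cases i <;> simp [hc, hd]

lemma three_le_of_notMem {v : Fin 2 → ℤ} (hv : v ∈ gammaSet 1 1 0)
    (hs : v ∉ (shortVecs : Set (Fin 2 → ℤ))) : 3 ≤ v 0 ^ 2 + v 0 * v 1 + v 1 ^ 2 := by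
  by_contra! hcon
  have h0 := ne_zero_of_mem_gammaSet hv
  obtain ⟨c, hc⟩ : ∃ c, v 0 = c := ⟨_, rfl⟩
  obtain ⟨d, hd⟩ : ∃ d, v 1 = d := ⟨_, rfl⟩
  have hve := eq_vec_of_eq hc hd
  rw [hc, hd] at hcon
  have h1 : c ≤ 1 := by nlinarith [sq_nonneg (c + 2 * d)]
  have h2 : -1 ≤ c := by nlinarith [sq_nonneg (c + 2 * d)]
  have h3 : d ≤ 1 := by nlinarith [sq_nonneg (d + 2 * c)]
  have h4 : -1 ≤ d := by nlinarith [sq_nonneg (d + 2 * c)]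
  subst hve
  clear hc hd
  rw [Finset.mem_coe] at hs
  interval_cases c <;> interval_cases d <;> revert hcon h0 hs <;> decide

lemma four_le_of_notMem {v : Fin 2 → ℤ} (hv : v ∈ gammaSet 1 1 0)
    (hs : v ∉ (mediumVecs : Set (Fin 2 → ℤ))) : 4 ≤ v 0 ^ 2 + v 0 * v 1 + v 1 ^ 2 := by
  by_contra! hcon
  have h0 := ne_zero_of_mem_gammaSet hv
  obtain ⟨c, hc⟩ : ∃ c, v 0 = c := ⟨_, rfl⟩
  obtain ⟨d, hd⟩ : ∃ d, v 1 = d := ⟨_, rfl⟩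
  have hve := eq_vec_of_eq hc hd
  rw [hc, hd] at hcon
  have h1 : c ≤ 2 := by nlinarith [sq_nonneg (c + 2 * d)]
  have h2 : -2 ≤ c := by nlinarith [sq_nonneg (c + 2 * d)]
  have h3 : d ≤ 2 := by nlinarith [sq_nonneg (d + 2 * c)]
  have h4 : -2 ≤ d := by nlinarith [sq_nonneg (d + 2 * c)]
  subst hve
  clear hc hd
  rw [Finset.mem_coe] at hs
  interval_cases c <;> interval_cases d <;> revert hcon h0 hs <;> decide

/-- Writing conj(v) as n/v with n = |v|² leaves n^m v^{-(k + 2m)}, and the exponent is a multiple of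
6. -/
lemma term_rhoSum_eq {m k e : ℕ} (h : k + 2 * m = 6 * e) {v : Fin 2 → ℤ} {n s : ℂ}
    (hn : latVec rho v * starRingEnd ℂ (latVec rho v) = n) (hv : latVec rho v ≠ 0)
    (hs : latVec rho v ^ 6 = s) :
    (starRingEnd ℂ (latVec rho v)) ^ m * ((latVec rho v)⁻¹) ^ (k + m) = n ^ m * (s⁻¹) ^ e := by
  have h1 : starRingEnd ℂ (latVec rho v) = n * (latVec rho v)⁻¹ := by
    rw [← hn]; field_simp
  rw [h1, mul_pow, mul_assoc, ← pow_add, show m + (k + m) = 6 * e by omega, pow_mul, inv_pow,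
    hs]

lemma norm_rhoSum_sub_sum_le {S : Finset (Fin 2 → ℤ)}
    (hS : (S : Set (Fin 2 → ℤ)) ⊆ gammaSet 1 1 0) {μ : ℝ} (hμ : 0 < μ)
    (hSμ : ∀ v ∈ gammaSet 1 1 0, v ∉ (S : Set (Fin 2 → ℤ)) → μ ≤ ‖latVec rho v‖) (m : ℕ) {k : ℕ}
    (hk : 4 ≤ k) :
    ‖rhoSum m k - 1 / 2 * ∑ v ∈ S, (starRingEnd ℂ (latVec rho v)) ^ m *
      ((latVec rho v)⁻¹) ^ (k + m)‖ ≤ tailConst * (μ⁻¹) ^ (k - 4) := by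
  have hle : ∀ v : Fin 2 → ℤ, ‖(starRingEnd ℂ (latVec rho v)) ^ m *
      ((latVec rho v)⁻¹) ^ (k + m)‖ ≤ ‖((latVec rho v)⁻¹) ^ k‖ := by
    intro v
    rcases norm_term_rhoSum m k v with h | h
    · exact h.le
    · rw [h, inv_zero, zero_pow (by omega : k + m ≠ 0)]; simp
  have hsk := summable_norm_latVec (k := k) (by omega) rho
  have hs : Summable fun v => ‖(starRingEnd ℂ (latVec rho v)) ^ m *
      ((latVec rho v)⁻¹) ^ (k + m)‖ :=
    Summable.of_nonneg_of_le (fun _ => norm_nonneg _) hle hsk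
  rw [rhoSum, tsum_gammaSet_eq_add hs hS, Finset.tsum_subtype' S fun v =>
    (starRingEnd ℂ (latVec rho v)) ^ m * ((latVec rho v)⁻¹) ^ (k + m), ← mul_sub,
    add_sub_cancel_left, norm_mul]
  have h12 : ‖(1 / 2 : ℂ)‖ = 1 / 2 := by norm_num
  rw [h12]
  have hre : |rho.re| ≤ 1 := by
    have : rho.re = 1 / 2 := rfl
    rw [this]; norm_num
  have him : 1 / 2 ≤ rho.im := by
    have h1 : rho.im = √3 / 2 := rfl
    have : 1 ≤ √3 := Real.one_le_sqrt.2 (by norm_num)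
    linarith
  have hb := tsum_subtype_latVec_le hre him hμ (s := gammaSet 1 1 0 \ S)
    (fun v hv => hSμ v hv.1 hv.2) (k - 4)
  rw [Nat.sub_add_cancel hk] at hb
  have hn : ‖∑' v : (gammaSet 1 1 0 \ S : Set (Fin 2 → ℤ)), (starRingEnd ℂ (latVec rho v)) ^ m *
      ((latVec rho v)⁻¹) ^ (k + m)‖ ≤
      ∑' v : (gammaSet 1 1 0 \ S : Set (Fin 2 → ℤ)), ‖((latVec rho v)⁻¹) ^ k‖ :=
    tsum_of_norm_bounded (hsk.subtype _).hasSum fun v => hle v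
  have := (norm_nonneg _).trans hn
  linarith

lemma latVec_rho_mul_conj (v : Fin 2 → ℤ) : latVec rho v * starRingEnd ℂ (latVec rho v) =
    ((v 0 ^ 2 + v 0 * v 1 + v 1 ^ 2 : ℤ) : ℂ) := by
  rw [Complex.mul_conj, Complex.normSq_eq_norm_sq, norm_sq_latVec_rho]
  norm_cast

lemma term_of_mem_shortVecs {m k : ℕ} (h : (k + 2 * m) % 6 = 0) {v : Fin 2 → ℤ}
    (hv : v ∈ shortVecs) :
    (starRingEnd ℂ (latVec rho v)) ^ m * ((latVec rho v)⁻¹) ^ (k + m) = 1 := by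
  have hn : v 0 ^ 2 + v 0 * v 1 + v 1 ^ 2 = 1 := by revert v; decide
  have hr := rho_sq
  have h6 : latVec rho v ^ 6 = 1 := by
    have h3 := rho_pow_three
    have h62 : (rho : ℂ) ^ 6 = 1 := by linear_combination ((rho : ℂ) ^ 3 - 1) * h3
    have h64 : ((rho : ℂ) - 1) ^ 6 = 1 := by
      rw [← hr]; linear_combination ((rho : ℂ) ^ 6 + 1) * h62
    have e1 : (-(rho : ℂ) + 1) ^ 6 = 1 := by linear_combination h64
    simp only [shortVecs, Finset.mem_insert, Finset.mem_singleton] at hv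
    rcases hv with rfl | rfl | rfl | rfl | rfl | rfl <;> simp only [latVec, Matrix.cons_val_zero,
      Matrix.cons_val_one] <;> push_cast
    · norm_num
    · norm_num
    · linear_combination h62
    · linear_combination h62
    · linear_combination h64
    · linear_combination e1
  have hmul := latVec_rho_mul_conj v
  rw [hn] at hmul
  rw [term_rhoSum_eq (e := (k + 2 * m) / 6) (by omega) hmul
    (fun h0 => by rw [h0] at h6; norm_num at h6) h6]
  simp

/-- The first approximation of the coefficients at `ρ`. -/
lemma norm_rhoSum_sub_three_le {m k : ℕ} (hk : 4 ≤ k) (h : (k + 2 * m) % 6 = 0) :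
    ‖rhoSum m k - 3‖ ≤ tailConst * ((√3)⁻¹) ^ (k - 4) := by
  have := norm_rhoSum_sub_sum_le shortVecs_subset (μ := √3) (by positivity)
    (fun v hv hs => by
      apply Real.sqrt_le_iff.2 ⟨norm_nonneg _, ?_⟩
      rw [norm_sq_latVec_rho]
      exact_mod_cast three_le_of_notMem hv hs) m hk
  rw [Finset.sum_congr rfl fun v hv => term_of_mem_shortVecs h hv, Finset.sum_const,
    show shortVecs.card = 6 by decide] at this
  norm_num at this ⊢
  exact this

/-- The second approximation of the coefficients at `ρ`. -/
lemma norm_rhoSum_sub_le {m k : ℕ} (hk : 4 ≤ k) (h : (k + 2 * m) % 6 = 0) :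
    ‖rhoSum m k - (3 + 3 * 3 ^ m * ((-27)⁻¹) ^ ((k + 2 * m) / 6))‖ ≤
      tailConst * (2⁻¹) ^ (k - 4) := by
  have hb := norm_rhoSum_sub_sum_le mediumVecs_subset (μ := 2) (by positivity)
    (fun v hv hs => by
      apply le_of_sq_le_sq _ (norm_nonneg _)
      rw [norm_sq_latVec_rho]
      have := four_le_of_notMem hv hs
      have : (4 : ℝ) ≤ ((v 0 ^ 2 + v 0 * v 1 + v 1 ^ 2 : ℤ) : ℝ) := by exact_mod_cast this
      linarith) m hk
  have hsplit : mediumVecs = shortVecs ∪ (mediumVecs \ shortVecs) := by decide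
  have hdisj : Disjoint shortVecs (mediumVecs \ shortVecs) := by decide
  have hterm : ∀ v ∈ mediumVecs \ shortVecs, (starRingEnd ℂ (latVec rho v)) ^ m *
      ((latVec rho v)⁻¹) ^ (k + m) = 3 ^ m * ((-27)⁻¹) ^ ((k + 2 * m) / 6) := by
    intro v hv
    have hn : v 0 ^ 2 + v 0 * v 1 + v 1 ^ 2 = 3 := by revert v; decide
    have hr := rho_sq
    have h3 := rho_pow_three
    -- The vectors of norm √3 are √3 times odd powers of e^{iπ/6}, so all their sixth powers agree.
    have h6 : latVec rho v ^ 6 = -27 := by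
      have hv' : v = ![1, 1] ∨ v = ![-1, -1] ∨ v = ![-2, 1] ∨ v = ![2, -1] ∨ v = ![1, -2] ∨
          v = ![-1, 2] := by revert v; decide
      have e1 : ((rho : ℂ) + 1) ^ 2 = 3 * rho := by linear_combination hr
      have e2 : (-2 * (rho : ℂ) + 1) ^ 2 = -3 := by linear_combination 4 * hr
      have e3 : ((rho : ℂ) - 2) ^ 2 = -3 * rho ^ 2 := by linear_combination 4 * hr
      have f1 : ((rho : ℂ) + 1) ^ 6 = -27 := by
        rw [show (6 : ℕ) = 2 * 3 by rfl, pow_mul, e1]; linear_combination 27 * h3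
      have f2 : (-2 * (rho : ℂ) + 1) ^ 6 = -27 := by
        rw [show (6 : ℕ) = 2 * 3 by rfl, pow_mul, e2]; norm_num
      have f3 : ((rho : ℂ) - 2) ^ 6 = -27 := by
        rw [show (6 : ℕ) = 2 * 3 by rfl, pow_mul, e3]
        linear_combination (-27 * ((rho : ℂ) ^ 3 - 1)) * h3
      rcases hv' with rfl | rfl | rfl | rfl | rfl | rfl <;> simp only [latVec,
        Matrix.cons_val_zero, Matrix.cons_val_one] <;> push_cast
      · linear_combination f1
      · linear_combination f1
      · linear_combination f2
      · linear_combination f2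
      · linear_combination f3
      · linear_combination f3
    have hmul := latVec_rho_mul_conj v
    rw [hn] at hmul
    rw [term_rhoSum_eq (e := (k + 2 * m) / 6) (by omega) hmul
      (fun h0 => by rw [h0] at h6; norm_num at h6) h6]
    norm_num
  rw [hsplit, Finset.sum_union hdisj,
    Finset.sum_congr rfl fun v hv => term_of_mem_shortVecs h hv, Finset.sum_const,
    Finset.sum_congr rfl hterm, Finset.sum_const, show shortVecs.card = 6 by decide,
    show (mediumVecs \ shortVecs).card = 6 by decide] at hb
  refine le_trans (le_of_eq ?_) hb
  congr 2
  simp only [nsmul_eq_mul]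
  push_cast
  ring

end EisensteinZeros

/-! ### Nonvanishing of the leading coefficient of Δ at ρ -/

namespace EisensteinZeros

open Filter Topology EisensteinSeries ModularForm UpperHalfPlane

/-- The binomial factor of the leading Taylor coefficient of `E_k` at `ρ`. -/
noncomputable def rhoBinom (k : ℕ) : ℝ :=
  if k % 3 = 0 then 1 else if k % 3 = 1 then k else k * (k + 1) / 2

/-- The coefficient of `u^{k % 3}` in the expansion of `E_k` at `ρ`. -/
noncomputable def rhoCoef (k : ℕ) : ℂ := rhoBinom k * rhoSum (k % 3) k

/-- The coefficient of `u^{(k + ℓ) % 3}` in the expansion of `Δ_{k,ℓ}` at `ρ`. -/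
noncomputable def deltaCoef (k l : ℕ) : ℂ :=
  (if k % 3 + l % 3 < 3 then rhoCoef k * rhoCoef l else 0) - rhoCoef (k + l)

/-- For even k, k + 2m ≡ 0 mod 6 means m ≡ k mod 3, so exactly one coefficient of degree at most 2
survives the sixfold symmetry. -/
lemma exists_norm_discE_sub_rhoCoef_le {k : ℕ} (hk : 3 ≤ k) (he : Even k) :
    ∃ C : ℝ, 0 ≤ C ∧ ∀ u : ℂ, ‖u‖ ≤ 1 / 2 →
      ‖discE k u - rhoCoef k * u ^ (k % 3)‖ ≤ C * ‖u‖ ^ 3 := by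
  obtain ⟨C, hC, h⟩ := exists_norm_discE_sub_le hk
  refine ⟨C, hC, fun u hu => ?_⟩
  refine le_trans (le_of_eq ?_) (h u hu)
  congr 2
  obtain ⟨p, hp⟩ := he
  rcases (by omega : k % 3 = 0 ∨ k % 3 = 1 ∨ k % 3 = 2) with h3 | h3 | h3
  · rw [rhoCoef, rhoBinom, h3, rhoSum_eq_zero (m := 1) hk ⟨p, hp⟩ (by omega),
      rhoSum_eq_zero (m := 2) hk ⟨p, hp⟩ (by omega)]
    simp
  · rw [rhoCoef, rhoBinom, h3, rhoSum_eq_zero (m := 0) hk ⟨p, hp⟩ (by omega),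
      rhoSum_eq_zero (m := 2) hk ⟨p, hp⟩ (by omega)]
    simp
  · rw [rhoCoef, rhoBinom, h3, rhoSum_eq_zero (m := 0) hk ⟨p, hp⟩ (by omega),
      rhoSum_eq_zero (m := 1) hk ⟨p, hp⟩ (by omega)]
    simp

lemma exists_norm_disc_delta_sub_le {k l : ℕ} (hk : 3 ≤ k) (hl : 3 ≤ l) (hke : Even k)
    (hle : Even l) : ∃ C : ℝ, 0 ≤ C ∧ ∀ u : ℂ, ‖u‖ ≤ 1 / 2 →
      ‖discE k u * discE l u - discE (k + l) u - deltaCoef k l * u ^ ((k + l) % 3)‖ ≤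
        C * ‖u‖ ^ 3 := by
  obtain ⟨C1, hC1, h1⟩ := exists_norm_discE_sub_rhoCoef_le hk hke
  obtain ⟨C2, hC2, h2⟩ := exists_norm_discE_sub_rhoCoef_le hl hle
  obtain ⟨C3, hC3, h3⟩ := exists_norm_discE_sub_rhoCoef_le (k := k + l) (by omega) (hke.add hle)
  set a := rhoCoef k with ha
  set b := rhoCoef l with hb
  set i := k % 3
  set j := l % 3
  refine ⟨‖a‖ * C2 + ‖b‖ * C1 + C1 * C2 + C3 + ‖a‖ * ‖b‖, by positivity, fun u hu => ?_⟩
  set r := discE k u - a * u ^ i with hr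
  set s := discE l u - b * u ^ j with hs
  set t := discE (k + l) u - rhoCoef (k + l) * u ^ ((k + l) % 3) with ht
  have hr' := h1 u hu
  have hs' := h2 u hu
  have ht' := h3 u hu
  rw [← hr] at hr'
  rw [← hs] at hs'
  rw [← ht] at ht'
  have hu1 : ‖u‖ ≤ 1 := by linarith
  have hp : ∀ n, ‖u ^ n‖ ≤ 1 := fun n => by
    rw [norm_pow]; exact pow_le_one₀ (norm_nonneg _) hu1
  have hE : ∃ e : ℂ, ‖e‖ ≤ ‖a‖ * ‖b‖ * ‖u‖ ^ 3 ∧ discE k u * discE l u - discE (k + l) u -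
      deltaCoef k l * u ^ ((k + l) % 3) = a * u ^ i * s + r * (b * u ^ j) + r * s - t + e := by
    rcases lt_or_ge (i + j) 3 with hij | hij
    · refine ⟨0, by rw [norm_zero]; positivity, ?_⟩
      have hm : (k + l) % 3 = i + j := by omega
      rw [deltaCoef, if_pos hij, ht, hr, hs, ← ha, ← hb, hm, pow_add]
      ring
    · refine ⟨a * b * u ^ (i + j), ?_, ?_⟩
      · rw [norm_mul, norm_mul, norm_pow]
        exact mul_le_mul_of_nonneg_left (pow_le_pow_of_le_one (norm_nonneg _) hu1 hij)
          (by positivity)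
      · rw [deltaCoef, if_neg (by omega), ht, hr, hs, pow_add]
        ring
  obtain ⟨e, he, heq⟩ := hE
  rw [heq]
  have hu3 : ‖u‖ ^ 3 ≤ 1 := pow_le_one₀ (norm_nonneg _) hu1
  have t1 : ‖a * u ^ i * s‖ ≤ ‖a‖ * (C2 * ‖u‖ ^ 3) := by
    rw [norm_mul, norm_mul]
    exact mul_le_mul (mul_le_of_le_one_right (norm_nonneg _) (hp _)) hs' (norm_nonneg _)
      (norm_nonneg _)
  have t2 : ‖r * (b * u ^ j)‖ ≤ C1 * ‖u‖ ^ 3 * ‖b‖ := by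
    rw [norm_mul, norm_mul]
    exact mul_le_mul hr' (mul_le_of_le_one_right (norm_nonneg _) (hp _)) (by positivity)
      (by positivity)
  have t3 : ‖r * s‖ ≤ C1 * (C2 * ‖u‖ ^ 3) := by
    rw [norm_mul]
    exact mul_le_mul (hr'.trans (mul_le_of_le_one_right hC1 hu3)) hs' (norm_nonneg _) hC1
  have t4 := norm_add_le (a * u ^ i * s + r * (b * u ^ j) + r * s - t) e
  have t5 := norm_sub_le (a * u ^ i * s + r * (b * u ^ j) + r * s) t
  have t6 : ‖a * u ^ i * s + r * (b * u ^ j) + r * s‖ ≤ _ := norm_add₃_le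
  linarith

/-- Writing A + 1 = 3B gives AB = M² with A and B coprime, so A would be a square congruent to 2 mod
3. -/
lemma sq_ne_of_mod_three {A M : ℕ} (hA : A % 3 = 2) : A * (A + 1) ≠ 3 * M ^ 2 := by
  intro h
  obtain ⟨B, hB⟩ : 3 ∣ A + 1 := by omega
  rw [hB] at h
  have h2 : A * B = M ^ 2 := by nlinarith
  have hcop : Nat.Coprime A B := by
    have h1 : Nat.Coprime A (A + 1) := by simp
    rw [hB] at h1
    exact h1.coprime_mul_left_right
  obtain ⟨b, hb⟩ := Int.sq_of_gcd_eq_one (a := A) (b := B) (c := M)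
    (by rw [Int.gcd_natCast_natCast]; exact hcop) (by exact_mod_cast h2)
  rcases hb with hb | hb
  · have h3 : (A : ℤ) % 3 = 2 := by omega
    rw [hb, sq, Int.mul_emod] at h3
    have h4 : b % 3 = 0 ∨ b % 3 = 1 ∨ b % 3 = 2 := by omega
    rcases h4 with h4 | h4 | h4 <;> rw [h4] at h3 <;> norm_num at h3
  · have : 0 ≤ b ^ 2 := sq_nonneg b
    omega

lemma re_combination {A B ε : ℝ} {x y z : ℂ} (hA : 0 ≤ A) (hB : 0 ≤ B) (hε : ε ≤ 1)
    (hx : ‖x - 3‖ ≤ ε) (hy : ‖y - 3‖ ≤ ε) (hz : ‖z - 3‖ ≤ ε) :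
    |(A * (x * y) - B * z).re - (9 * A - 3 * B)| ≤ (7 * A + B) * ε := by
  have h1 : (A * (x * y) - B * z).re - (9 * A - 3 * B) =
      (A * ((x - 3) * (y - 3) + 3 * (x - 3) + 3 * (y - 3)) - B * (z - 3)).re := by
    have : (A * ((x - 3) * (y - 3) + 3 * (x - 3) + 3 * (y - 3)) - B * (z - 3)) =
        (A * (x * y) - B * z) - ((9 * A - 3 * B : ℝ) : ℂ) := by push_cast; ring
    rw [this, Complex.sub_re _ ((9 * A - 3 * B : ℝ) : ℂ), Complex.ofReal_re]
  rw [h1]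
  refine (Complex.abs_re_le_norm _).trans ((norm_sub_le _ _).trans ?_)
  rw [norm_mul, norm_mul, Complex.norm_real, Complex.norm_real, Real.norm_of_nonneg hA,
    Real.norm_of_nonneg hB]
  have h2 : ‖(x - 3) * (y - 3) + 3 * (x - 3) + 3 * (y - 3)‖ ≤ 7 * ε := by
    refine norm_add₃_le.trans ?_
    rw [norm_mul, norm_mul, norm_mul]
    have h3 : ‖(3 : ℂ)‖ = 3 := by norm_num
    rw [h3]
    have := mul_le_mul hx (hy.trans hε) (norm_nonneg _) ((norm_nonneg _).trans hx)
    linarith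
  have := mul_le_mul_of_nonneg_left h2 hA
  have := mul_le_mul_of_nonneg_left hz hB
  linarith

lemma rhoCoef_mul_sub (k l : ℕ) :
    rhoCoef k * rhoCoef l - rhoCoef (k + l) = ((rhoBinom k * rhoBinom l : ℝ) : ℂ) *
      (rhoSum (k % 3) k * rhoSum (l % 3) l) - rhoBinom (k + l) * rhoSum ((k + l) % 3) (k + l) := by
  rw [rhoCoef, rhoCoef, rhoCoef]; push_cast; ring

/-- Bounds for the error in `rhoSum m n ≈ 3`. -/
lemma exists_norm_rhoSum_sub_three_le : ∃ L : ℕ, ∀ l, L ≤ l → 4 ≤ l → ∃ ε : ℝ, 0 ≤ ε ∧ ε ≤ 1 / 1000 ∧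
    1000 * (l : ℝ) ^ 2 * ε ≤ 1 ∧
    ∀ n, l ≤ n → Even n → ‖rhoSum (n % 3) n - 3‖ ≤ ε := by
  have h3 : (√3)⁻¹ < 1 := inv_lt_one_of_one_lt₀ (Real.lt_sqrt_of_sq_lt (by norm_num))
  have hlim : Tendsto (fun l : ℕ => 1000 * tailConst * 9 * ((l : ℝ) ^ 2 * ((√3)⁻¹) ^ l))
      atTop (𝓝 0) := by
    rw [show (𝓝 (0 : ℝ)) = 𝓝 (1000 * tailConst * 9 * 0) by rw [mul_zero]]
    exact (tendsto_pow_const_mul_const_pow_of_lt_one 2 (by positivity) h3).const_mul _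
  obtain ⟨L, hL⟩ := eventually_atTop.1 (hlim.eventually_le_const (u := 1) (by norm_num))
  refine ⟨L, fun l hl h4 => ⟨tailConst * ((√3)⁻¹) ^ (l - 4),
    mul_nonneg tailConst_pos.le (by positivity), ?_, ?_, ?_⟩⟩
  rotate_right
  · intro n hn hne
    obtain ⟨p, hp⟩ := hne
    refine (norm_rhoSum_sub_three_le (by omega) (by omega)).trans ?_
    exact mul_le_mul_of_nonneg_left (pow_le_pow_of_le_one (by positivity) h3.le (by omega))
      tailConst_pos.le
  all_goals
    have hs : ((√3)⁻¹) ^ (l - 4) = 9 * ((√3)⁻¹) ^ l := by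
      obtain ⟨q, rfl⟩ : ∃ q, l = q + 4 := ⟨l - 4, by omega⟩
      have h9 : ((√3)⁻¹) ^ 4 = 9⁻¹ := by
        rw [show (4 : ℕ) = 2 * 2 by rfl, pow_mul, inv_pow, Real.sq_sqrt (by norm_num)]; norm_num
      rw [Nat.add_sub_cancel, pow_add, h9]; ring
    have := hL l hl
    rw [hs]
  · have hl1 : (1 : ℝ) ≤ (l : ℝ) ^ 2 := one_le_pow₀ (by exact_mod_cast (by omega : 1 ≤ l))
    have : 1000 * (tailConst * (9 * ((√3)⁻¹) ^ l)) ≤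
        1000 * tailConst * 9 * ((l : ℝ) ^ 2 * ((√3)⁻¹) ^ l) := by
      have h5 := mul_nonneg tailConst_pos.le (by positivity : 0 ≤ ((√3)⁻¹) ^ l)
      nlinarith
    linarith
  · linarith

/-- All three binomial factors are 1 here and the lattice sums are near 3, so the coefficient is
near 3·3 - 3 = 6. -/
lemma exists_deltaCoef_re_pos : ∃ L : ℕ, ∀ k l : ℕ, Even k → Even l → L ≤ l → l ≤ k → 4 ≤ l →
    k % 6 = 0 → l % 6 = 0 → 0 < (deltaCoef k l).re := by
  obtain ⟨L, hL⟩ := exists_norm_rhoSum_sub_three_le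
  refine ⟨L, fun k l hke hle hl hlk h4 hk6 hl6 => ?_⟩
  obtain ⟨ε, hε0, hε1, -, hε⟩ := hL l hl h4
  rw [deltaCoef, if_pos (by omega), rhoCoef_mul_sub, rhoBinom, rhoBinom, rhoBinom,
    if_pos (by omega), if_pos (by omega), if_pos (by omega)]
  have := re_combination (A := 1 * 1) (B := 1) (by norm_num) (by norm_num) (by linarith)
    (hε k hlk hke) (hε l le_rfl hle) (hε (k + l) (by omega) (hke.add hle))
  linarith [(abs_le.1 this).1]

lemma re_ne_zero_of_abs_lt {x a b : ℝ} (h : |x - a| ≤ b) (hb : b < |a|) : x ≠ 0 := by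
  rintro rfl
  rw [zero_sub, abs_neg] at h
  linarith

/-- The degenerate case, decided by the vectors of norm `√3`. -/
lemma exists_re_ne_zero_of_degenerate : ∃ L : ℕ, ∀ k l : ℕ, Even k → Even l → L ≤ l → 4 ≤ l →
    3 * l ≤ k → k % 6 = 4 → l % 6 = 4 →
    (rhoSum 1 k * rhoSum 1 l - 3 * rhoSum 2 (k + l)).re ≠ 0 := by
  have hlim : Tendsto (fun l : ℕ => tailConst * 19 * 64 * (27 / 64 : ℝ) ^ l) atTop (𝓝 0) := by
    rw [show (𝓝 (0 : ℝ)) = 𝓝 (tailConst * 19 * 64 * 0) by rw [mul_zero]]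
    exact (tendsto_pow_atTop_nhds_zero_of_lt_one (by norm_num) (by norm_num)).const_mul _
  have hlim2 : Tendsto (fun l : ℕ => tailConst * (2⁻¹ : ℝ) ^ (l - 4)) atTop (𝓝 0) := by
    rw [show (𝓝 (0 : ℝ)) = 𝓝 (tailConst * 0) by rw [mul_zero]]
    exact ((tendsto_pow_atTop_nhds_zero_of_lt_one (by norm_num) (by norm_num)).comp
      (tendsto_sub_atTop_nat 4)).const_mul _
  obtain ⟨L, hL⟩ := eventually_atTop.1 (hlim.eventually_le_const (u := 1) (by norm_num))
  obtain ⟨L', hL'⟩ := eventually_atTop.1 (hlim2.eventually_le_const (u := 1 / 2) (by norm_num))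
  refine ⟨max (6 * L) L', fun k l hke hle hLl h4 hkl hk6 hl6 => ?_⟩
  obtain ⟨e, he⟩ : ∃ e, l + 2 = 6 * e := ⟨(l + 2) / 6, by omega⟩
  have hLe := hL e (by omega)
  have hr1 := hL' l (by omega)
  set err := tailConst * (2⁻¹ : ℝ) ^ (l - 4) with hr
  have hr0 : 0 ≤ err := mul_nonneg tailConst_pos.le (by positivity)
  -- For weights at least 3ℓ even the vectors of norm √3 are negligible, since 3^{-(ℓ-4)} ≤
  -- 2^{-(ℓ-4)}. Only E_ℓ needs the second approximation.
  have hfar : ∀ n, 3 * l ≤ n → tailConst * ((√3)⁻¹) ^ (n - 4) ≤ err := by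
    intro n hn
    have h3 : (√3)⁻¹ ≤ 1 := inv_le_one_of_one_le₀ (Real.one_le_sqrt.2 (by norm_num))
    refine mul_le_mul_of_nonneg_left ?_ tailConst_pos.le
    calc ((√3)⁻¹) ^ (n - 4) ≤ ((√3)⁻¹) ^ (2 * (l - 4)) :=
          pow_le_pow_of_le_one (by positivity) h3 (by omega)
      _ = ((3 : ℝ)⁻¹) ^ (l - 4) := by
          rw [pow_mul, inv_pow, Real.sq_sqrt (by norm_num)]
      _ ≤ _ := pow_le_pow_left₀ (by norm_num) (by norm_num) _
  have h1 := (norm_rhoSum_sub_three_le (m := 1) (k := k) (by omega) (by omega)).trans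
    (hfar k hkl)
  have h2 := (norm_rhoSum_sub_three_le (m := 2) (k := k + l) (by omega) (by omega)).trans
    (hfar (k + l) (by omega))
  have h3 := norm_rhoSum_sub_le (m := 1) (k := l) h4 (by omega)
  rw [show (l + 2 * 1) / 6 = e by omega, ← hr] at h3
  set t : ℝ := ((-27)⁻¹ : ℝ) ^ e with ht
  have htc : ((-27 : ℂ)⁻¹) ^ e = (t : ℂ) := by rw [ht]; push_cast; ring
  rw [htc] at h3
  have htabs : |t| = ((27)⁻¹ : ℝ) ^ e := by rw [ht, abs_pow]; norm_num
  have ht1 : |t| ≤ 1 := by rw [htabs]; exact pow_le_one₀ (by norm_num) (by norm_num)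
  -- The main terms 3·3 - 3·3 cancel, and the vectors of norm √3 in E_ℓ leave 3·9t = 27t with |t| =
  -- 27^{-e}. Vectors of norm at least 2 contribute only order 64^{-e}.
  refine re_ne_zero_of_abs_lt (a := 27 * t) (b := 19 * err) ?_ ?_
  · have hre : (rhoSum 1 k * rhoSum 1 l - 3 * rhoSum 2 (k + l)).re - 27 * t =
        (3 * (rhoSum 1 l - (3 + 3 * 3 ^ 1 * t)) + (rhoSum 1 k - 3) * rhoSum 1 l -
          3 * (rhoSum 2 (k + l) - 3)).re := by
      have : (3 * (rhoSum 1 l - (3 + 3 * 3 ^ 1 * t)) + (rhoSum 1 k - 3) * rhoSum 1 l -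
          3 * (rhoSum 2 (k + l) - 3)) = (rhoSum 1 k * rhoSum 1 l - 3 * rhoSum 2 (k + l)) -
          ((27 * t : ℝ) : ℂ) := by push_cast; ring
      rw [this, Complex.sub_re _ ((27 * t : ℝ) : ℂ), Complex.ofReal_re]
    rw [hre]
    refine (Complex.abs_re_le_norm _).trans ((norm_sub_le _ _).trans
      ((add_le_add_left (norm_add_le _ _) _).trans ?_))
    have hn3 : ‖(3 : ℂ)‖ = 3 := by norm_num
    rw [norm_mul, norm_mul, norm_mul, hn3]
    have h5 : ‖rhoSum 1 l‖ ≤ 13 := by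
      have h6 := norm_le_insert' (rhoSum 1 l) (3 + 3 * 3 ^ 1 * t)
      have h7 : ‖(3 + 3 * 3 ^ 1 * t : ℂ)‖ ≤ 12 := by
        refine (norm_add_le _ _).trans ?_
        rw [norm_mul, Complex.norm_real, Real.norm_eq_abs, hn3]
        have : ‖(3 * 3 ^ 1 : ℂ)‖ = 9 := by norm_num
        rw [this]; linarith
      linarith
    have := mul_le_mul h1 h5 (norm_nonneg _) hr0
    linarith
  · rw [abs_mul, htabs, abs_of_pos (by norm_num : (0 : ℝ) < 27)]
    have h6 : err = tailConst * (64 * (64⁻¹ : ℝ) ^ e) := by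
      rw [hr]
      congr 1
      obtain ⟨e', rfl⟩ : ∃ e', e = e' + 1 := ⟨e - 1, by omega⟩
      rw [show l - 4 = 6 * e' by omega, pow_mul]
      norm_num
      rw [pow_succ]
      ring
    have h7 : (27 / 64 : ℝ) ^ e = 27 ^ e * (64⁻¹ : ℝ) ^ e := by rw [← mul_pow]; norm_num
    have h8 : (27 : ℝ) ^ e * ((27)⁻¹ : ℝ) ^ e = 1 := by rw [← mul_pow]; norm_num
    have h9 : 0 < (27⁻¹ : ℝ) ^ e := by positivity
    rw [h7] at hLe
    have h10 : 19 * err = (tailConst * 19 * 64 * (27 ^ e * (64⁻¹ : ℝ) ^ e)) * (27⁻¹ : ℝ) ^ e := by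
      rw [h6]; linear_combination (-(tailConst * 19 * 64 * (64⁻¹ : ℝ) ^ e)) * h8
    rw [h10]
    have := mul_le_mul_of_nonneg_right hLe h9.le
    linarith

/-- For k ≤ 3ℓ the integer bound |Q| ≥ 1 suffices, since ℓ²ε is tiny. Beyond that Q ≥ k², and a
small ε alone is enough. `quadratic_lt_of_four` follows the same pattern. -/
lemma quadratic_lt_of_zero {k l ε Q : ℝ} (hl4 : 4 ≤ l) (hlk' : l ≤ k) (hε0 : 0 ≤ ε)
    (hε1 : ε ≤ 1 / 1000) (hε2 : 1000 * l ^ 2 * ε ≤ 1) (hQ1 : 1 ≤ |Q|)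
    (hQr : Q = 2 * k ^ 2 - 2 * k * l - l ^ 2 + 2 * k - l) :
    (7 * (k * (k + 1) / 2) + (k + l) * (k + l + 1) / 2) * ε <
      |9 * (k * (k + 1) / 2) - 3 * ((k + l) * (k + l + 1) / 2)| := by
  have hk0 : 0 < k := by linarith
  have hmain : 9 * (k * (k + 1) / 2) - 3 * ((k + l) * (k + l + 1) / 2) = 3 / 2 * Q := by
    rw [hQr]; ring
  rw [hmain, abs_mul, abs_of_pos (by norm_num : (0 : ℝ) < 3 / 2)]
  have herr : 7 * (k * (k + 1) / 2) + (k + l) * (k + l + 1) / 2 ≤ 10 * k ^ 2 := by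
    nlinarith
  have herr' := mul_le_mul_of_nonneg_right herr hε0
  rcases le_total k (3 * l) with h | h
  · have h1 : (1 : ℝ) ≤ |Q| := hQ1
    have h2 : k ^ 2 ≤ 9 * l ^ 2 := by nlinarith
    nlinarith
  · have h1 : k ^ 2 ≤ |Q| := by
      refine le_trans ?_ (le_abs_self _)
      rw [hQr]; nlinarith
    have h2 : (0 : ℝ) < k ^ 2 := by positivity
    nlinarith

lemma quadratic_lt_of_four {k l ε Q : ℝ} (hl4 : 4 ≤ l) (hlk' : l ≤ k) (hε0 : 0 ≤ ε)
    (hε1 : ε ≤ 1 / 1000) (hε2 : 1000 * l ^ 2 * ε ≤ 1) (hQ1 : 1 ≤ |Q|)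
    (hQr : Q = k ^ 2 + l ^ 2 - 4 * k * l + k + l) :
    (7 * (k * l) + (k + l) * (k + l + 1) / 2) * ε <
      |9 * (k * l) - 3 * ((k + l) * (k + l + 1) / 2)| := by
  have hk0 : 0 < k := by linarith
  have hmain : 9 * (k * l) - 3 * ((k + l) * (k + l + 1) / 2) = -(3 / 2) * Q := by
    rw [hQr]; ring
  rw [hmain, abs_mul, abs_of_neg (by norm_num : (-(3 / 2) : ℝ) < 0)]
  have herr : 7 * (k * l) + (k + l) * (k + l + 1) / 2 ≤ 10 * k ^ 2 := by
    nlinarith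
  have herr' := mul_le_mul_of_nonneg_right herr hε0
  rcases le_total k (5 * l) with h | h
  · have h1 : (1 : ℝ) ≤ |Q| := hQ1
    have h2 : k ^ 2 ≤ 25 * l ^ 2 := by nlinarith
    nlinarith
  · have h1 : k ^ 2 / 5 ≤ |Q| := by
      refine le_trans ?_ (le_abs_self _)
      rw [hQr]; nlinarith
    have h2 : (0 : ℝ) < k ^ 2 := by positivity
    nlinarith

/-- Replacing every lattice sum by 3 turns the coefficient into 9A - 3B with explicit binomial
factors, or into -3B when the residues mod 3 add up to at least 3. Congruences keep this away from 0
except for one quadratic that has integer zeros. -/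
lemma exists_deltaCoef_re_ne_zero : ∃ L : ℕ, ∀ k l : ℕ, Even k → Even l → L ≤ l → l ≤ k → 4 ≤ l →
    (l % 6 = 0 ∧ k % 6 ≠ 0 ∨ l % 6 = 2 ∧ k % 6 ≠ 0 ∨ l % 6 = 4) → (deltaCoef k l).re ≠ 0 := by
  obtain ⟨L, hL⟩ := exists_norm_rhoSum_sub_three_le
  obtain ⟨L', hL'⟩ := exists_re_ne_zero_of_degenerate
  refine ⟨max L L', fun k l hke hle hLl hlk h4 hcases => ?_⟩
  obtain ⟨ε, hε0, hε1, hε2, hε⟩ := hL l (by omega) h4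
  have hk := hε k hlk hke
  have hl := hε l le_rfl hle
  have hw := hε (k + l) (by omega) (hke.add hle)
  have hl4 : (4 : ℝ) ≤ l := by exact_mod_cast h4
  have hlk' : (l : ℝ) ≤ k := by exact_mod_cast hlk
  have hl0 : (0 : ℝ) < l := by linarith
  have hk0 : (0 : ℝ) < k := by linarith
  have hlε : 1000 * (l : ℝ) * ε ≤ 1 := by nlinarith
  have hgen : ∀ A B : ℝ, 0 ≤ A → 0 ≤ B → (7 * A + B) * ε < |9 * A - 3 * B| →
      (A * (rhoSum (k % 3) k * rhoSum (l % 3) l) -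
        B * rhoSum ((k + l) % 3) (k + l)).re ≠ 0 := fun A B hA hB h =>
    re_ne_zero_of_abs_lt (re_combination hA hB (by linarith) hk hl hw) h
  have hcarry : 3 ≤ k % 3 + l % 3 → 0 < rhoBinom (k + l) → (deltaCoef k l).re ≠ 0 := by
    intro h hB
    have := hgen 0 (rhoBinom (k + l)) le_rfl hB.le (by
      rw [mul_zero, zero_add, mul_zero, zero_sub, abs_neg, abs_of_pos (by positivity)]
      nlinarith)
    rw [deltaCoef, if_neg (by omega), rhoCoef]
    simpa using this
  rcases hcases with ⟨hl6, hk6⟩ | ⟨hl6, hk6⟩ | hl6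
  · obtain hk3 | hk3 : k % 3 = 1 ∨ k % 3 = 2 := by obtain ⟨p, rfl⟩ := hke; omega
    · rw [deltaCoef, if_pos (by omega), rhoCoef_mul_sub]
      refine hgen _ _ ?_ ?_ ?_ <;>
      simp only [rhoBinom, hk3, show l % 3 = 0 by omega, show (k + l) % 3 = 1 by omega,
        if_true, if_false, one_ne_zero, mul_one]
      · positivity
      · positivity
      · push_cast
        refine lt_of_lt_of_le ?_ (le_abs_self _)
        nlinarith
    · rw [deltaCoef, if_pos (by omega), rhoCoef_mul_sub]
      refine hgen _ _ ?_ ?_ ?_ <;>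
      simp only [rhoBinom, hk3, show l % 3 = 0 by omega, show (k + l) % 3 = 2 by omega,
        if_true, if_false, mul_one, OfNat.ofNat_ne_zero, OfNat.ofNat_ne_one]
      · positivity
      · positivity
      · push_cast
        set Q : ℤ := 2 * k ^ 2 - 2 * k * l - l ^ 2 + 2 * k - l with hQ
        -- With M = ℓ/2 and A = k - M, Q = 0 would read A(A + 1) = 3M² with A ≡ 2 mod 3.
        have hQ0 : Q ≠ 0 := by
          intro h0
          obtain ⟨M, hM⟩ := hle
          have := sq_ne_of_mod_three (A := k - M) (M := M) (by omega)
          apply this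
          have hMk : M ≤ k := by omega
          zify [hMk]
          rw [hQ, hM] at h0
          push_cast at h0
          linarith
        have hQr : (Q : ℝ) = 2 * k ^ 2 - 2 * k * l - l ^ 2 + 2 * k - l := by
          rw [hQ]; push_cast; ring
        exact quadratic_lt_of_zero hl4 hlk' hε0 hε1 hε2 (by exact_mod_cast Int.one_le_abs hQ0) hQr
  · obtain hk3 | hk3 : k % 3 = 1 ∨ k % 3 = 2 := by obtain ⟨p, rfl⟩ := hke; omega
    · refine hcarry (by omega) ?_
      rw [rhoBinom, if_pos (by omega)]; norm_num
    · refine hcarry (by omega) ?_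
      rw [rhoBinom, if_neg (by omega), if_pos (by omega)]; push_cast; linarith
  · rcases (by omega : k % 3 = 0 ∨ k % 3 = 1 ∨ k % 3 = 2) with hk3 | hk3 | hk3
    · rw [deltaCoef, if_pos (by omega), rhoCoef_mul_sub]
      -- k is divisible by 3, whereas 2ℓ ≡ 2 mod 3.
      have hne : (k : ℤ) - 2 * l ≠ 0 := by obtain ⟨p, rfl⟩ := hke; omega
      refine hgen _ _ ?_ ?_ ?_ <;>
      simp only [rhoBinom, hk3, show l % 3 = 1 by omega, show (k + l) % 3 = 1 by omega,
        if_true, if_false, one_ne_zero, one_mul]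
      · positivity
      · positivity
      · push_cast
        have hmain : 9 * (l : ℝ) - 3 * (k + l) = -3 * (((k : ℤ) - 2 * l : ℤ) : ℝ) := by
          push_cast; ring
        have hc : (((k : ℤ) - 2 * l : ℤ) : ℝ) = k - 2 * l := by push_cast; ring
        rw [hmain, abs_mul, abs_of_neg (by norm_num : (-3 : ℝ) < 0)]
        rcases le_total (k : ℝ) (3 * l) with h | h
        · have h1 : (1 : ℝ) ≤ |(((k : ℤ) - 2 * l : ℤ) : ℝ)| := by
            exact_mod_cast Int.one_le_abs hne
          nlinarith
        · have h1 : (k : ℝ) - 2 * l ≤ |(((k : ℤ) - 2 * l : ℤ) : ℝ)| := by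
            rw [hc]; exact le_abs_self _
          nlinarith
    · rw [deltaCoef, if_pos (by omega), rhoCoef_mul_sub]
      set Q : ℤ := k ^ 2 + l ^ 2 - 4 * k * l + k + l with hQ
      have hQr : (Q : ℝ) = k ^ 2 + l ^ 2 - 4 * k * l + k + l := by
        rw [hQ]; push_cast; ring
      -- No congruence excludes Q = 0 here. In that case k ≥ 3ℓ, the binomial factors are in the
      -- exact ratio 1 : 3, and the next order of approximation decides.
      by_cases hQ0 : Q = 0
      · rw [hQ0, Int.cast_zero] at hQr
        have h3 : 3 * l ≤ k := by
          have : (3 : ℝ) * l ≤ k := by nlinarith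
          exact_mod_cast this
        have := hL' k l hke hle (by omega) h4 h3 (by obtain ⟨p, rfl⟩ := hke; omega) hl6
        have hB : rhoBinom (k + l) = 3 * (k * l) := by
          rw [rhoBinom, if_neg (by omega), if_neg (by omega)]; push_cast; linarith
        have hA : rhoBinom k * rhoBinom l = k * l := by
          rw [rhoBinom, rhoBinom, if_neg (by omega), if_pos (by omega), if_neg (by omega),
            if_pos (by omega)]
        rw [hA, hB, hk3, show l % 3 = 1 by omega, show (k + l) % 3 = 2 by omega]
        have hfac : ((k * l : ℝ) : ℂ) * (rhoSum 1 k * rhoSum 1 l) -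
            ((3 * (k * l) : ℝ) : ℂ) * rhoSum 2 (k + l) =
            ((k * l : ℝ) : ℂ) * (rhoSum 1 k * rhoSum 1 l - 3 * rhoSum 2 (k + l)) := by
          push_cast; ring
        rw [hfac, Complex.re_ofReal_mul]
        exact mul_ne_zero (by positivity) this
      · refine hgen _ _ ?_ ?_ ?_ <;>
        simp only [rhoBinom, hk3, show l % 3 = 1 by omega, show (k + l) % 3 = 2 by omega,
          if_true, if_false, one_ne_zero, OfNat.ofNat_ne_zero, OfNat.ofNat_ne_one]
        · positivity
        · positivity
        · push_cast
          exact quadratic_lt_of_four hl4 hlk' hε0 hε1 hε2 (by exact_mod_cast Int.one_le_abs hQ0) hQr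
    · refine hcarry (by omega) ?_
      rw [rhoBinom, if_pos (by omega)]; norm_num

end EisensteinZeros

/-! ### Signs of Δ on both lines near ρ -/

namespace EisensteinZeros

open Filter Topology EisensteinSeries ModularForm UpperHalfPlane

lemma Delta_eq_disc {k l : ℕ} (hk : 4 ≤ k) (hl : 4 ≤ l) {z : ℍ} {u : ℂ} (hu : 1 - u ≠ 0)
    (hz : (z : ℂ) * (1 - u) = rho - starRingEnd ℂ rho * u) :
    Delta hk hl z = (1 - u) ^ (k + l) * (discE k u * discE l u - discE (k + l) u) := by
  rw [Delta, E_eq_discE _ hu hz, E_eq_discE _ hu hz, E_eq_discE _ hu hz, pow_add]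
  ring

/-- Since (k + ℓ) mod 3 < 3, the cubic remainder is negligible against the leading term as t → 0.
The unimodular ζ is the normalising phase of the line of approach and s the sign it produces. -/
lemma exists_disc_re_pos {k l q : ℕ} (hk : 3 ≤ k) (hl : 3 ≤ l) (hke : Even k) (hle : Even l)
    (hq : 0 < (-1) ^ q * (deltaCoef k l).re) : ∃ t₀ : ℝ, 0 < t₀ ∧ ∀ (t s : ℝ) (u ζ : ℂ), 0 < t →
      t < t₀ → ‖u‖ = t → ‖ζ‖ = 1 → s * s = 1 →
      ζ * u ^ ((k + l) % 3) = ((s * t ^ ((k + l) % 3) : ℝ) : ℂ) →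
      0 < (-1) ^ q * s * (ζ * (discE k u * discE l u - discE (k + l) u)).re := by
  obtain ⟨C, hC, h⟩ := exists_norm_disc_delta_sub_le hk hl hke hle
  set c := deltaCoef k l with hc
  set r := (-1) ^ q * c.re with hr
  set d := (k + l) % 3 with hd
  have hd2 : d < 3 := Nat.mod_lt _ (by norm_num)
  refine ⟨min (1 / 2) (r / (C + 1)), by positivity, fun t s u ζ ht ht0 hu hζ hs hζu => ?_⟩
  have ht1 : t < 1 / 2 := ht0.trans_le (min_le_left _ _)
  have ht2 : t * (C + 1) < r := by
    rw [← lt_div_iff₀ (by positivity)]; exact ht0.trans_le (min_le_right _ _)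
  have hb := h u (by rw [hu]; exact ht1.le)
  rw [hu] at hb
  set H := discE k u * discE l u - discE (k + l) u with hH
  have hdecomp : ζ * H = ((s * t ^ d : ℝ) : ℂ) * c + ζ * (H - c * u ^ d) := by
    rw [← hζu]; ring
  have habs : |(-1) ^ q * s * (ζ * (H - c * u ^ d)).re| ≤ C * t ^ 3 := by
    have hs1 : |s| = 1 := by rcases mul_self_eq_one_iff.1 hs with h | h <;> simp [h]
    rw [abs_mul, abs_mul, abs_pow, abs_neg, abs_one, one_pow, hs1, one_mul, one_mul]
    refine (Complex.abs_re_le_norm _).trans ?_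
    rw [norm_mul, hζ, one_mul]
    exact hb
  have hmain : (-1) ^ q * s * (((s * t ^ d : ℝ) : ℂ) * c).re = r * t ^ d := by
    rw [Complex.re_ofReal_mul, hr]
    linear_combination ((-1) ^ q * t ^ d * c.re) * hs
  rw [hdecomp, Complex.add_re, mul_add, hmain]
  have h3 : t ^ 3 ≤ t ^ d * t := by
    rw [← pow_succ]
    exact pow_le_pow_of_le_one ht.le (by linarith) (by omega)
  have htd : 0 < t ^ d := by positivity
  have h4 : C * t ^ 3 ≤ C * (t ^ d * t) := mul_le_mul_of_nonneg_left h3 hC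
  have h5 : t ^ d * (t * (C + 1)) < t ^ d * r := mul_lt_mul_of_pos_left ht2 htd
  have h6 : 0 < t ^ d * t := by positivity
  linarith [(abs_le.1 habs).1]

/-- The sign of `Δ_{k,ℓ}` on the line `x = 1/2` near `ρ`. -/
lemma eventually_sideVal_pos {k l q : ℕ} (hk : 4 ≤ k) (hl : 4 ≤ l) (hke : Even k) (hle : Even l)
    (hq : 0 < (-1) ^ q * (deltaCoef k l).re) :
    ∀ᶠ y in 𝓝[>] (√3 / 2), 0 < (-1) ^ q * sideVal (Delta hk hl) y := by
  obtain ⟨t₀, ht₀, h⟩ := exists_disc_re_pos (by omega) (by omega) hke hle hq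
  have h3 : 0 < √3 / 2 := by positivity
  have hcont : ContinuousAt (fun y : ℝ => (y - √3 / 2) / (y + √3 / 2)) (√3 / 2) := by
    refine ContinuousAt.div (by fun_prop) (by fun_prop) (by positivity)
  have hlim : ∀ᶠ y in 𝓝[>] (√3 / 2), (y - √3 / 2) / (y + √3 / 2) < t₀ :=
    (hcont.eventually_lt_const (by simpa using ht₀)).filter_mono nhdsWithin_le_nhds
  filter_upwards [hlim, self_mem_nhdsWithin] with y hy hy0
  have hy0 : √3 / 2 < y := hy0
  set t := (y - √3 / 2) / (y + √3 / 2) with ht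
  have hyp : 0 < y := h3.trans hy0
  have ht0 : 0 < t := div_pos (by linarith) (by linarith)
  have ht1 : t < 1 := by rw [ht, div_lt_one (by linarith)]; linarith
  have hH := h t 1 (t : ℂ) 1 ht0 hy (by rw [Complex.norm_real, Real.norm_of_nonneg ht0.le])
    norm_one (by norm_num) (by push_cast; ring)
  have hu : (1 : ℂ) - t ≠ 0 := by
    rw [← Complex.ofReal_one, ← Complex.ofReal_sub]
    exact_mod_cast (by linarith : (1 - t) ≠ 0)
  -- On this line the disc coordinate is the positive real number t, so no extra sign appears.
  have hz : (sidePt y : ℂ) * (1 - t) = rho - starRingEnd ℂ rho * t := by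
    have hden : y + √3 / 2 ≠ 0 := by linarith
    rw [coe_sidePt hyp, coe_rho_eq]
    apply Complex.ext
    · simp
      ring
    · simp
      rw [ht]
      field_simp
      ring
  rw [sideVal, Delta_eq_disc hk hl hu hz, ← Complex.ofReal_one, ← Complex.ofReal_sub,
    ← Complex.ofReal_pow, Complex.re_ofReal_mul]
  have hp : 0 < (1 - t) ^ (k + l) := pow_pos (by linarith) _
  rw [mul_one, one_mul] at hH
  have := mul_pos hp hH
  linarith

/-- On the arc the disc coordinate is ρt with t a ratio of sines. The second identity shows that
e^{iθ/2}(1 - u) has the constant argument π/6, so the normalising phase becomes e^{iπw/6}. -/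
lemma arc_disc_identities {θ : ℝ} (h1 : Real.pi / 3 < θ) (h2 : θ < Real.pi / 2) {t : ℝ}
    (ht : t = Real.sin ((θ - Real.pi / 3) / 2) / Real.sin ((θ + Real.pi / 3) / 2)) :
    (arcPt θ : ℂ) * (1 - rho * t) = rho - starRingEnd ℂ rho * (rho * t) ∧
      Complex.exp ((θ / 2 : ℝ) * Complex.I) * (1 - rho * t) =
        Complex.exp ((Real.pi / 6 : ℝ) * Complex.I) *
          ((√3 / (2 * Real.sin ((θ + Real.pi / 3) / 2)) : ℝ) : ℂ) := by
  have hpi := Real.pi_pos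
  have hs : 0 < Real.sin ((θ + Real.pi / 3) / 2) :=
    Real.sin_pos_of_pos_of_lt_pi (by linarith) (by linarith)
  have hsin : 0 < Real.sin θ := Real.sin_pos_of_pos_of_lt_pi (by linarith) (by linarith)
  set E := Complex.exp ((θ / 2 : ℝ) * Complex.I) with hE
  set R := Complex.exp ((Real.pi / 6 : ℝ) * Complex.I) with hR
  have hE0 : E ≠ 0 := Complex.exp_ne_zero _
  have hR0 : R ≠ 0 := Complex.exp_ne_zero _
  have hEi : E⁻¹ = Complex.exp (-((θ / 2 : ℝ) * Complex.I)) := (Complex.exp_neg _).symm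
  have hRi : R⁻¹ = Complex.exp (-((Real.pi / 6 : ℝ) * Complex.I)) := (Complex.exp_neg _).symm
  have hz : (arcPt θ : ℂ) = E ^ 2 := by
    rw [coe_arcPt hsin, hE, ← Complex.exp_nat_mul]; congr 1; push_cast; ring
  have hrho : (rho : ℂ) = R ^ 2 := by
    rw [hR, ← Complex.exp_nat_mul, coe_rho_eq]
    have : ((2 : ℕ) : ℂ) * ((Real.pi / 6 : ℝ) * Complex.I) = ((Real.pi / 3 : ℝ) : ℂ) * Complex.I := by
      push_cast; ring
    rw [this, Complex.exp_mul_I, ← Complex.ofReal_cos, ← Complex.ofReal_sin, Real.cos_pi_div_three,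
      Real.sin_pi_div_three]
    apply Complex.ext <;> simp
  have hconj : starRingEnd ℂ (rho : ℂ) = (R⁻¹) ^ 2 := by
    rw [inv_pow, ← hrho, Complex.inv_def, normSq_rho]; simp
  have hsm : (Real.sin ((θ - Real.pi / 3) / 2) : ℂ) * (2 * Complex.I) = E * R⁻¹ - E⁻¹ * R := by
    rw [hEi, hRi, hE, hR, ← Complex.exp_add, ← Complex.exp_add]
    have e1 : (θ / 2 : ℝ) * Complex.I + -((Real.pi / 6 : ℝ) * Complex.I) =
        (((θ - Real.pi / 3) / 2 : ℝ) : ℂ) * Complex.I := by push_cast; ring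
    have e2 : -((θ / 2 : ℝ) * Complex.I) + (Real.pi / 6 : ℝ) * Complex.I =
        -(((θ - Real.pi / 3) / 2 : ℝ) : ℂ) * Complex.I := by push_cast; ring
    rw [e1, e2, Complex.exp_mul_I, Complex.exp_mul_I, Complex.cos_neg, Complex.sin_neg,
      ← Complex.ofReal_sin]
    ring
  have hsp : (Real.sin ((θ + Real.pi / 3) / 2) : ℂ) * (2 * Complex.I) = E * R - E⁻¹ * R⁻¹ := by
    rw [hEi, hRi, hE, hR, ← Complex.exp_add, ← Complex.exp_add]
    have e1 : (θ / 2 : ℝ) * Complex.I + ((Real.pi / 6 : ℝ) * Complex.I) =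
        (((θ + Real.pi / 3) / 2 : ℝ) : ℂ) * Complex.I := by push_cast; ring
    have e2 : -((θ / 2 : ℝ) * Complex.I) + -((Real.pi / 6 : ℝ) * Complex.I) =
        -(((θ + Real.pi / 3) / 2 : ℝ) : ℂ) * Complex.I := by push_cast; ring
    rw [e1, e2, Complex.exp_mul_I, Complex.exp_mul_I, Complex.cos_neg, Complex.sin_neg,
      ← Complex.ofReal_sin]
    ring
  have hRR : (√3 : ℂ) * Complex.I = R ^ 2 - (R⁻¹) ^ 2 := by
    rw [← hconj, ← hrho, coe_rho_eq]
    apply Complex.ext <;> simp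
  have hsc : (Real.sin ((θ + Real.pi / 3) / 2) : ℂ) ≠ 0 := by exact_mod_cast hs.ne'
  have htc : (t : ℂ) * Real.sin ((θ + Real.pi / 3) / 2) = Real.sin ((θ - Real.pi / 3) / 2) := by
    rw [ht, Complex.ofReal_div, div_mul_cancel₀ _ hsc]
  have hI : (2 * Complex.I) ≠ 0 := by simp
  have hD0 : E * R - E⁻¹ * R⁻¹ ≠ 0 := by rw [← hsp]; exact mul_ne_zero hsc hI
  have htD : (t : ℂ) * (E * R - E⁻¹ * R⁻¹) = E * R⁻¹ - E⁻¹ * R := by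
    rw [← hsp, ← hsm, ← htc]; ring
  have hEE : E * E⁻¹ = 1 := mul_inv_cancel₀ hE0
  have hRR1 : R * R⁻¹ = 1 := mul_inv_cancel₀ hR0
  set F := E⁻¹ with hF
  set S := R⁻¹ with hS
  constructor
  · rw [hz, hconj, hrho]
    apply mul_right_cancel₀ hD0
    linear_combination (-E ^ 2 * R ^ 2 + S ^ 2 * R ^ 2) * htD + (E * R ^ 3 - E * S) * hEE +
      (F * R - E ^ 3 * R + (E * S - F * R) * (R * S + 1)) * hRR1
  · rw [hrho]
    have hP : ((√3 / (2 * Real.sin ((θ + Real.pi / 3) / 2)) : ℝ) : ℂ) * (E * R - F * S) =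
        R ^ 2 - S ^ 2 := by
      rw [← hsp, ← hRR, Complex.ofReal_div, Complex.ofReal_mul, Complex.ofReal_ofNat]
      generalize (Real.sin ((θ + Real.pi / 3) / 2) : ℂ) = x at hsc
      field_simp
    apply mul_right_cancel₀ hD0
    linear_combination -E * R ^ 2 * htD - R * hP + (R ^ 3 - S) * hEE + (S - E ^ 2 * R) * hRR1

/-- The sign of `Δ_{k,ℓ}` on the arc near `ρ`. -/
lemma eventually_arcVal_pos {k l q : ℕ} (hk : 4 ≤ k) (hl : 4 ≤ l) (hke : Even k) (hle : Even l)
    (hq : 0 < (-1) ^ q * (deltaCoef k l).re) :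
    ∀ᶠ θ in 𝓝[>] (Real.pi / 3), 0 < (-1) ^ (q + (k + l + 2 * ((k + l) % 3)) / 6) *
      arcVal (Delta hk hl) (k + l) θ := by
  obtain ⟨t₀, ht₀, h⟩ := exists_disc_re_pos (by omega) (by omega) hke hle hq
  have hpi := Real.pi_pos
  have hcont : ContinuousAt (fun θ : ℝ => Real.sin ((θ - Real.pi / 3) / 2) /
      Real.sin ((θ + Real.pi / 3) / 2)) (Real.pi / 3) := by
    refine ContinuousAt.div (by fun_prop) (by fun_prop) ?_
    exact (Real.sin_pos_of_pos_of_lt_pi (by linarith) (by linarith)).ne'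
  have hlim : ∀ᶠ θ in 𝓝[>] (Real.pi / 3), Real.sin ((θ - Real.pi / 3) / 2) /
      Real.sin ((θ + Real.pi / 3) / 2) < t₀ :=
    (hcont.eventually_lt_const (by simpa using ht₀)).filter_mono nhdsWithin_le_nhds
  have hlt : ∀ᶠ θ in 𝓝[>] (Real.pi / 3), θ < Real.pi / 2 :=
    nhdsWithin_le_nhds (gt_mem_nhds (by linarith))
  filter_upwards [hlim, hlt, self_mem_nhdsWithin] with θ hθ hθ2 hθ1
  have hθ1 : Real.pi / 3 < θ := hθ1
  set t := Real.sin ((θ - Real.pi / 3) / 2) / Real.sin ((θ + Real.pi / 3) / 2) with ht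
  have hs : 0 < Real.sin ((θ + Real.pi / 3) / 2) :=
    Real.sin_pos_of_pos_of_lt_pi (by linarith) (by linarith)
  have ht0 : 0 < t :=
    div_pos (Real.sin_pos_of_pos_of_lt_pi (by linarith) (by linarith)) hs
  obtain ⟨hz, hP⟩ := arc_disc_identities hθ1 hθ2 ht
  set P := √3 / (2 * Real.sin ((θ + Real.pi / 3) / 2)) with hPdef
  have hP0 : 0 < P := by positivity
  have hu : 1 - (rho : ℂ) * t ≠ 0 := fun h0 => by
    rw [h0, mul_zero] at hP
    have : (P : ℂ) ≠ 0 := by exact_mod_cast hP0.ne'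
    exact mul_ne_zero (Complex.exp_ne_zero _) this hP.symm
  set d := (k + l) % 3 with hd
  set w := k + l with hw
  -- The phase e^{iπw/6} times u^d, with u = e^{iπ/3}t, is e^{iπ(w + 2d)/6} t^d = (-1)^v t^d.
  obtain ⟨v, hv⟩ : ∃ v, w + 2 * d = 6 * v := ⟨(w + 2 * d) / 6, by
    have := (hke.add hle).two_dvd; omega⟩
  have hv' : (w + 2 * d) / 6 = v := by omega
  set ζ := Complex.exp ((Real.pi / 6 : ℝ) * Complex.I) ^ w with hζ
  have hrho : (rho : ℂ) = Complex.exp ((Real.pi / 6 : ℝ) * Complex.I) ^ 2 := by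
    rw [← Complex.exp_nat_mul, coe_rho_eq]
    have : ((2 : ℕ) : ℂ) * ((Real.pi / 6 : ℝ) * Complex.I) = ((Real.pi / 3 : ℝ) : ℂ) * Complex.I := by
      push_cast; ring
    rw [this, Complex.exp_mul_I, ← Complex.ofReal_cos, ← Complex.ofReal_sin, Real.cos_pi_div_three,
      Real.sin_pi_div_three]
    apply Complex.ext <;> simp
  have hsix : Complex.exp ((Real.pi / 6 : ℝ) * Complex.I) ^ 6 = -1 := by
    rw [← Complex.exp_nat_mul, ← Complex.exp_pi_mul_I]
    congr 1; push_cast; ring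
  have hnrm : ‖Complex.exp ((Real.pi / 6 : ℝ) * Complex.I)‖ = 1 := Complex.norm_exp_ofReal_mul_I _
  have hH := h t ((-1) ^ v) (rho * t) ζ ht0 hθ
    (by rw [norm_mul, Complex.norm_real, Real.norm_of_nonneg ht0.le, hrho, norm_pow, hnrm]; simp)
    (by rw [hζ, norm_pow, hnrm, one_pow]) (by rw [← mul_pow]; simp) (by
      rw [mul_pow, ← mul_assoc, hrho, hζ, ← pow_mul, ← pow_add, hv, pow_mul, hsix]
      push_cast; ring)
  rw [arcVal, Delta_eq_disc hk hl hu hz, hv']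
  have hexp : Complex.exp ((w : ℂ) * ((θ : ℂ) / 2) * Complex.I) =
      Complex.exp ((θ / 2 : ℝ) * Complex.I) ^ w := by
    rw [← Complex.exp_nat_mul]; congr 1; push_cast; ring
  have hmul : Complex.exp ((w : ℂ) * ((θ : ℂ) / 2) * Complex.I) * ((1 - rho * t) ^ (k + l) *
      (discE k (rho * t) * discE l (rho * t) - discE (k + l) (rho * t))) =
      ((P ^ w : ℝ) : ℂ) * (ζ * (discE k (rho * t) * discE l (rho * t) -
        discE (k + l) (rho * t))) := by
    rw [hexp, ← mul_assoc, ← hw, ← mul_pow, hP, mul_pow, hζ]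
    push_cast; ring
  have hp : 0 < P ^ w := by positivity
  have := mul_pos hp hH
  rw [hmul, Complex.re_ofReal_mul, pow_add]
  linarith

end EisensteinZeros

/-! ### Counting zeros and comparison with the table -/

namespace EisensteinZeros

open Filter Topology EisensteinSeries ModularForm UpperHalfPlane

lemma continuous_Delta {k l : ℕ} (hk : 4 ≤ k) (hl : 4 ≤ l) : Continuous (Delta hk hl) := by
  rw [← coe_deltaForm hk hl]
  exact (ModularFormClass.holo (deltaForm hk hl)).continuous

lemma continuousAt_arcVal {k l : ℕ} (hk : 4 ≤ k) (hl : 4 ≤ l) (w : ℕ) {θ : ℝ}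
    (h : 0 < Real.sin θ) : ContinuousAt (arcVal (Delta hk hl) w) θ := by
  refine Complex.continuous_re.continuousAt.comp (ContinuousAt.mul (by fun_prop) ?_)
  refine (continuous_Delta hk hl).continuousAt.comp ?_
  refine ContinuousAt.comp (g := ofComplex) (mdifferentiableAt_ofComplex ?_).continuousAt
    (by fun_prop)
  rwa [Complex.exp_ofReal_mul_I_im]

lemma continuousAt_sideVal {k l : ℕ} (hk : 4 ≤ k) (hl : 4 ≤ l) {y : ℝ} (h : 0 < y) :
    ContinuousAt (sideVal (Delta hk hl)) y := by
  refine Complex.continuous_re.continuousAt.comp ?_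
  refine (continuous_Delta hk hl).continuousAt.comp ?_
  refine ContinuousAt.comp (g := ofComplex) (mdifferentiableAt_ofComplex ?_).continuousAt
    (by fun_prop)
  simpa using h

lemma sin_pos_of_arc {θ : ℝ} (h1 : Real.pi / 3 < θ) (h2 : θ ≤ Real.pi / 2) : 0 < Real.sin θ :=
  Real.sin_pos_of_pos_of_lt_pi (by linarith [Real.pi_pos]) (by linarith [Real.pi_pos])

lemma finite_arcZeros {k l : ℕ} (hk : 4 ≤ k) (hl : 4 ≤ l) (h0 : Delta hk hl ≠ 0) :
    (arcZeros (Delta hk hl)).Finite := by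
  have hne : deltaForm hk hl ≠ 0 := fun h => h0 (by rw [← coe_deltaForm hk hl, h]; rfl)
  refine (finite_zeros_of_modularForm (deltaForm hk hl) hne).subset ?_
  rintro z ⟨⟨θ, h1, h2, hz⟩, hf⟩
  have hre : z.re = Real.cos θ := by
    rw [← coe_re, hz, Complex.exp_ofReal_mul_I_re]
  have hpos : 0 < Real.cos θ :=
    Real.cos_pos_of_mem_Ioo ⟨by linarith [Real.pi_pos], h2⟩
  have hlt : Real.cos θ < 1 / 2 := by
    rw [← Real.cos_pi_div_three]
    exact Real.cos_lt_cos_of_nonneg_of_le_pi (by positivity) (by linarith [Real.pi_pos]) h1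
  have hn : ‖(z : ℂ)‖ = 1 := by rw [hz, Complex.norm_exp_ofReal_mul_I]
  exact ⟨⟨hn.ge, by rw [hre]; linarith, by rw [hre]; exact hlt.le, fun _ => by
    rw [hre]; exact hpos.le⟩, hf⟩

lemma finite_sideZeros {k l : ℕ} (hk : 4 ≤ k) (hl : 4 ≤ l) (h0 : Delta hk hl ≠ 0) :
    (sideZeros (Delta hk hl)).Finite := by
  have hne : deltaForm hk hl ≠ 0 := fun h => h0 (by rw [← coe_deltaForm hk hl, h]; rfl)
  refine (finite_zeros_of_modularForm (deltaForm hk hl) hne).subset ?_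
  rintro z ⟨hre, him, hf⟩
  refine ⟨mem_strictFundamentalDomain_iff.2 ⟨?_, by linarith, hre.le, fun _ => by linarith⟩, hf⟩
  rw [Complex.normSq_apply, coe_re, coe_im, hre]
  have h3 : √3 * √3 = 3 := Real.mul_self_sqrt (by norm_num)
  have : √3 / 2 * (√3 / 2) ≤ z.im * z.im := mul_self_le_mul_self (by positivity) him.le
  linarith

lemma card_le_A {k l : ℕ} (hk : 4 ≤ k) (hl : 4 ≤ l) (h0 : Delta hk hl ≠ 0) {T : Finset ℝ}
    (hT : ∀ t ∈ T, t ∈ Set.Ioo (Real.pi / 3) (Real.pi / 2) ∧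
      arcVal (Delta hk hl) (k + l) t = 0) : T.card ≤ A hk hl := by
  classical
  have hinj : Set.InjOn arcPt T := by
    intro s hs t ht hst
    obtain ⟨⟨hs1, hs2⟩, -⟩ := hT s hs
    obtain ⟨⟨ht1, ht2⟩, -⟩ := hT t ht
    have h := congrArg (fun z : ℍ => (z : ℂ).re) hst
    simp only [coe_arcPt (sin_pos_of_arc hs1 hs2.le), coe_arcPt (sin_pos_of_arc ht1 ht2.le),
      Complex.exp_ofReal_mul_I_re] at h
    exact Real.injOn_cos ⟨by linarith [Real.pi_pos], by linarith [Real.pi_pos]⟩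
      ⟨by linarith [Real.pi_pos], by linarith [Real.pi_pos]⟩ h
  rw [← Finset.card_image_of_injOn hinj, ← Set.ncard_coe_finset]
  refine Set.ncard_le_ncard ?_ (finite_arcZeros hk hl h0)
  intro z hz
  obtain ⟨t, ht, rfl⟩ := Finset.mem_image.1 (Finset.mem_coe.1 hz)
  obtain ⟨⟨h1, h2⟩, hz⟩ := hT t ht
  have hs := sin_pos_of_arc h1 h2.le
  refine ⟨⟨t, h1, h2, coe_arcPt hs⟩, ?_⟩
  have := ofReal_arcVal hk hl hs
  rw [hz, Complex.ofReal_zero] at this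
  exact (mul_eq_zero.1 this.symm).resolve_left (Complex.exp_ne_zero _)

lemma card_le_B {k l : ℕ} (hk : 4 ≤ k) (hl : 4 ≤ l) (h0 : Delta hk hl ≠ 0) {T : Finset ℝ}
    (hT : ∀ t ∈ T, √3 / 2 < t ∧ sideVal (Delta hk hl) t = 0) : T.card ≤ B hk hl := by
  classical
  have h3 : 0 < √3 / 2 := by positivity
  have hinj : Set.InjOn sidePt T := by
    intro s hs t ht hst
    have h := congrArg UpperHalfPlane.im hst
    rwa [sidePt_im (h3.trans (hT s hs).1), sidePt_im (h3.trans (hT t ht).1)] at h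
  rw [← Finset.card_image_of_injOn hinj, ← Set.ncard_coe_finset]
  refine Set.ncard_le_ncard ?_ (finite_sideZeros hk hl h0)
  intro z hz
  obtain ⟨t, ht, rfl⟩ := Finset.mem_image.1 (Finset.mem_coe.1 hz)
  obtain ⟨h1, hz⟩ := hT t ht
  have hpos := h3.trans h1
  refine ⟨sidePt_re hpos, by rwa [sidePt_im hpos], ?_⟩
  have := ofReal_sideVal hk hl hpos
  rw [hz, Complex.ofReal_zero] at this
  exact this.symm

lemma mul_neg_of_neg_one_pow_pos {p : ℕ} {x y : ℝ} (hx : 0 < (-1) ^ p * x)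
    (hy : 0 < (-1) ^ (p + 1) * y) : x * y < 0 := by
  have h := mul_pos hx hy
  have h1 : ((-1 : ℝ) ^ p) * (-1) ^ p = 1 := by rw [← mul_pow]; simp
  have : (-1) ^ p * x * ((-1) ^ (p + 1) * y) = -(x * y) := by
    rw [pow_succ]; linear_combination (-(x * y)) * h1
  linarith

/-- Zeros on the arc, counted through sign changes. -/
lemma exists_card_le_A : ∃ L : ℕ, ∀ (k l : ℕ) (hk : 4 ≤ k) (hl : 4 ≤ l), Even k → Even l →
    L ≤ l → l + 12 ≤ k → (k - l) / 4 ≤ A hk hl + ((k - l) / 6 + 1) ∧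
      ∀ q : ℕ, 0 < (-1) ^ q * (deltaCoef k l).re →
        (k - l) / 4 + (if ((k - l) / 6 + 1 + (q + (k + l + 2 * ((k + l) % 3)) / 6)) % 2 = 0 then 0
          else 1) ≤ A hk hl + ((k - l) / 6 + 1) := by
  obtain ⟨L, hL⟩ := exists_arcVal_pos
  refine ⟨L, fun k l hk hl hke hle hLl hkl => ?_⟩
  have hpi := Real.pi_pos
  set D := k - l with hD
  have hDe : D % 2 = 0 := by have := hke.two_dvd; have := hle.two_dvd; omega
  have hD0 : (0 : ℝ) < D := by exact_mod_cast (by omega : 0 < D)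
  -- The samples in (π/3, π/2] are those with D/6 < m ≤ D/4. As D ≥ 12 is even, m₀ ≤ ⌊D/4⌋, so the
  -- truncated difference D / 4 - m₀ is the true number of gaps.
  set m₀ := D / 6 + 1 with hm₀
  set x : ℕ → ℝ := fun i => 2 * Real.pi * (m₀ + i : ℕ) / D with hx
  have hpos : ∀ i ≤ D / 4 - m₀, 0 < (-1) ^ (m₀ + i) * arcVal (Delta hk hl) (k + l) (x i) :=
    fun i hi => hL k l (m₀ + i) hk hl hke hle hLl (by omega) (by omega) (by omega)
  have h0 : Delta hk hl ≠ 0 := fun h0 => by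
    have := hpos 0 (Nat.zero_le _)
    simp [h0, arcVal] at this
  have hxa : ∀ i ≤ D / 4 - m₀, Real.pi / 3 < x i := fun i _ => by
    have : (D : ℝ) < 6 * (m₀ + i : ℕ) := by exact_mod_cast (by omega : D < 6 * (m₀ + i))
    simp only [hx]
    rw [div_lt_div_iff₀ (by norm_num) hD0]
    nlinarith
  have hxb : ∀ i ≤ D / 4 - m₀, x i ≤ Real.pi / 2 := fun i hi => by
    have : 4 * ((m₀ + i : ℕ) : ℝ) ≤ D := by exact_mod_cast (by omega : 4 * (m₀ + i) ≤ D)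
    simp only [hx]
    rw [div_le_div_iff₀ hD0 (by norm_num)]
    nlinarith
  have hxs : ∀ i < D / 4 - m₀, x i < x (i + 1) := fun i _ => by
    simp only [hx]
    gcongr
    omega
  have hcont : ContinuousOn (arcVal (Delta hk hl) (k + l)) (Set.Ioc (Real.pi / 3) (Real.pi / 2)) :=
    fun θ hθ => (continuousAt_arcVal hk hl _ (sin_pos_of_arc hθ.1 hθ.2)).continuousWithinAt
  constructor
  · obtain ⟨T, hcard, hT⟩ := exists_finset_zeros hcont hxa hxb hxs fun i hi =>
      mul_neg_of_neg_one_pow_pos (hpos i hi.le) (hpos (i + 1) hi)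
    have := card_le_A hk hl h0 hT
    omega
  · intro q hq
    obtain ⟨T, hcard, hT⟩ := exists_finset_zeros_of_eventually hcont hxa hxb hxs hpos
      (eventually_arcVal_pos hk hl hke hle hq)
    have := card_le_A hk hl h0 hT
    rw [hcard] at this
    have : m₀ ≤ D / 4 := by omega
    omega

/-- Zeros on the half-line, counted through sign changes. -/
lemma exists_card_le_B : ∃ L : ℕ, ∀ (k l : ℕ) (hk : 4 ≤ k) (hl : 4 ≤ l), Even k → Even l →
    L ≤ l → l + 12 ≤ k → (l - 2) / 6 ≤ B hk hl + 1 ∧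
      ∀ q : ℕ, 0 < (-1) ^ q * (deltaCoef k l).re →
        (l - 2) / 6 + (if (l / 2 + (l - 2) / 6 + q) % 2 = 0 then 0 else 1) ≤ B hk hl + 1 := by
  obtain ⟨L, hL⟩ := exists_sideVal_sideSample_pos
  refine ⟨max L 41, fun k l hk hl hke hle hLl hkl => ?_⟩
  have hL1 : L ≤ l := (le_max_left _ _).trans hLl
  have hL2 : 41 ≤ l := (le_max_right _ _).trans hLl
  set M := (l - 2) / 6 with hM
  -- Heights fall as m grows, so the index is reversed to list the samples upwards from ρ.
  set x : ℕ → ℝ := fun i => sideSample l (M - i) with hx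
  have hpos : ∀ i ≤ M - 1, 0 < (-1) ^ (l / 2 + M + i) * sideVal (Delta hk hl) (x i) := fun i hi => by
    have h := hL k l (M - i) hk hl hke hle hL1 hkl (by omega) (by omega)
    have e : l / 2 + M + i = l / 2 + (M - i) + 2 * i := by omega
    rwa [e, pow_add _ _ (2 * i), pow_mul, neg_one_sq, one_pow, mul_one]
  have h0 : Delta hk hl ≠ 0 := fun h0 => by
    have := hpos 0 (Nat.zero_le _)
    simp [h0, sideVal] at this
  have hxa : ∀ i ≤ M - 1, √3 / 2 < x i := fun i _ =>
    sqrt_three_div_two_lt_sideSample hle hL2 (by omega) (by omega)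
  have hxs : ∀ i < M - 1, x i < x (i + 1) := fun i hi => by
    have h := sideSample_succ_lt (m := M - (i + 1)) hle (by omega) (by omega)
    rwa [show M - (i + 1) + 1 = M - i by omega] at h
  have hxb : ∀ i ≤ M - 1, x i ≤ x (M - 1) := fun i hi => by
    induction hi using Nat.decreasingInduction with
    | self => exact le_rfl
    | of_succ i hi ih => exact (hxs i hi).le.trans ih
  have hcont : ContinuousOn (sideVal (Delta hk hl)) (Set.Ioc (√3 / 2) (x (M - 1))) :=
    fun y hy => (continuousAt_sideVal hk hl
      ((by positivity : 0 < √3 / 2).trans hy.1)).continuousWithinAt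
  constructor
  · obtain ⟨T, hcard, hT⟩ := exists_finset_zeros hcont hxa hxb hxs fun i hi =>
      mul_neg_of_neg_one_pow_pos (hpos i hi.le) (hpos (i + 1) hi)
    have := card_le_B hk hl h0 fun t ht => ⟨(hT t ht).1.1, (hT t ht).2⟩
    omega
  · intro q hq
    obtain ⟨T, hcard, hT⟩ := exists_finset_zeros_of_eventually hcont hxa hxb hxs hpos
      (eventually_sideVal_pos hk hl hke hle hq)
    have := card_le_B hk hl h0 fun t ht => ⟨(hT t ht).1.1, (hT t ht).2⟩
    rw [hcard] at this
    omega

lemma exists_neg_one_pow_mul_pos {x : ℝ} (hx : x ≠ 0) : ∃ q : ℕ, 0 < (-1) ^ q * x := by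
  rcases hx.lt_or_gt with h | h
  · exact ⟨1, by simpa using h⟩
  · exact ⟨0, by simpa using h⟩

/-- The parities of the two gap conditions differ in every class except k ≡ 0 with ℓ ≡ 0 or 2 mod 6,
so exactly one `if` contributes for either value of q mod 2. For k ≡ ℓ ≡ 0 the parities agree and q
= 0 makes both contribute. -/
lemma add_sub_tableOffset_le {n j r c q a b : ℕ} (hc : c = 0 ∨ c = 2 ∨ c = 4)
    (hj : j = 0 ∨ j = 2 ∨ j = 4 ∨ j = 6 ∨ j = 8 ∨ j = 10)
    (hA : 3 * n + j / 4 + (if (j / 6 + 1 + q + (2 * c + j + 2 * ((j + 2 * c) % 3)) / 6) % 2 = 0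
      then 0 else 1) ≤ a + (2 * n + j / 6 + 1))
    (hB : r + (if (c / 2 + (if c = 0 then 1 else 0) + q) % 2 = 0 then 0 else 1) ≤
      b + 1 + (if c = 0 then 1 else 0))
    (hq : c = 0 → j % 6 = 0 → q = 0) (h : ¬ (c = 2 ∧ (c + j) % 6 = 0)) :
    (n : ℤ) + r - tableOffset j c ≤ a + b := by
  rcases hc with rfl | rfl | rfl <;> rcases hj with rfl | rfl | rfl | rfl | rfl | rfl <;>
    simp only [tableOffset] <;> norm_num at hA hB hq h <;> split_ifs at hA hB <;> omega

/-- Lower bound for the number of zeros of `Δ_{k,ℓ}` on the arc and the half-line. -/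
theorem exists_tableValue_le : ∃ L : ℕ, ∀ (k l n j : ℕ) (hk : 4 ≤ k) (hl : 4 ≤ l),
    Even k → Even l → L ≤ l → l ≤ k → k - l = 12 * n + j → j < 12 → 1 ≤ n →
      tableValue n j l ≤ (A hk hl : ℤ) + (B hk hl : ℤ) := by
  obtain ⟨L₁, h₁⟩ := exists_card_le_A
  obtain ⟨L₂, h₂⟩ := exists_card_le_B
  obtain ⟨L₃, h₃⟩ := exists_deltaCoef_re_pos
  obtain ⟨L₄, h₄⟩ := exists_deltaCoef_re_ne_zero
  refine ⟨L₁ + L₂ + L₃ + L₄ + 8, fun k l n j hk hl hke hle hLl hlk hkl hj hn => ?_⟩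
  obtain ⟨hA, hA'⟩ := h₁ k l hk hl hke hle (by omega) (by omega)
  obtain ⟨hB, hB'⟩ := h₂ k l hk hl hke hle (by omega) (by omega)
  have hpos := h₃ k l hke hle (by omega) hlk hl
  have hne := h₄ k l hke hle (by omega) hlk hl
  have hk2 := hke.two_dvd
  have hl2 := hle.two_dvd
  obtain ⟨r, c, hlr, hc⟩ : ∃ r c, l = 6 * r + c ∧ (c = 0 ∨ c = 2 ∨ c = 4) :=
    ⟨l / 6, l % 6, by omega, by omega⟩
  have hl6 : l % 6 = c := by omega
  have hl6' : l / 6 = r := by omega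
  have hk6 : k % 6 = (c + j) % 6 := by omega
  have e1 : (l - 2) / 6 + (if c = 0 then 1 else 0) = r ∧
      (l / 2 + (l - 2) / 6) % 2 = (c / 2 + (if c = 0 then 1 else 0)) % 2 := by
    clear hA hB hpos hne h₁ h₂ h₃ h₄ hA' hB'
    rcases hc with rfl | rfl | rfl <;> simp <;> omega
  obtain ⟨e1, e3⟩ := e1
  have e2 : ∀ q, ((k - l) / 6 + 1 + (q + (k + l + 2 * ((k + l) % 3)) / 6)) % 2 =
      (j / 6 + 1 + q + (2 * c + j + 2 * ((j + 2 * c) % 3)) / 6) % 2 := fun q => by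
    clear hA hB hpos hne h₁ h₂ h₃ h₄ hA' hB' hc e1 e3
    rw [show (k + l) % 3 = (j + 2 * c) % 3 by omega]
    omega
  have hj' : j = 0 ∨ j = 2 ∨ j = 4 ∨ j = 6 ∨ j = 8 ∨ j = 10 := by
    clear hA hB hpos hne h₁ h₂ h₃ h₄ hA' hB' hc e1 e2 e3
    omega
  rw [tableValue, hl6, hl6']
  by_cases hc2 : c = 2 ∧ (c + j) % 6 = 0
  -- For ℓ ≡ 2 and k ≡ 0 mod 6 the sign changes between samples already reach the table value, and
  -- nothing about ρ is needed.
  · obtain ⟨rfl, hcj⟩ := hc2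
    rw [if_neg (by norm_num)] at e1
    have hjj : j = 4 ∨ j = 10 := by omega
    rcases hjj with rfl | rfl <;> simp only [tableOffset] <;> omega
  · obtain ⟨q, hq, hq0⟩ : ∃ q : ℕ, 0 < (-1) ^ q * (deltaCoef k l).re ∧
        (c = 0 → j % 6 = 0 → q = 0) := by
      by_cases hc0 : c = 0 ∧ j % 6 = 0
      · exact ⟨0, by simpa using hpos (by rw [hk6, hc0.1, zero_add, hc0.2]) (hl6.trans hc0.1), fun _ _ => rfl⟩
      · obtain ⟨q, hq⟩ := exists_neg_one_pow_mul_pos (hne (by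
          rw [hl6, hk6]
          rcases hc with rfl | rfl | rfl
          · exact Or.inl ⟨rfl, by simpa using hc0⟩
          · exact Or.inr (Or.inl ⟨rfl, by simpa using hc2⟩)
          · exact Or.inr (Or.inr rfl)))
        exact ⟨q, hq, fun h h' => absurd ⟨h, h'⟩ hc0⟩
    replace hA' := hA' q hq
    replace hB' := hB' q hq
    rw [e2, hkl] at hA'
    rw [Nat.add_mod, e3, ← Nat.add_mod] at hB'
    clear hA hB hpos hne h₁ h₂ h₃ h₄ e2 e3
    exact add_sub_tableOffset_le hc hj' (by clear hc hj'; omega) (by clear hc hj' hA'; omega) hq0 hc2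

end EisensteinZeros

theorem mainTheorem10 :
    ∃ L : ℕ, ∀ (k l n j : ℕ) (hk : 4 ≤ k) (hl : 4 ≤ l),
      Even k → Even l → L ≤ l → l ≤ k →
      k - l = 12 * n + j → j < 12 → 1 ≤ n →
      EisensteinZeros.sp j l ≤ (k : ℝ) →
        EisensteinZeros.tableValue n j l ≤
            (EisensteinZeros.A hk hl : ℤ) + (EisensteinZeros.B hk hl : ℤ) ∧
        ∀ f : CuspForm 𝒮ℒ ((k + l : ℕ) : ℤ), f ≠ 0 →
          EisensteinZeros.nontrivialZeroCount (k + l) f =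
            (EisensteinZeros.tableValue n j l : ℚ) := by
  obtain ⟨L, hL⟩ := EisensteinZeros.exists_tableValue_le
  refine ⟨L, fun k l n j hk hl hke hle hLl hlk hkl hj hn _ =>
    ⟨hL k l n j hk hl hke hle hLl hlk hkl hj hn, fun f hf => ?_⟩⟩
  rw [EisensteinZeros.nontrivialZeroCount_eq f hf,
    EisensteinZeros.tableValue_eq hke hle hlk hkl hj]
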